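/- \textbf{Notation.} Let $n\ge 0$ (for $n=0$ everything is trivial) and let $C^r(\mathbb T;\mathbb R^n)$ be the space of $2\pi$-periodic $C^r$ functions $x:\mathbb R\to\mathbb R^n$ with norm $\|x\|_r=\max_{i\le r}\sup_t|x^{(i)}(t)|$. For $x\in C^0(\mathbb T;\mathbb R^n)$ put $\|x\|_{0,1}=\max\{\|x\|_0,\sup_{s\ne t}|x(s)-x(t)|/|s-t|\}\in[0,\infty]$, let $C^{0,1}(\mathbb T;\mathbb R^n)=\{x:\|x\|_{0,1}<\infty\}$ and $B^{0,1}_\rho(x_0)=\{x:\|x-x_0\|_{0,1}\le\rho\}$; $C^{1,1}(\mathbb T;\mathbb R^n)$ is the set of $x\in C^1(\mathbb T;\mathbb R^n)$ with Lipschitz continuous derivative. Define $D_0^r=C^r(\mathbb T;\mathbb R^n)$, $D_{j+1}^r=D_j^{r+1}\times D_j^r$ with maximum norms, and $D_j=D_j^0$. A functional $g:D_j\to\mathbb R^m$ is $EC^0$ smooth if it is continuous. It is $EC^{k+1}$ smooth if it is continuous and there is a map $\partial^1 g:D_j^1\times D_j\to\mathbb R^m$, jointly continuous, linear in its second argument,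 with $\lim_{v\in D_j^1,\,\|v\|_{D_j^1}\to0}|g(u+v)-g(u)-\partial^1g(u,v)|/\|v\|_{D_j^1}=0$ for all $u\in D_j^1$, such that $\partial^1g$, as a functional on $D_{j+1}=D_j^1\times D_j$, is $EC^k$ smooth. For a continuous $f:C^0(\mathbb T;\mathbb R^n)\to\mathbb R^n$ let $F(x)(t)=f(\Delta_tx)$, where $(\Delta_tx)(s)=x(t+s)$. Let $R_Nx=(c_k)_{k=-N}^N\in\mathbb R^{n\times(2N+1)}$ be the real Fourier coefficients of $x$: $c_0=\frac1{2\pi}\int_{-\pi}^\pi x(s)\,ds$, $c_k=\frac1\pi\int_{-\pi}^\pi\cos(ks)x(s)\,ds$, $c_{-k}=\frac1\pi\int_{-\pi}^\pi\sin(ks)x(s)\,ds$ for $1\le k\le N$. Let $(E_Np)(t)=p_0+\sum_{k=1}^N[p_k\cos(kt)+p_{-k}\sin(kt)]$, $P_N=E_NR_N$, $Q_N=I-P_N$, $(Lx)(t)=\int_0^t(x(s)-R_0x)\,ds$. \textbf{Theorem (Smoothness of the algebraic system and of $X$).} Let $j_{\max}\ge0$, let $f:C^0(\mathbb T;\mathbb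 R^n)\to\mathbb R^n$ be $EC^{j_{\max}}$ smooth and let $x_0\in C^{1,1}(\mathbb T;\mathbb R^n)$. (a) If $j_{\max}\ge1$, there are $\delta,R,K>0$ such that, for all $x,y\in B_{6\delta}^{0,1}(x_0)$, $$\|F(x)\|_{0,1}\le R,\qquad \|F(x)-F(y)\|_0\le K\|x-y\|_0.\tag{1}$$ (b) Let $\delta,R,K>0$ be any numbers for which (1) holds. Then all sufficiently large $N$ satisfy $$\|Q_Nx_0\|_{0,1}\le2\delta,\qquad \|Q_NLx\|_{0,1}\le\tfrac{2\delta}{R}\|x\|_{0,1}\ (x\in C^{0,1}(\mathbb T;\mathbb R^n)),\qquad \|Q_NLx\|_0\le\tfrac1{2K}\|x\|_0\ (x\in C^0(\mathbb T;\mathbb R^n)).\tag{2}$$ Let $N\ge0$ be any integer satisfying (2), and let $U=\{p\in\mathbb R^{n\times(2N+1)}:\|E_N[p-R_Nx_0]\|_{0,1}<2\delta\}$. For every $p\in U$ the equation $x=E_Np+Q_NLF(x)$ has a unique solution $x=X(p)$ in $B_{6\delta}^{0,1}(x_0)$. Put $X_0=X$, $Y_0=F\circ X$, $D(X_0)=U$,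 $n_0=n(2N+1)$, $n_j=2^jn_0$ and $D(X_j)=D(X_{j-1})\times\mathbb R^{n_{j-1}}\subseteq\mathbb R^{n_j}$. Then for all $j\le j_{\max}$ the maps $$X_j:D(X_j)\to D_j,\quad X_j(p,q)=[X_{j-1}(p),\partial X_{j-1}(p)q],\qquad Y_j:D(X_j)\to D_j,\quad Y_j(p,q)=[Y_{j-1}(p),\partial Y_{j-1}(p)q]\qquad(j\ge1)$$ exist and are continuous, as are $X_0,Y_0:U\to D_0$. Existence of $X_j$ means that $X_{j-1}:D(X_{j-1})\to D_{j-1}$ has a Fr\'echet derivative $\partial X_{j-1}(p)$ at every $p\in D(X_{j-1})$ and that $X_{j-1}(p)\in D_{j-1}^1$, so that $X_j(p,q)\in D_{j-1}^1\times D_{j-1}=D_j$; likewise for $Y_j$. -/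

import Mathlib

noncomputable section

namespace PerBVP

open Filter Topology Asymptotics
open scoped BoundedContinuousFunction ENNReal ContDiff

/-- The space `ℝⁿ`. -/
abbrev E (n : ℕ) : Type := EuclideanSpace ℝ (Fin n)

/-! ### The spaces `Cʳ(𝕋; ℝⁿ)` of periodic functions -/

/-- The `2π`-periodic functions `ℝ → ℝⁿ` of class `Cʳ`, as a linear space. -/
def perSubmodule (n r : ℕ) : Submodule ℝ (ℝ → E n) where
  carrier := {x | ContDiff ℝ r x ∧ Function.Periodic x (2 * Real.pi)}
  add_mem' := fun hx hy => ⟨hx.1.add hy.1, hx.2.add hy.2⟩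
  zero_mem' := ⟨contDiff_const, fun _ => rfl⟩
  smul_mem' := fun c _ hx => ⟨contDiff_const.smul hx.1, fun t => congrArg (c • ·) (hx.2 t)⟩

/-- The space `Cʳ(𝕋; ℝⁿ)`. Its norm `max_{i ≤ r} sup_t |x⁽ⁱ⁾(t)|` is introduced below. -/
def CT (n r : ℕ) : Type := perSubmodule n r

namespace CT

variable {n r : ℕ}

instance : CoeFun (CT n r) (fun _ => ℝ → E n) := ⟨fun x => x.1⟩

/-- The linear structure is the pointwise one. -/
instance instAddCommGroup : AddCommGroup (CT n r) :=
  inferInstanceAs (AddCommGroup (perSubmodule n r))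

instance instModule : Module ℝ (CT n r) :=
  inferInstanceAs (Module ℝ (perSubmodule n r))

/-- Constructor. -/
def mk (x : ℝ → E n) (h : ContDiff ℝ r x) (hp : Function.Periodic x (2 * Real.pi)) : CT n r :=
  ⟨x, h, hp⟩

@[simp] theorem mk_apply (x : ℝ → E n) (h : ContDiff ℝ r x)
    (hp : Function.Periodic x (2 * Real.pi)) (t : ℝ) : (mk x h hp : CT n r) t = x t := rfl

@[ext] theorem ext {x y : CT n r} (h : ∀ t, x t = y t) : x = y := Subtype.ext (funext h)

theorem contDiff (x : CT n r) : ContDiff ℝ r (fun t => x t) := x.2.1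

theorem periodic (x : CT n r) : Function.Periodic (fun t => x t) (2 * Real.pi) := x.2.2

@[simp] theorem add_apply (x y : CT n r) (t : ℝ) : (x + y) t = x t + y t := rfl
@[simp] theorem sub_apply (x y : CT n r) (t : ℝ) : (x - y) t = x t - y t := rfl
@[simp] theorem smul_apply (c : ℝ) (x : CT n r) (t : ℝ) : (c • x) t = c • x t := rfl
@[simp] theorem zero_apply (t : ℝ) : (0 : CT n r) t = 0 := rfl

theorem iteratedDeriv_periodic (x : CT n r) (i : ℕ) :
    Function.Periodic (iteratedDeriv i (fun t => x t)) (2 * Real.pi) := by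
  intro t
  have h := congrFun (iteratedDeriv_comp_add_const i (fun t => x t) (2 * Real.pi)) t
  rw [← h]
  congr 1
  funext s
  exact x.periodic s

/-- The `i`-th derivative (`i ≤ r`), as a bounded continuous function on `ℝ`. -/
def derivBCF (x : CT n r) (i : Fin (r + 1)) : ℝ →ᵇ E n :=
  BoundedContinuousFunction.mkOfBound
    ⟨iteratedDeriv i (fun t => x t),
      x.contDiff.continuous_iteratedDeriv i (by exact_mod_cast Nat.lt_succ_iff.mp i.2)⟩
    (Metric.diam (Set.range (iteratedDeriv i (fun t => x t))))
    (fun s t => Metric.dist_le_diam_of_mem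
      ((x.iteratedDeriv_periodic i).isBounded_of_continuous (by positivity)
        (x.contDiff.continuous_iteratedDeriv i (by exact_mod_cast Nat.lt_succ_iff.mp i.2)))
      (Set.mem_range_self s) (Set.mem_range_self t))

@[simp] theorem derivBCF_apply (x : CT n r) (i : Fin (r + 1)) (t : ℝ) :
    x.derivBCF i t = iteratedDeriv i (fun t => x t) t := rfl

/-- The vector `(x, x', …, x⁽ʳ⁾)` of derivatives. -/
def jet (n r : ℕ) : CT n r →ₗ[ℝ] (Fin (r + 1) → ℝ →ᵇ E n) where
  toFun x i := x.derivBCF i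
  map_add' x y := by
    funext i
    ext1 t
    have hi : ((i : ℕ) : ℕ∞ω) ≤ (r : ℕ∞ω) := by exact_mod_cast Nat.lt_succ_iff.mp i.2
    exact iteratedDeriv_add (x.contDiff.contDiffAt.of_le hi) (y.contDiff.contDiffAt.of_le hi)
  map_smul' c x := by
    funext i
    ext1 t
    have hi : ((i : ℕ) : ℕ∞ω) ≤ (r : ℕ∞ω) := by exact_mod_cast Nat.lt_succ_iff.mp i.2
    exact iteratedDeriv_const_smul (x.contDiff.contDiffAt.of_le hi) c

theorem jet_injective (n r : ℕ) : Function.Injective (jet n r) := by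
  intro x y h
  ext1 t
  have h0 := congrArg (fun g : ℝ →ᵇ E n => g t) (congrFun h 0)
  simpa [jet] using h0

/-- The norm of `Cʳ(𝕋; ℝⁿ)`, which is `max_{i ≤ r} sup_t |x⁽ⁱ⁾(t)|` (see `norm_le_iff`). -/
instance instNormedAddCommGroup : NormedAddCommGroup (CT n r) :=
  NormedAddCommGroup.induced (CT n r) (Fin (r + 1) → ℝ →ᵇ E n) (jet n r) (jet_injective n r)

instance instNormedSpace : NormedSpace ℝ (CT n r) :=
  NormedSpace.induced ℝ (CT n r) (Fin (r + 1) → ℝ →ᵇ E n) (jet n r)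

theorem norm_le_iff (x : CT n r) {c : ℝ} (hc : 0 ≤ c) :
    ‖x‖ ≤ c ↔ ∀ i ≤ r, ∀ t, ‖iteratedDeriv i (fun t => x t) t‖ ≤ c := by
  have h : ‖x‖ = ‖jet n r x‖ := rfl
  rw [h, pi_norm_le_iff_of_nonneg hc]
  constructor
  · intro H i hi t
    exact (BoundedContinuousFunction.norm_le hc).1 (H ⟨i, Nat.lt_succ_iff.mpr hi⟩) t
  · intro H i
    exact (BoundedContinuousFunction.norm_le hc).2 (H i (Nat.lt_succ_iff.mp i.2))

/-- The inclusion `Cʳ⁺¹(𝕋; ℝⁿ) ⊆ Cʳ(𝕋; ℝⁿ)`. -/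
def incl (x : CT n (r + 1)) : CT n r :=
  mk (fun t => x t) (x.contDiff.of_le (by exact_mod_cast Nat.le_succ r)) x.periodic

/-- The time shift `[Δ_t x](s) = x(t + s)`. -/
def shift (t : ℝ) (x : CT n r) : CT n r :=
  mk (fun s => x (t + s)) (x.contDiff.comp (contDiff_const.add contDiff_id))
    (fun s => by
      have h := x.periodic (t + s)
      simpa [add_assoc] using h)

theorem uniformContinuous (x : CT n r) : UniformContinuous (fun t => x t) := by
  have : Fact (0 < 2 * Real.pi) := ⟨by positivity⟩
  have hc : Continuous (x.periodic.lift) :=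
    continuous_coinduced_dom.mpr x.contDiff.continuous
  have h1 : UniformContinuous (x.periodic.lift) :=
    CompactSpace.uniformContinuous_of_continuous hc
  have h2 : UniformContinuous (fun t : ℝ => (t : AddCircle (2 * Real.pi))) :=
    uniformContinuous_of_continuousAt_zero (QuotientAddGroup.mk' _)
      (AddCircle.continuous_mk' (2 * Real.pi)).continuousAt
  exact h1.comp h2

theorem continuous_shift (x : CT n 0) : Continuous (fun t => shift t x) := by
  rw [Metric.continuous_iff]
  intro t ε hε
  obtain ⟨δ, hδ, H⟩ := Metric.uniformContinuous_iff.1 x.uniformContinuous (ε / 2) (half_pos hε)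
  refine ⟨δ, hδ, fun s hs => ?_⟩
  rw [dist_eq_norm]
  refine lt_of_le_of_lt ((norm_le_iff _ (half_pos hε).le).2 ?_) (half_lt_self hε)
  intro i hi u
  obtain rfl : i = 0 := Nat.le_zero.mp hi
  have h := H (a := s + u) (b := t + u) (by simpa using hs)
  rw [iteratedDeriv_zero]
  exact (dist_eq_norm (x (s + u)) (x (t + u)) ▸ h).le

/-- The Lipschitz norm `‖x‖_{0,1} = max {‖x‖₀, sup_{s ≠ t} |x(s) - x(t)| / |s - t|}`, with the
value `∞` if `x` is not Lipschitz continuous, so that `C^{0,1}(𝕋; ℝⁿ)` consists of the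
`x ∈ C⁰(𝕋; ℝⁿ)` with `lipNorm x < ∞`. -/
def lipNorm (x : CT n 0) : ℝ≥0∞ :=
  max ‖x‖ₑ (⨆ (s : ℝ) (t : ℝ) (_ : s ≠ t), ‖x s - x t‖ₑ / ‖s - t‖ₑ)

/-- The closed ball `B_ρ^{0,1}(x₀)`. -/
def lipBall (x₀ : CT n 0) (ρ : ℝ) : Set (CT n 0) :=
  {x | lipNorm (x - x₀) ≤ ENNReal.ofReal ρ}

end CT

/-! ### The product spaces `D_j` -/

/-- `D n j r` is the space `D_j^r`, where `D_0^r = Cʳ(𝕋; ℝⁿ)` and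
`D_{j+1}^r = D_j^{r+1} × D_j^r`. In particular `D_j = D_j^0`. -/
def D (n : ℕ) : ℕ → ℕ → Type
  | 0, r => CT n r
  | j + 1, r => D n j (r + 1) × D n j r

/-- The norm of `D_j^r` is the maximum of the norms of the components. -/
instance D.instNormedAddCommGroup (n : ℕ) : ∀ j r, NormedAddCommGroup (D n j r)
  | 0, r => inferInstanceAs (NormedAddCommGroup (CT n r))
  | j + 1, r =>
    letI := D.instNormedAddCommGroup n j (r + 1)
    letI := D.instNormedAddCommGroup n j r
    inferInstanceAs (NormedAddCommGroup (D n j (r + 1) × D n j r))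

instance D.instNormedSpace (n : ℕ) : ∀ j r, NormedSpace ℝ (D n j r)
  | 0, r => inferInstanceAs (NormedSpace ℝ (CT n r))
  | j + 1, r =>
    letI := D.instNormedSpace n j (r + 1)
    letI := D.instNormedSpace n j r
    inferInstanceAs (NormedSpace ℝ (D n j (r + 1) × D n j r))

/-- The pair `(u, v) ∈ D_j^{r+1} × D_j^r` as an element of `D_{j+1}^r`. -/
def D.pair {n j r : ℕ} (u : D n j (r + 1)) (v : D n j r) : D n (j + 1) r := (u, v)

/-- First component of an element of `D_{j+1}^r = D_j^{r+1} × D_j^r`. -/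
def D.fst {n j r : ℕ} (w : D n (j + 1) r) : D n j (r + 1) := Prod.fst w

/-- Second component of an element of `D_{j+1}^r = D_j^{r+1} × D_j^r`. -/
def D.snd {n j r : ℕ} (w : D n (j + 1) r) : D n j r := Prod.snd w

/-- The inclusion `D_j^{r+1} ⊆ D_j^r`. -/
def D.incl {n : ℕ} : ∀ {j r : ℕ}, D n j (r + 1) → D n j r
  | 0, _, x => CT.incl x
  | _ + 1, _, w => D.pair (D.incl (D.fst w)) (D.incl (D.snd w))

/-! ### Extendable continuous differentiability -/

/-- `df : D_j^1 × D_j → ℝᵐ` is an extendable continuous derivative of `f : D_j → ℝᵐ`: it is linear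
in its second argument, continuous in both arguments jointly, and
`|f(u + v) - f(u) - df(u, v)| / ‖v‖_{D_j^1} → 0` as `v → 0` in `D_j^1`, for all `u ∈ D_j^1`. -/
structure IsExtDeriv {n m j : ℕ} (f : D n j 0 → E m) (df : D n j 1 → D n j 0 →ₗ[ℝ] E m) :
    Prop where
  continuous : Continuous (fun w : D n j 1 × D n j 0 => df w.1 w.2)
  isLittleO : ∀ u : D n j 1,
    (fun v : D n j 1 => f (D.incl (u + v)) - f (D.incl u) - df u (D.incl v)) =o[𝓝 0]
      (fun v : D n j 1 => v)

/-- `IsEC k f`: the functional `f : D_j → ℝᵐ` is `EC^k` smooth, i.e. it is continuous and, for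
`k ≥ 1`, it has an extendable continuous derivative `∂¹f : D_{j+1} = D_j^1 × D_j → ℝᵐ` that is
`EC^{k-1}` smooth. -/
def IsEC {n m : ℕ} : ℕ → ∀ {j : ℕ}, (D n j 0 → E m) → Prop
  | 0, _, f => Continuous f
  | k + 1, j, f => Continuous f ∧ ∃ df : D n j 1 → D n j 0 →ₗ[ℝ] E m,
      IsExtDeriv f df ∧ IsEC k (fun w : D n (j + 1) 0 => df (D.fst w) (D.snd w))

/-! ### The operator `F`, the Fourier projections and the fixed point problem -/

/-- The operator `[F(x)](t) = f(Δ_t x)`. -/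
def opF {n : ℕ} (f : C(CT n 0, E n)) (x : CT n 0) : CT n 0 :=
  CT.mk (fun t => f (CT.shift t x))
    (contDiff_zero.2 (f.continuous.comp x.continuous_shift))
    (fun t => by
      refine congrArg f (CT.ext fun s => ?_)
      have h := x.periodic (t + s)
      show x (t + 2 * Real.pi + s) = x (t + s)
      rw [add_right_comm]
      exact h)

theorem opF_apply {n : ℕ} (f : C(CT n 0, E n)) (x : CT n 0) (t : ℝ) :
    opF f x t = f (CT.shift t x) := rfl

/-- The Fourier modes: the constant `1` for `k = 0`, and `cos (k t)` for index `k > 0`,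
`sin (k t)` for index `-k < 0`. -/
def mode (k : ℤ) (t : ℝ) : ℝ :=
  if k = 0 then 1 else if 0 < k then Real.cos (k * t) else Real.sin (-k * t)

/-- The space `ℝ^{n × (2N+1)}` of coefficient vectors, indexed by `k = -N, …, N`. -/
abbrev Coeff (n N : ℕ) : Type := Finset.Icc (-(N : ℤ)) (N : ℤ) → E n

/-- `[E_N p](t) = ∑_{k=-N}^N p_k b_k(t)`. -/
def opE {n : ℕ} (N : ℕ) (p : Coeff n N) : CT n 0 :=
  CT.mk (fun t => ∑ k : Finset.Icc (-(N : ℤ)) (N : ℤ), mode k t • p k)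
    (by
      refine contDiff_zero.2 (continuous_finsetSum _ fun k _ => ?_)
      unfold mode
      split_ifs <;> fun_prop)
    (fun t => by
      refine Finset.sum_congr rfl fun k _ => ?_
      congr 1
      unfold mode
      split_ifs
      · rfl
      · rw [mul_add]; exact Real.cos_add_int_mul_two_pi _ _
      · have h := Real.sin_add_int_mul_two_pi (-(k : ℤ) * t) (-(k : ℤ))
        rw [mul_add]
        simpa using h)

theorem opE_apply {n : ℕ} (N : ℕ) (p : Coeff n N) (t : ℝ) :
    opE N p t = ∑ k : Finset.Icc (-(N : ℤ)) (N : ℤ), mode k t • p k := rfl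

/-- The first `2N+1` Fourier coefficients of `x`: `[R_N x]_k = (1/π) ∫_{-π}^π b_k(s) x(s) ds` for
`k ≠ 0`, and `[R_N x]_0 = (1/(2π)) ∫_{-π}^π x(s) ds`, the average of `x`. -/
def opR {n : ℕ} (N : ℕ) (x : CT n 0) : Coeff n N := fun k =>
  (if (k : ℤ) = 0 then 1 / (2 * Real.pi) else 1 / Real.pi) •
    ∫ s in (-Real.pi)..Real.pi, mode k s • x s

/-- The projection `P_N = E_N R_N` onto the span of the modes `b_{-N}, …, b_N`. -/
def opP {n : ℕ} (N : ℕ) (x : CT n 0) : CT n 0 := opE N (opR N x)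

/-- The projection `Q_N = I - P_N`. -/
def opQ {n : ℕ} (N : ℕ) (x : CT n 0) : CT n 0 := x - opP N x

/-- The average of `x` over a period. -/
def average {n : ℕ} (x : CT n 0) : E n :=
  (1 / (2 * Real.pi)) • ∫ s in (-Real.pi)..Real.pi, x s

/-- The anti-derivative `[L x](t) = ∫_0^t (x(s) - R_0 x) ds`, where `R_0 x` is the average. -/
def opL {n : ℕ} (x : CT n 0) : CT n 0 :=
  CT.mk (fun t => ∫ s in (0 : ℝ)..t, (x s - average x))
    (contDiff_zero.2 (intervalIntegral.continuous_primitive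
      (fun a b => (x.contDiff.continuous.sub continuous_const).intervalIntegrable a b) 0))
    (fun t => by
      have hc : Continuous (fun s => x s - average x) :=
        x.contDiff.continuous.sub continuous_const
      have hp : Function.Periodic (fun s => x s - average x) (2 * Real.pi) :=
        fun s => congrArg (fun v => v - average x) (x.periodic s)
      have h0 : ∫ s in t..(t + 2 * Real.pi), (x s - average x) = 0 := by
        rw [hp.intervalIntegral_add_eq t (-Real.pi)]
        have e : -Real.pi + 2 * Real.pi = Real.pi := by ring
        rw [e, intervalIntegral.integral_sub (x.contDiff.continuous.intervalIntegrable _ _)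
          (continuous_const.intervalIntegrable _ _), intervalIntegral.integral_const]
        have e2 : Real.pi - -Real.pi = 2 * Real.pi := by ring
        rw [e2, average, smul_smul, mul_one_div_cancel (by positivity), one_smul, sub_self]
      have h1 := intervalIntegral.integral_add_adjacent_intervals
        (hc.intervalIntegrable (μ := MeasureTheory.volume) 0 t)
        (hc.intervalIntegrable (μ := MeasureTheory.volume) t (t + 2 * Real.pi))
      rw [h0, add_zero] at h1
      exact h1.symm)

theorem opL_apply {n : ℕ} (x : CT n 0) (t : ℝ) :
    opL x t = ∫ s in (0 : ℝ)..t, (x s - average x) := rfl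

/-- The map `M_N(x, p) = E_N p + Q_N L F(x)`. -/
def opM {n : ℕ} (f : C(CT n 0, E n)) (N : ℕ) (x : CT n 0) (p : Coeff n N) : CT n 0 :=
  opE N p + opQ N (opL (opF f x))

/-- `x₀ ∈ C^{1,1}(𝕋; ℝⁿ)`. -/
def IsC11 {n : ℕ} (x₀ : CT n 1) : Prop := ∃ c, LipschitzWith c (deriv (fun t => x₀ t))

/-- The bounds `‖F(x)‖_{0,1} ≤ R` and `‖F(x) - F(y)‖₀ ≤ K ‖x - y‖₀` for all `x, y` in
`B_{6δ}^{0,1}(x₀)`. -/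
def HasBounds {n : ℕ} (f : C(CT n 0, E n)) (x₀ : CT n 1) (δ R K : ℝ) : Prop :=
  (∀ x ∈ CT.lipBall x₀.incl (6 * δ), CT.lipNorm (opF f x) ≤ ENNReal.ofReal R) ∧
  ∀ x ∈ CT.lipBall x₀.incl (6 * δ), ∀ y ∈ CT.lipBall x₀.incl (6 * δ),
    ‖opF f x - opF f y‖ ≤ K * ‖x - y‖

/-- `N` is large enough: `‖Q_N x₀‖_{0,1} ≤ 2δ`, `‖Q_N L‖_{0,1} ≤ 2δ/R` and
`‖Q_N L‖₀ ≤ 1/(2K)`, with the operator norms on `C^{0,1}(𝕋; ℝⁿ)` and `C⁰(𝕋; ℝⁿ)`. -/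
def LargeEnough {n : ℕ} (x₀ : CT n 1) (δ R K : ℝ) (N : ℕ) : Prop :=
  CT.lipNorm (opQ N x₀.incl) ≤ ENNReal.ofReal (2 * δ) ∧
  (∀ x : CT n 0, CT.lipNorm x < ⊤ →
    CT.lipNorm (opQ N (opL x)) ≤ ENNReal.ofReal (2 * δ / R) * CT.lipNorm x) ∧
  ∀ x : CT n 0, ‖opQ N (opL x)‖ ≤ 1 / (2 * K) * ‖x‖

/-- The domain `U = {p : ‖E_N (p - R_N x₀)‖_{0,1} < 2δ}` of the map `X`. -/
def domU {n : ℕ} (x₀ : CT n 1) (δ : ℝ) (N : ℕ) : Set (Coeff n N) :=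
  {p | CT.lipNorm (opE N (p - opR N x₀.incl)) < ENNReal.ofReal (2 * δ)}

/-- `X(p)` is, for every `p ∈ U`, the fixed point of `M_N(·, p)` in `B_{6δ}^{0,1}(x₀)`. -/
def IsFixedPointMap {n : ℕ} (f : C(CT n 0, E n)) (x₀ : CT n 1) (δ : ℝ) (N : ℕ)
    (X : Coeff n N → CT n 0) : Prop :=
  ∀ p ∈ domU x₀ δ N, X p ∈ CT.lipBall x₀.incl (6 * δ) ∧ X p = opM f N (X p) p

/-! ### Iterated maps -/

/-- The parameter spaces `ℝ^{n_j}`, `n_j = 2^j n (2N+1)`: `ℝ^{n_0} = ℝ^{n × (2N+1)}` and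
`ℝ^{n_{j+1}} = ℝ^{n_j} × ℝ^{n_j}`. -/
def Par (n N : ℕ) : ℕ → Type
  | 0 => Coeff n N
  | j + 1 => Par n N j × Par n N j

instance Par.instNormedAddCommGroup (n N : ℕ) : ∀ j, NormedAddCommGroup (Par n N j)
  | 0 => inferInstanceAs (NormedAddCommGroup (Coeff n N))
  | j + 1 =>
    letI := Par.instNormedAddCommGroup n N j
    inferInstanceAs (NormedAddCommGroup (Par n N j × Par n N j))

instance Par.instNormedSpace (n N : ℕ) : ∀ j, NormedSpace ℝ (Par n N j)
  | 0 => inferInstanceAs (NormedSpace ℝ (Coeff n N))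
  | j + 1 =>
    letI := Par.instNormedSpace n N j
    inferInstanceAs (NormedSpace ℝ (Par n N j × Par n N j))

/-- The pair `[p, q]` as an element of `ℝ^{n_{j+1}}`. -/
def Par.pair {n N j : ℕ} (p q : Par n N j) : Par n N (j + 1) := (p, q)

/-- The domains `D(X_0) = U` and `D(X_{j+1}) = D(X_j) × ℝ^{n_j}`. -/
def domX {n N : ℕ} (U : Set (Coeff n N)) : ∀ j, Set (Par n N j)
  | 0 => U
  | j + 1 => {w : Par n N j × Par n N j | w.1 ∈ domX U j}

/-- The maps `Z_0 = Z` and `Z_j : [p, q] ↦ [Z_{j-1}(p), ∂Z_{j-1}(p) q]` exist as maps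
`D(X_j) → D_j` and are continuous, for all `j ≤ jmax`. Here `∂Z_{j-1}(p)` is the Fréchet
derivative of `Z_{j-1} : D(X_{j-1}) → D_{j-1}` at `p`; that `Z_j` has values in
`D_j = D_{j-1}^1 × D_{j-1}` means that `Z_{j-1}(p)` is (the image under inclusion of) an element of
`D_{j-1}^1`. -/
def IteratedMapsExist {n N : ℕ} (jmax : ℕ) (U : Set (Coeff n N)) (Z : Coeff n N → CT n 0) :
    Prop :=
  ∃ Zs : ∀ j, Par n N j → D n j 0,
    (∀ p ∈ U, (Zs 0 p : CT n 0) = Z p) ∧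
    (∀ j < jmax, ∀ p ∈ domX U j, ∃ dZ : Par n N j →L[ℝ] D n j 0,
      HasFDerivAt (Zs j) dZ p ∧
      ∀ q : Par n N j, D.incl (D.fst (Zs (j + 1) (Par.pair p q))) = Zs j p ∧
        D.snd (Zs (j + 1) (Par.pair p q)) = dZ q) ∧
    ∀ j ≤ jmax, ContinuousOn (Zs j) (domX U j)

end PerBVP

end

noncomputable section

namespace PerBVP

open Filter Topology Asymptotics Set
open scoped ENNReal ContDiff

/-! ### Uniformity in a periodic variable -/

section Periodic

/-! `EC` smoothness does not in general make `F` Fréchet differentiable on `C⁰`, so the implicit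
function theorem cannot be applied to `x = E_N p + Q_N L F(x)` directly. The remedy is to treat time
as one more parameter. A family `q ↦ u(q)` with finite-dimensional parameter is jointly `Cᵏ`
(`JointCk`) if its time derivatives up to the order of the target space are `Cᵏ` in `(t, q)`
together. Joint order can be traded: a jointly `Cᵏ⁺¹` family has one more time derivative
(`exists_lift`) and a Fréchet derivative (`exists_fderiv`), both jointly `Cᵏ`; conversely, in `C⁰`
these two facts give joint `Cᵏ⁺¹` (`succ_of_lift_of_fderiv`).

An `ECᵏ` functional sends jointly `Cᵏ` families to `Cᵏ` functions (`IsEC.contDiffOn_comp`): along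
`u` the derivative is `∂¹f(u, ∂u e)`, an `ECᵏ⁻¹` functional on a jointly `Cᵏ⁻¹` family in the next
space `D_{j+1}`. Applied to all time shifts, this shows that `F` preserves joint smoothness.

The operator `T = Q_N L` commutes with shifts and gains one time derivative. Hence a jointly `Cᵏ`
solution `X` of `x = E_N p + T F(x)` has a jointly `Cᵏ` time derivative. Its Fréchet derivative
solves the linearized equation, a contraction with factor 1/2 because the Lipschitz constant `K`
bounds `∂F`; the solution of that equation is jointly `Cᵏ` by an induction of its own
(`jointCk_of_linear_fixedPoint`). So `X` climbs from order `k` to `k + 1` until the smoothness of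
`f` is used up (`jointCk_of_fixedPoint`). The maps `X_j`, `Y_j` then exist because each tangent map
costs exactly one order.

The remaining ingredients are quantitative. The bounds (1) follow from local boundedness of `∂¹f`
near the compact orbit `{Δ_t x₀}` in `C¹`, the mean value inequality and mollification. The
estimates (2) follow because `Q_N L` is convolution with the tail of a sawtooth series, whose `L²`
norm tends to zero by Euler's value of `ζ(2)`. Existence and uniqueness of `X(p)` are Banach's
theorem in the `C⁰` metric on a Lipschitz ball. -/

theorem eventually_dist_lt_of_periodic {W F : Type*} [NormedAddCommGroup W]
    [NormedAddCommGroup F] {g : ℝ × W → F} {Ω : Set W} (hΩ : IsOpen Ω)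
    (hg : ContinuousOn g (univ ×ˢ Ω))
    (hper : ∀ q ∈ Ω, Function.Periodic (fun t => g (t, q)) (2 * Real.pi)) {p : W} (hp : p ∈ Ω)
    {ε : ℝ} (hε : 0 < ε) : ∀ᶠ q in 𝓝 p, ∀ t, dist (g (t, q)) (g (t, p)) < ε := by
  have hopen : IsOpen ((univ : Set ℝ) ×ˢ Ω) := isOpen_univ.prod hΩ
  -- Compactness of one period makes the neighbourhood of `p` independent of `t`; periodicity then
  -- covers all times.
  have key : ∀ᶠ q in 𝓝 p, ∀ t ∈ Icc (0 : ℝ) (2 * Real.pi), dist (g (t, q)) (g (t, p)) < ε := by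
    refine isCompact_Icc.eventually_forall_of_forall_eventually
      (P := fun q t => dist (g (t, q)) (g (t, p)) < ε) fun t _ => ?_
    have hga : ContinuousAt g (t, p) := hg.continuousAt (hopen.mem_nhds ⟨mem_univ _, hp⟩)
    have h1 : ContinuousAt (fun z : W × ℝ => g (z.2, z.1)) (p, t) :=
      ContinuousAt.comp (f := fun z : W × ℝ => (z.2, z.1)) (x := (p, t)) hga
        (by fun_prop)
    have h2 : ContinuousAt (fun z : W × ℝ => g (z.2, p)) (p, t) :=
      ContinuousAt.comp (f := fun z : W × ℝ => (z.2, p)) (x := (p, t)) hga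
        (by fun_prop)
    have h3 : ContinuousAt (fun z : W × ℝ => dist (g (z.2, z.1)) (g (z.2, p))) (p, t) := h1.dist h2
    exact h3.eventually (gt_mem_nhds (by simpa using hε))
  filter_upwards [key, hΩ.mem_nhds hp] with q hq hqΩ t
  have hd : Function.Periodic (fun t => dist (g (t, q)) (g (t, p))) (2 * Real.pi) := fun t => by
    have h1 := hper q hqΩ t
    have h2 := hper p hp t
    simp only at h1 h2 ⊢
    rw [h1, h2]
  obtain ⟨s, hs, hts⟩ := hd.exists_mem_Ico₀ (by positivity) t
  rw [hts]
  exact hq s ⟨hs.1, hs.2.le⟩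

variable {W F : Type*} [NormedAddCommGroup W] [NormedSpace ℝ W] [NormedAddCommGroup F]
  [NormedSpace ℝ F]

theorem fderiv_periodic {g : ℝ × W → F} {Ω : Set W} (hΩ : IsOpen Ω)
    (hper : ∀ q ∈ Ω, Function.Periodic (fun t => g (t, q)) (2 * Real.pi)) {p : W} (hp : p ∈ Ω) :
    Function.Periodic (fun t => fderiv ℝ g (t, p)) (2 * Real.pi) := by
  intro t
  have h := fderiv_comp_add_right (𝕜 := ℝ) (f := g) (x := (t, p)) ((2 * Real.pi, 0) : ℝ × W)
  simp only [Prod.mk_add_mk, add_zero] at h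
  simp only
  rw [← h]
  refine Filter.EventuallyEq.fderiv_eq ?_
  filter_upwards [(isOpen_univ.prod hΩ).mem_nhds (⟨mem_univ t, hp⟩ : (t, p) ∈ univ ×ˢ Ω)] with z hz
  have := hper z.2 hz.2 z.1
  obtain ⟨a, b⟩ := z
  simpa using this

/-- Mean value inequality on a ball around `p` where the derivative varies by less than `ε`
uniformly in time. The uniformity turns pointwise differentiability into differentiability in the
sup norm. -/
theorem eventually_norm_sub_sub_fderiv_le {g : ℝ × W → F} {Ω : Set W} (hΩ : IsOpen Ω)
    (hg : ContDiffOn ℝ 1 g (univ ×ˢ Ω))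
    (hper : ∀ q ∈ Ω, Function.Periodic (fun t => g (t, q)) (2 * Real.pi)) {p : W} (hp : p ∈ Ω)
    {ε : ℝ} (hε : 0 < ε) :
    ∀ᶠ q in 𝓝 p, ∀ t, ‖g (t, q) - g (t, p) - fderiv ℝ g (t, p) (0, q - p)‖ ≤ ε * ‖q - p‖ := by
  have hopen : IsOpen ((univ : Set ℝ) ×ˢ Ω) := isOpen_univ.prod hΩ
  have hd := eventually_dist_lt_of_periodic hΩ (hg.continuousOn_fderiv_of_isOpen hopen le_rfl)
    (fun q hq => fderiv_periodic hΩ hper hq) hp hε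
  obtain ⟨η, hη, hball⟩ := Metric.eventually_nhds_iff_ball.1 (hd.and (hΩ.eventually_mem hp))
  filter_upwards [Metric.ball_mem_nhds p hη] with q hq t
  let ι : W →L[ℝ] ℝ × W := ContinuousLinearMap.inr ℝ ℝ W
  have hder : ∀ x ∈ Metric.ball p η, HasFDerivWithinAt (fun x => g (t, x))
      ((fderiv ℝ g (t, x)).comp ι) (Metric.ball p η) x := by
    intro x hx
    have h1 : HasFDerivAt g (fderiv ℝ g (t, x)) (t, x) :=
      ((hg.differentiableOn one_ne_zero).differentiableAt
        (hopen.mem_nhds ⟨mem_univ _, (hball x hx).2⟩)).hasFDerivAt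
    exact (h1.comp x (hasFDerivAt_prodMk_right t x)).hasFDerivWithinAt
  have := (convex_ball p η).norm_image_sub_le_of_norm_hasFDerivWithin_le'
    (φ := (fderiv ℝ g (t, p)).comp ι) (C := ε) hder
    (fun x hx => by
      rw [← ContinuousLinearMap.sub_comp]
      refine (ContinuousLinearMap.opNorm_comp_le _ _).trans ?_
      have h1 : ‖ι‖ ≤ 1 := ContinuousLinearMap.norm_inr_le_one ℝ ℝ W
      have h2 := ((hball x hx).1 t).le
      rw [dist_eq_norm] at h2
      nlinarith [norm_nonneg ι, norm_nonneg (fderiv ℝ g (t, x) - fderiv ℝ g (t, p))])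
    (Metric.mem_ball_self hη) hq
  simpa [ι] using this

/-- Differentiation with respect to a parameter commutes with the derivative in the periodic
variable. -/
theorem hasDerivAt_fderiv_apply {g g' : ℝ × W → F} {Ω : Set W} (hΩ : IsOpen Ω)
    (hg : ContDiffOn ℝ 1 g (univ ×ˢ Ω)) (hg' : ContDiffOn ℝ 1 g' (univ ×ˢ Ω))
    (hper : ∀ q ∈ Ω, Function.Periodic (fun t => g (t, q)) (2 * Real.pi))
    (hper' : ∀ q ∈ Ω, Function.Periodic (fun t => g' (t, q)) (2 * Real.pi))
    (hder : ∀ q ∈ Ω, ∀ t, HasDerivAt (fun t => g (t, q)) (g' (t, q)) t)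
    {p : W} (hp : p ∈ Ω) (e : W) (t : ℝ) :
    HasDerivAt (fun t => fderiv ℝ g (t, p) (0, e)) (fderiv ℝ g' (t, p) (0, e)) t := by
  have hlin : Tendsto (fun h : ℝ => p + h • e) (𝓝[≠] 0) (𝓝 p) := by
    have : Tendsto (fun h : ℝ => p + h • e) (𝓝 0) (𝓝 (p + (0 : ℝ) • e)) :=
      (by fun_prop : Continuous fun h : ℝ => p + h • e).tendsto 0
    simp only [zero_smul, add_zero] at this
    exact this.mono_left nhdsWithin_le_nhds
  have main : ∀ k : ℝ × W → F, ContDiffOn ℝ 1 k (univ ×ˢ Ω) →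
      (∀ q ∈ Ω, Function.Periodic (fun t => k (t, q)) (2 * Real.pi)) →
      TendstoUniformly (fun (h : ℝ) t => h⁻¹ • (k (t, p + h • e) - k (t, p)))
        (fun t => fderiv ℝ k (t, p) (0, e)) (𝓝[≠] 0) := by
    intro k hk hkp
    rw [Metric.tendstoUniformly_iff]
    intro ε hε
    have hε' : 0 < ε / (‖e‖ + 1) := by positivity
    filter_upwards [hlin.eventually (eventually_norm_sub_sub_fderiv_le hΩ hk hkp hp hε'),
      self_mem_nhdsWithin] with h hh h0 t
    have h0 : h ≠ 0 := h0
    have h1 := hh t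
    rw [add_sub_cancel_left, norm_smul] at h1
    have e1 : ((0 : ℝ), h • e) = h • ((0 : ℝ), e) := by simp
    rw [e1, map_smul] at h1
    rw [dist_eq_norm, ← norm_neg, neg_sub]
    have e2 : h⁻¹ • (k (t, p + h • e) - k (t, p)) - fderiv ℝ k (t, p) (0, e)
        = h⁻¹ • (k (t, p + h • e) - k (t, p) - h • fderiv ℝ k (t, p) (0, e)) := by
      rw [smul_sub h⁻¹ _ (h • _), smul_smul, inv_mul_cancel₀ h0, one_smul]
    rw [e2, norm_smul, norm_inv]
    have h2 : 0 < ‖h‖ := norm_pos_iff.2 h0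
    calc ‖h‖⁻¹ * _ ≤ ‖h‖⁻¹ * (ε / (‖e‖ + 1) * (‖h‖ * ‖e‖)) := by gcongr
      _ = ε * (‖e‖ / (‖e‖ + 1)) := by field_simp
      _ < ε * 1 := by
        gcongr
        rw [div_lt_one (by positivity)]
        linarith
      _ = ε := mul_one ε
  -- The parameter difference quotients of `g` have those of `g'` as time derivatives, and both
  -- converge uniformly in `t`, so the limit and the time derivative may be exchanged.
  refine hasDerivAt_of_tendstoUniformly (l := 𝓝[≠] (0 : ℝ)) (main g' hg' hper') ?_
    (fun t => (main g hg hper).tendsto_at t) t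
  filter_upwards [hlin.eventually (hΩ.mem_nhds hp)] with h hh t
  exact ((hder _ hh t).sub (hder _ hp t)).const_smul h⁻¹

theorem contDiff_of_hasDerivAt_chain {h : ℕ → ℝ → F} {r : ℕ}
    (h1 : ∀ i < r, ∀ t, HasDerivAt (h i) (h (i + 1) t) t) (h2 : ∀ i ≤ r, Continuous (h i)) :
    ContDiff ℝ r (h 0) ∧ ∀ i ≤ r, iteratedDeriv i (h 0) = h i := by
  have key : ∀ i ≤ r, iteratedDeriv i (h 0) = h i := by
    intro i
    induction i with
    | zero => intro _; exact iteratedDeriv_zero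
    | succ i ih =>
      intro hi
      rw [iteratedDeriv_succ, ih (by omega)]
      funext t
      exact (h1 i (by omega) t).deriv
  refine ⟨contDiff_nat_iff_iteratedDeriv.2 ⟨fun m hm => ?_, fun m hm => ?_⟩, key⟩
  · rw [key m hm]; exact h2 m hm
  · rw [key m hm.le]; exact fun t => (h1 m hm t).differentiableAt

end Periodic

/-! ### Elements of `Cʳ(𝕋; ℝⁿ)` -/

namespace CT

variable {n r : ℕ}

theorem hasDerivAt_iteratedDeriv (x : CT n r) {i : ℕ} (hi : i < r) (t : ℝ) :
    HasDerivAt (iteratedDeriv i (fun t => x t)) (iteratedDeriv (i + 1) (fun t => x t) t) t := by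
  rw [iteratedDeriv_succ]
  exact ((contDiff_nat_iff_iteratedDeriv.1 x.contDiff).2 i hi t).hasDerivAt

theorem hasDerivAt (x : CT n (r + 1)) (t : ℝ) :
    HasDerivAt (fun t => x t) (iteratedDeriv 1 (fun t => x t) t) t := by
  have := x.hasDerivAt_iteratedDeriv (Nat.succ_pos r) t
  simpa using this

theorem continuous_iteratedDeriv (x : CT n r) {i : ℕ} (hi : i ≤ r) :
    Continuous (iteratedDeriv i (fun t => x t)) :=
  (contDiff_nat_iff_iteratedDeriv.1 x.contDiff).1 i hi

theorem continuous (x : CT n r) : Continuous (fun t => x t) := x.contDiff.continuous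

theorem norm_iteratedDeriv_le (x : CT n r) {i : ℕ} (hi : i ≤ r) (t : ℝ) :
    ‖iteratedDeriv i (fun t => x t) t‖ ≤ ‖x‖ :=
  (norm_le_iff x (norm_nonneg x)).1 le_rfl i hi t

theorem norm_apply_le (x : CT n r) (t : ℝ) : ‖x t‖ ≤ ‖x‖ := by
  simpa using x.norm_iteratedDeriv_le (Nat.zero_le r) t

theorem norm_le_iff_zero (x : CT n 0) {c : ℝ} (hc : 0 ≤ c) : ‖x‖ ≤ c ↔ ∀ t, ‖x t‖ ≤ c := by
  rw [norm_le_iff x hc]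
  refine ⟨fun h t => by simpa using h 0 le_rfl t, fun h i hi t => ?_⟩
  obtain rfl := Nat.le_zero.1 hi
  simpa using h t

theorem iteratedDeriv_sub_apply (x y : CT n r) {i : ℕ} (hi : i ≤ r) (t : ℝ) :
    iteratedDeriv i (fun t => (x - y) t) t
      = iteratedDeriv i (fun t => x t) t - iteratedDeriv i (fun t => y t) t := by
  have hi : ((i : ℕ) : ℕ∞ω) ≤ (r : ℕ∞ω) := by exact_mod_cast hi
  exact iteratedDeriv_sub (x.contDiff.contDiffAt.of_le hi) (y.contDiff.contDiffAt.of_le hi)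

theorem iteratedDeriv_add_apply (x y : CT n r) {i : ℕ} (hi : i ≤ r) (t : ℝ) :
    iteratedDeriv i (fun t => (x + y) t) t
      = iteratedDeriv i (fun t => x t) t + iteratedDeriv i (fun t => y t) t := by
  have hi : ((i : ℕ) : ℕ∞ω) ≤ (r : ℕ∞ω) := by exact_mod_cast hi
  exact iteratedDeriv_add (x.contDiff.contDiffAt.of_le hi) (y.contDiff.contDiffAt.of_le hi)

theorem iteratedDeriv_shift (x : CT n r) (i : ℕ) (t s : ℝ) :
    iteratedDeriv i (fun s => shift t x s) s = iteratedDeriv i (fun t => x t) (t + s) :=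
  congrFun (iteratedDeriv_comp_const_add i (fun t => x t) t) s

@[simp] theorem shift_apply (t : ℝ) (x : CT n r) (s : ℝ) : shift t x s = x (t + s) := rfl

@[simp] theorem incl_apply (x : CT n (r + 1)) (t : ℝ) : x.incl t = x t := rfl

/-- Evaluation at a time. -/
def evalL (n r : ℕ) (t : ℝ) : CT n r →L[ℝ] E n :=
  LinearMap.mkContinuous {
    toFun := fun x => x t
    map_add' := fun _ _ => rfl
    map_smul' := fun _ _ => rfl } 1 fun x => by
      rw [one_mul]
      exact x.norm_apply_le t

@[simp] theorem evalL_apply (t : ℝ) (x : CT n r) : evalL n r t x = x t := rfl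

/-- The inclusion `Cʳ⁺¹ ⊆ Cʳ` as a continuous linear map. -/
def inclL (n r : ℕ) : CT n (r + 1) →L[ℝ] CT n r :=
  LinearMap.mkContinuous {
    toFun := incl
    map_add' := fun _ _ => rfl
    map_smul' := fun _ _ => rfl } 1 fun x => by
      rw [one_mul]
      refine (norm_le_iff _ (norm_nonneg x)).2 fun i hi t => ?_
      exact x.norm_iteratedDeriv_le (by omega) t

theorem norm_shift_le (t : ℝ) (x : CT n r) : ‖shift t x‖ ≤ ‖x‖ := by
  refine (norm_le_iff _ (norm_nonneg x)).2 fun i hi s => ?_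
  rw [iteratedDeriv_shift]
  exact x.norm_iteratedDeriv_le hi _

/-- The time shift as a continuous linear map. -/
def shiftL (n r : ℕ) (t : ℝ) : CT n r →L[ℝ] CT n r :=
  LinearMap.mkContinuous {
    toFun := shift t
    map_add' := fun _ _ => rfl
    map_smul' := fun _ _ => rfl } 1 fun x => by
      rw [one_mul]
      exact norm_shift_le t x

theorem incl_injective : Function.Injective (incl : CT n (r + 1) → CT n r) := fun x y h => by
  ext1 t
  exact congrArg (fun z : CT n r => z t) h

/-- `C⁰(𝕋)` sits isometrically in the bounded continuous functions as the closed set of periodic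
ones. -/
instance instCompleteSpace : CompleteSpace (CT n 0) := by
  let Φ : CT n 0 → BoundedContinuousFunction ℝ (E n) := fun x => x.derivBCF 0
  have hΦ : Isometry Φ := by
    refine Isometry.of_dist_eq fun x y => ?_
    rw [dist_eq_norm, dist_eq_norm]
    refine le_antisymm ((BoundedContinuousFunction.norm_le (norm_nonneg _)).2 fun t => ?_)
      ((norm_le_iff_zero _ (norm_nonneg _)).2 fun t => ?_)
    · have := (x - y).norm_apply_le t
      simpa [Φ] using this
    · have := (Φ x - Φ y).norm_coe_le_norm t
      simpa [Φ] using this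
  rw [completeSpace_iff_isComplete_range hΦ.isUniformInducing]
  refine IsClosed.isComplete ?_
  have : range Φ = ⋂ t : ℝ, {g | g (t + 2 * Real.pi) = g t} := by
    ext g
    simp only [mem_range, mem_iInter, mem_ofPred_eq]
    constructor
    · rintro ⟨x, rfl⟩ t
      simpa [Φ] using x.periodic t
    · intro h
      refine ⟨mk g (contDiff_zero.2 g.continuous) h, ?_⟩
      ext1 t
      rfl
  rw [this]
  refine isClosed_iInter fun t => isClosed_eq (by fun_prop) (by fun_prop)

end CT

/-! ### Continuous linear maps between the spaces `D_j^r` -/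

namespace D

variable {n j r : ℕ}

/-- First component, as a continuous linear map. -/
def fstL (n j r : ℕ) : D n (j + 1) r →L[ℝ] D n j (r + 1) :=
  show D n j (r + 1) × D n j r →L[ℝ] D n j (r + 1) from ContinuousLinearMap.fst ℝ _ _

/-- Second component, as a continuous linear map. -/
def sndL (n j r : ℕ) : D n (j + 1) r →L[ℝ] D n j r :=
  show D n j (r + 1) × D n j r →L[ℝ] D n j r from ContinuousLinearMap.snd ℝ _ _

/-- Pairing of continuous linear maps. -/
def pairL {V : Type*} [NormedAddCommGroup V] [NormedSpace ℝ V] (A : V →L[ℝ] D n j (r + 1))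
    (B : V →L[ℝ] D n j r) : V →L[ℝ] D n (j + 1) r :=
  show V →L[ℝ] D n j (r + 1) × D n j r from A.prod B

theorem continuousAt_pair {V : Type*} [TopologicalSpace V] {a : V → D n j (r + 1)}
    {b : V → D n j r} {v : V} (ha : ContinuousAt a v) (hb : ContinuousAt b v) :
    ContinuousAt (fun v => pair (a v) (b v)) v :=
  show ContinuousAt (fun v => ((a v, b v) : D n j (r + 1) × D n j r)) v from ha.prodMk hb

theorem hasFDerivAt_pair {V : Type*} [NormedAddCommGroup V] [NormedSpace ℝ V]
    {a : V → D n j (r + 1)} {b : V → D n j r} {A : V →L[ℝ] D n j (r + 1)}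
    {B : V →L[ℝ] D n j r} {v : V} (ha : HasFDerivAt a A v) (hb : HasFDerivAt b B v) :
    HasFDerivAt (fun v => pair (a v) (b v)) (pairL A B) v :=
  show HasFDerivAt (fun v => ((a v, b v) : D n j (r + 1) × D n j r)) (A.prod B) v from ha.prodMk hb

/-- The inclusion `D_j^{r+1} ⊆ D_j^r` as a continuous linear map. -/
def inclL (n : ℕ) : ∀ j r : ℕ, D n j (r + 1) →L[ℝ] D n j r
  | 0, r => CT.inclL n r
  | j + 1, r => pairL ((inclL n j (r + 1)).comp (fstL n j (r + 1)))
      ((inclL n j r).comp (sndL n j (r + 1)))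

theorem inclL_apply : ∀ {j r : ℕ} (w : D n j (r + 1)), inclL n j r w = incl w
  | 0, _, _ => rfl
  | j + 1, r, w => by
    have h1 := inclL_apply (fst w)
    have h2 := inclL_apply (snd w)
    show pair (inclL n j (r + 1) (fst w)) (inclL n j r (snd w)) = pair _ _
    rw [h1, h2]

/-- The time shift on `D_j^r` as a continuous linear map. -/
def shiftL (n : ℕ) (t : ℝ) : ∀ j r : ℕ, D n j r →L[ℝ] D n j r
  | 0, r => CT.shiftL n r t
  | j + 1, r => pairL ((shiftL n t j (r + 1)).comp (fstL n j r))
      ((shiftL n t j r).comp (sndL n j r))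

theorem shiftL_incl (t : ℝ) : ∀ {j r : ℕ} (w : D n j (r + 1)),
    shiftL n t j r (incl w) = incl (shiftL n t j (r + 1) w)
  | 0, _, _ => rfl
  | j + 1, r, w => by
    have h1 := shiftL_incl t (fst w)
    have h2 := shiftL_incl t (snd w)
    show pair (shiftL n t j (r + 1) (incl (fst w))) (shiftL n t j r (incl (snd w))) = _
    rw [h1, h2]
    rfl

end D

/-! ### Families of periodic functions depending smoothly on time and parameters -/

section Joint

variable {n : ℕ} {W : Type} [NormedAddCommGroup W] [NormedSpace ℝ W]

/-- A family `q ↦ u q` in `Cʳ(𝕋; ℝⁿ)` is jointly `Cᵏ` on `Ω` if its time derivatives up to order `r`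
are `Cᵏ` as functions of time and of `q ∈ Ω`. -/
def CT.JointCk {r : ℕ} (k : ℕ) (Ω : Set W) (u : W → CT n r) : Prop :=
  ∀ i ≤ r, ContDiffOn ℝ k (fun z : ℝ × W => iteratedDeriv i (fun t => u z.2 t) z.1) (univ ×ˢ Ω)

/-- A family `q ↦ u q` in `D_j^r` is jointly `Cᵏ` on `Ω` if all time derivatives of the components
of `u` that are part of the norm of `D_j^r` are `Cᵏ` as functions of time and of `q ∈ Ω`. -/
def JointCk (k : ℕ) (Ω : Set W) : ∀ {j r : ℕ}, (W → D n j r) → Prop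
  | 0, r, u => CT.JointCk (n := n) (r := r) k Ω u
  | _ + 1, _, u => JointCk k Ω (fun q => D.fst (u q)) ∧ JointCk k Ω (fun q => D.snd (u q))

/-! ### Calculus of jointly smooth families in `Cʳ(𝕋; ℝⁿ)`. -/

namespace CT.JointCk

variable {k r : ℕ} {Ω : Set W}

theorem iff_zero {u : W → CT n 0} : CT.JointCk k Ω u ↔
    ContDiffOn ℝ k (fun z : ℝ × W => u z.2 z.1) (univ ×ˢ Ω) := by
  refine ⟨fun h => by simpa using h 0 le_rfl, fun h i hi => ?_⟩
  obtain rfl := Nat.le_zero.1 hi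
  simpa using h

theorem comp {W' : Type} [NormedAddCommGroup W'] [NormedSpace ℝ W'] {Ω' : Set W'} {φ : W' → W}
    (hφ : ContDiffOn ℝ k φ Ω') (hm : MapsTo φ Ω' Ω) {u : W → CT n r} (hu : CT.JointCk k Ω u) :
    CT.JointCk k Ω' (fun q => u (φ q)) := fun i hi => by
  refine (hu i hi).comp (f := fun z : ℝ × W' => (z.1, φ z.2)) ?_ ?_
  · exact contDiffOn_fst.prodMk (hφ.comp contDiffOn_snd fun z hz => hz.2)
  · exact fun z hz => ⟨mem_univ _, hm hz.2⟩

theorem of_le {l : ℕ} (hl : l ≤ k) {u : W → CT n r} (hu : CT.JointCk k Ω u) :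
    CT.JointCk l Ω u := fun i hi => (hu i hi).of_le (by exact_mod_cast hl)

theorem congr {u v : W → CT n r} (hu : CT.JointCk k Ω u) (h : ∀ q ∈ Ω, v q = u q) :
    CT.JointCk k Ω v := fun i hi => (hu i hi).congr fun z hz => by
  simp only [h z.2 hz.2]

theorem shift {u : W → CT n r} (hu : CT.JointCk k Ω u) :
    CT.JointCk k (univ ×ˢ Ω) (fun z : ℝ × W => CT.shift z.1 (u z.2)) := fun i hi => by
  have h2 := (hu i hi).comp
    (f := fun z : ℝ × (ℝ × W) => (z.2.1 + z.1, z.2.2)) (s := univ ×ˢ (univ ×ˢ Ω))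
    (by fun_prop) (fun z hz => ⟨mem_univ _, hz.2.2⟩)
  refine h2.congr fun z _ => ?_
  exact CT.iteratedDeriv_shift (u z.2.2) i z.2.1 z.1

theorem zero : CT.JointCk k Ω (fun _ => (0 : CT n r)) := fun i _ => by
  have h : iteratedDeriv i (fun t => (0 : CT n r) t) = fun _ => 0 := by
    show iteratedDeriv i (fun _ => (0 : E n)) = _
    funext t
    simp
  simp only [h]
  exact contDiffOn_const

/-- A fixed element of `Cʳ⁺¹` is a jointly `C¹` family in `Cʳ`. -/
theorem const_incl (x : CT n (r + 1)) : CT.JointCk 1 Ω (fun _ : W => x.incl) := fun i hi => by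
  have h : ContDiff ℝ 1 (iteratedDeriv i (fun t => x t)) := by
    rw [contDiff_one_iff_deriv, ← iteratedDeriv_succ]
    exact ⟨fun t => (x.hasDerivAt_iteratedDeriv (Nat.lt_succ_of_le hi) t).differentiableAt,
      x.continuous_iteratedDeriv (Nat.succ_le_succ hi)⟩
  exact (h.comp contDiff_fst).contDiffOn

theorem add {u v : W → CT n r} (hu : CT.JointCk k Ω u) (hv : CT.JointCk k Ω v) :
    CT.JointCk k Ω (fun q => u q + v q) := fun i hi =>
  ((hu i hi).add (hv i hi)).congr fun z _ => CT.iteratedDeriv_add_apply (u z.2) (v z.2) hi z.1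

theorem continuousAt (hΩ : IsOpen Ω) {p : W} (hp : p ∈ Ω) {u : W → CT n r}
    (hu : CT.JointCk 0 Ω u) : ContinuousAt u p := by
  rw [Metric.continuousAt_iff']
  intro ε hε
  have h : ∀ᶠ q in 𝓝 p, ∀ i ∈ Finset.range (r + 1), ∀ t,
      dist (iteratedDeriv i (fun t => u q t) t)
        (iteratedDeriv i (fun t => u p t) t) < ε / 2 := by
    rw [Filter.eventually_all_finset]
    intro i hi
    exact eventually_dist_lt_of_periodic hΩ
      (hu i (by simpa [Nat.lt_succ_iff] using hi)).continuousOn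
      (fun q _ => CT.iteratedDeriv_periodic (u q) i) hp (half_pos hε)
  filter_upwards [h] with q hq
  rw [dist_eq_norm]
  refine lt_of_le_of_lt ((CT.norm_le_iff _ (half_pos hε).le).2 fun i hi t => ?_)
    (half_lt_self hε)
  rw [CT.iteratedDeriv_sub_apply _ _ hi, ← dist_eq_norm]
  exact (hq i (by simpa [Nat.lt_succ_iff] using hi) t).le

/-- The extra time derivative is the partial derivative in the direction `(1, 0)` of a jointly
`Cᵏ⁺¹` function, hence exists and is jointly `Cᵏ`. -/
theorem exists_lift (hΩ : IsOpen Ω) {u : W → CT n r} (hu : CT.JointCk (k + 1) Ω u) :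
    ∃ v : W → CT n (r + 1), CT.JointCk k Ω v ∧ ∀ q ∈ Ω, (v q).incl = u q := by
  have hr := hu r le_rfl
  set g : ℝ × W → E n := fun z => iteratedDeriv r (fun t => u z.2 t) z.1 with hg
  have hopen : IsOpen ((univ : Set ℝ) ×ˢ Ω) := isOpen_univ.prod hΩ
  have hder : ∀ q ∈ Ω, ∀ t, HasDerivAt (iteratedDeriv r (fun t => u q t))
      (fderiv ℝ g (t, q) (1, 0)) t := by
    intro q hq t
    have h1 : HasFDerivAt g (fderiv ℝ g (t, q)) (t, q) :=
      ((hr.differentiableOn (by simp)).differentiableAt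
        (hopen.mem_nhds ⟨mem_univ _, hq⟩)).hasFDerivAt
    have h2 : HasDerivAt (fun t : ℝ => (t, q)) ((1 : ℝ), (0 : W)) t :=
      (hasDerivAt_id t).prodMk (hasDerivAt_const t q)
    exact h1.comp_hasDerivAt t h2
  have hfd : ContDiffOn ℝ k (fun z => fderiv ℝ g z (1, 0)) (univ ×ˢ Ω) :=
    (hr.fderiv_of_isOpen hopen (by simp)).clm_apply contDiffOn_const
  have hsmooth : ∀ q ∈ Ω, ContDiff ℝ (r + 1 : ℕ) (fun t => u q t) := by
    intro q hq
    rw [contDiff_nat_iff_iteratedDeriv]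
    constructor
    · intro m hm
      rcases Nat.lt_or_ge m (r + 1) with h | h
      · exact CT.continuous_iteratedDeriv (u q) (Nat.lt_succ_iff.1 h)
      · obtain rfl := le_antisymm hm h
        have : iteratedDeriv (r + 1) (fun t => u q t)
            = fun t => fderiv ℝ g (t, q) (1, 0) := by
          funext t
          rw [iteratedDeriv_succ]
          exact (hder q hq t).deriv
        rw [this]
        exact hfd.continuousOn.comp_continuous (f := fun t : ℝ => (t, q)) (by fun_prop)
          (fun t => ⟨mem_univ _, hq⟩)
    · intro m hm t
      rcases Nat.lt_or_ge m r with h | h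
      · exact (CT.hasDerivAt_iteratedDeriv (u q) h t).differentiableAt
      · obtain rfl : m = r := by omega
        exact (hder q hq t).differentiableAt
  classical
  -- Off `Ω` the family need not be smooth in time; the value 0 there is arbitrary.
  refine ⟨fun q => if h : ContDiff ℝ (r + 1 : ℕ) (fun t => u q t) then
    CT.mk _ h (CT.periodic (u q)) else (0 : CT n (r + 1)), ?_, ?_⟩
  · intro i hi
    rcases Nat.lt_or_ge i (r + 1) with h | h
    · refine ((hu i (Nat.lt_succ_iff.1 h)).of_le (by exact_mod_cast Nat.le_succ k)).congr ?_
      rintro ⟨t, q⟩ ⟨-, hq⟩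
      simp only [dif_pos (hsmooth q hq)]
      rfl
    · obtain rfl := le_antisymm hi h
      refine hfd.congr ?_
      rintro ⟨t, q⟩ ⟨-, hq⟩
      simp only [dif_pos (hsmooth q hq)]
      show iteratedDeriv (r + 1) (fun t => u q t) t = _
      rw [iteratedDeriv_succ]
      exact (hder q hq t).deriv
  · intro q hq
    simp only [dif_pos (hsmooth q hq)]
    rfl

/-- The candidate derivative is the partial derivative in `q`, taken at each time. Interchange with
time derivatives puts it in `Cʳ`, and the Taylor estimate uniform in time makes it a Fréchet
derivative in the `Cʳ` norm. It is bounded because `W` is finite-dimensional. -/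
theorem exists_fderiv [FiniteDimensional ℝ W] (hΩ : IsOpen Ω) {u : W → CT n r}
    (hu : CT.JointCk (k + 1) Ω u) :
    ∃ u' : W → W →L[ℝ] CT n r, (∀ p ∈ Ω, HasFDerivAt u (u' p) p) ∧
      CT.JointCk k (Ω ×ˢ univ) (fun z : W × W => u' z.1 z.2) := by
  set g : ℕ → ℝ × W → E n := fun i z => iteratedDeriv i (fun t => u z.2 t) z.1
    with hg
  have hopen : IsOpen ((univ : Set ℝ) ×ˢ Ω) := isOpen_univ.prod hΩ
  have hone : (1 : ℕ∞ω) ≤ ((k + 1 : ℕ) : ℕ∞ω) := by exact_mod_cast Nat.succ_le_succ (Nat.zero_le k)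
  have hper : ∀ i, ∀ q ∈ Ω, Function.Periodic (fun t => g i (t, q)) (2 * Real.pi) :=
    fun i q _ => CT.iteratedDeriv_periodic (u q) i
  have hfd : ∀ i ≤ r, ContDiffOn ℝ k (fderiv ℝ (g i)) (univ ×ˢ Ω) := fun i hi =>
    (hu i hi).fderiv_of_isOpen hopen (by simp)
  have hchain : ∀ p ∈ Ω, ∀ e : W, ContDiff ℝ r (fun t => fderiv ℝ (g 0) (t, p) (0, e)) ∧
      ∀ i ≤ r, iteratedDeriv i (fun t => fderiv ℝ (g 0) (t, p) (0, e))
        = fun t => fderiv ℝ (g i) (t, p) (0, e) := by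
    intro p hp e
    refine contDiff_of_hasDerivAt_chain (h := fun i t => fderiv ℝ (g i) (t, p) (0, e)) ?_ ?_
    · intro i hi t
      refine hasDerivAt_fderiv_apply hΩ ((hu i hi.le).of_le hone) ((hu (i + 1) hi).of_le hone)
        (hper i) (hper (i + 1)) (fun q _ t => ?_) hp e t
      exact CT.hasDerivAt_iteratedDeriv (u q) hi t
    · intro i hi
      exact ((hfd i hi).continuousOn.comp_continuous (f := fun t : ℝ => (t, p)) (by fun_prop)
          (fun t => ⟨mem_univ _, hp⟩)).clm_apply continuous_const
  have hperd : ∀ p ∈ Ω, ∀ e : W,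
      Function.Periodic (fun t => fderiv ℝ (g 0) (t, p) (0, e)) (2 * Real.pi) :=
    fun p hp e t => congrArg (fun A : ℝ × W →L[ℝ] E n => A (0, e))
      (fderiv_periodic hΩ (hper 0) hp t)
  let L : ∀ p ∈ Ω, W →ₗ[ℝ] CT n r := fun p hp =>
    { toFun := fun e => CT.mk _ (hchain p hp e).1 (hperd p hp e)
      map_add' := fun a b => CT.ext fun t => by
        show fderiv ℝ (g 0) (t, p) (0, a + b)
          = fderiv ℝ (g 0) (t, p) (0, a) + fderiv ℝ (g 0) (t, p) (0, b)
        rw [← map_add, Prod.mk_add_mk, add_zero]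
      map_smul' := fun c a => CT.ext fun t => by
        show fderiv ℝ (g 0) (t, p) (0, c • a) = c • fderiv ℝ (g 0) (t, p) (0, a)
        rw [← map_smul, Prod.smul_mk, smul_zero] }
  classical
  let u' : W → W →L[ℝ] CT n r := fun p =>
    if hp : p ∈ Ω then LinearMap.toContinuousLinearMap (L p hp) else 0
  have hu' : ∀ p ∈ Ω, ∀ e, ∀ i ≤ r, iteratedDeriv i (fun t => (u' p e) t)
      = fun t => fderiv ℝ (g i) (t, p) (0, e) := by
    intro p hp e i hi
    have : (fun t => (u' p e) t) = fun t => fderiv ℝ (g 0) (t, p) (0, e) := by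
      funext t
      simp only [u', dif_pos hp]
      rfl
    rw [this]
    exact (hchain p hp e).2 i hi
  refine ⟨u', fun p hp => ?_, ?_⟩
  · rw [hasFDerivAt_iff_isLittleO, isLittleO_iff]
    intro ε hε
    -- The `Cʳ` norm involves finitely many time derivatives, so the uniform Taylor estimates for
    -- all of them hold simultaneously.
    have h : ∀ᶠ q in 𝓝 p, ∀ i ∈ Finset.range (r + 1), ∀ t,
        ‖g i (t, q) - g i (t, p) - fderiv ℝ (g i) (t, p) (0, q - p)‖ ≤ ε * ‖q - p‖ := by
      rw [Filter.eventually_all_finset]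
      intro i hi
      exact eventually_norm_sub_sub_fderiv_le hΩ
        ((hu i (by simpa [Nat.lt_succ_iff] using hi)).of_le hone) (hper i) hp hε
    filter_upwards [h] with q hq
    refine (CT.norm_le_iff _ (by positivity)).2 fun i hi t => ?_
    rw [CT.iteratedDeriv_sub_apply _ _ hi, CT.iteratedDeriv_sub_apply _ _ hi, hu' p hp _ i hi]
    exact hq i (by simpa [Nat.lt_succ_iff] using hi) t
  · intro i hi
    have h1 : ContDiffOn ℝ k (fun z : ℝ × (W × W) => fderiv ℝ (g i) (z.1, z.2.1) (0, z.2.2))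
        (univ ×ˢ (Ω ×ˢ univ)) := by
      refine ((hfd i hi).comp (f := fun z : ℝ × (W × W) => (z.1, z.2.1)) (by fun_prop)
        (fun z hz => ⟨mem_univ _, hz.2.1⟩)).clm_apply (by fun_prop)
    refine h1.congr ?_
    rintro ⟨t, p, e⟩ ⟨-, hp, -⟩
    exact congrFun (hu' p hp e i hi) t

end CT.JointCk

/-! ### The same calculus, componentwise, in the product spaces `D_j^r`. -/

namespace JointCk

variable {k : ℕ} {Ω : Set W} {j r : ℕ}

theorem pair {u : W → D n j (r + 1)} {v : W → D n j r} (hu : JointCk k Ω u)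
    (hv : JointCk k Ω v) : JointCk k Ω (fun q => D.pair (u q) (v q)) := ⟨hu, hv⟩

theorem comp {W' : Type} [NormedAddCommGroup W'] [NormedSpace ℝ W'] {Ω' : Set W'} {φ : W' → W}
    (hφ : ContDiffOn ℝ k φ Ω') (hm : MapsTo φ Ω' Ω) : ∀ {j r : ℕ} {u : W → D n j r},
    JointCk k Ω u → JointCk k Ω' (fun q => u (φ q))
  | 0, r, _, hu => CT.JointCk.comp (n := n) (r := r) hφ hm hu
  | _ + 1, _, u, hu => ⟨comp hφ hm (u := fun q => D.fst (u q)) hu.1,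
      comp hφ hm (u := fun q => D.snd (u q)) hu.2⟩

theorem of_le {l : ℕ} (hl : l ≤ k) : ∀ {j r : ℕ} {u : W → D n j r},
    JointCk k Ω u → JointCk l Ω u
  | 0, r, _, hu => CT.JointCk.of_le (n := n) (r := r) hl hu
  | _ + 1, _, u, hu => ⟨of_le hl (u := fun q => D.fst (u q)) hu.1,
      of_le hl (u := fun q => D.snd (u q)) hu.2⟩

/-- The family of all time shifts. -/
theorem shift : ∀ {j r : ℕ} {u : W → D n j r}, JointCk k Ω u →
    JointCk k (univ ×ˢ Ω) (fun z : ℝ × W => D.shiftL n z.1 j r (u z.2))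
  | 0, r, _, hu => CT.JointCk.shift (n := n) (r := r) hu
  | _ + 1, _, u, hu => ⟨shift (u := fun q => D.fst (u q)) hu.1,
      shift (u := fun q => D.snd (u q)) hu.2⟩

theorem continuousAt (hΩ : IsOpen Ω) {p : W} (hp : p ∈ Ω) : ∀ {j r : ℕ} {u : W → D n j r},
    JointCk 0 Ω u → ContinuousAt u p
  | 0, r, u, hu => by
    exact CT.JointCk.continuousAt (n := n) (r := r) hΩ hp hu
  | j + 1, r, u, hu => by
    have h1 := continuousAt hΩ hp (u := fun q => D.fst (u q)) hu.1
    have h2 := continuousAt hΩ hp (u := fun q => D.snd (u q)) hu.2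
    exact D.continuousAt_pair h1 h2

theorem continuousOn (hΩ : IsOpen Ω) {u : W → D n j r} (hu : JointCk 0 Ω u) :
    ContinuousOn u Ω := fun _ hp => (hu.continuousAt hΩ hp).continuousWithinAt

/-- A jointly `Cᵏ⁺¹` family has one more time derivative that is jointly `Cᵏ`. -/
theorem exists_lift (hΩ : IsOpen Ω) : ∀ {j r : ℕ} {u : W → D n j r}, JointCk (k + 1) Ω u →
    ∃ v : W → D n j (r + 1), JointCk k Ω v ∧ ∀ q ∈ Ω, D.incl (v q) = u q
  | 0, r, u, hu => by
    exact CT.JointCk.exists_lift (n := n) (r := r) hΩ hu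
  | j + 1, r, u, hu => by
    obtain ⟨v, hv, hv'⟩ := exists_lift hΩ (u := fun q => D.fst (u q)) hu.1
    obtain ⟨w, hw, hw'⟩ := exists_lift hΩ (u := fun q => D.snd (u q)) hu.2
    refine ⟨fun q => D.pair (v q) (w q), ⟨hv, hw⟩, fun q hq => ?_⟩
    exact Prod.ext (hv' q hq) (hw' q hq)

/-- A jointly `Cᵏ⁺¹` family is Fréchet differentiable with a jointly `Cᵏ` derivative. -/
theorem exists_fderiv [FiniteDimensional ℝ W] (hΩ : IsOpen Ω) : ∀ {j r : ℕ} {u : W → D n j r},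
    JointCk (k + 1) Ω u → ∃ u' : W → W →L[ℝ] D n j r, (∀ p ∈ Ω, HasFDerivAt u (u' p) p) ∧
      JointCk k (Ω ×ˢ univ) (fun z : W × W => u' z.1 z.2)
  | 0, r, u, hu => by
    exact CT.JointCk.exists_fderiv (n := n) (r := r) hΩ hu
  | j + 1, r, u, hu => by
    obtain ⟨v, hv, hv'⟩ := exists_fderiv hΩ (u := fun q => D.fst (u q)) hu.1
    obtain ⟨w, hw, hw'⟩ := exists_fderiv hΩ (u := fun q => D.snd (u q)) hu.2
    exact ⟨fun p => D.pairL (v p) (w p), fun p hp => D.hasFDerivAt_pair (hv p hp) (hw p hp),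
      hv', hw'⟩

/-- A jointly `Cᵏ` family is a `Cᵏ` map into `D_j^r`. -/
theorem contDiffOn {W : Type} [NormedAddCommGroup W] [NormedSpace ℝ W] [FiniteDimensional ℝ W]
    {Ω : Set W} (hΩ : IsOpen Ω) {u : W → D n j r} (hu : JointCk k Ω u) :
    ContDiffOn ℝ k u Ω := by
  induction k generalizing u with
  | zero => exact contDiffOn_zero.2 (hu.continuousOn hΩ)
  | succ k ih =>
    obtain ⟨u', h1, h2⟩ := hu.exists_fderiv hΩ
    rw [Nat.cast_succ, contDiffOn_succ_iff_hasFDerivWithinAt_of_uniqueDiffOn hΩ.uniqueDiffOn]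
    refine ⟨by simp, u', contDiffOn_clm_apply.2 fun e => ?_,
      fun p hp => (h1 p hp).hasFDerivWithinAt⟩
    have hm : MapsTo (fun p => (p, e)) Ω (Ω ×ˢ univ) := fun p hp => ⟨hp, mem_univ _⟩
    exact ih (h2.comp (φ := fun p => (p, e)) (by fun_prop) hm)

end JointCk

/-! ### Raising the joint order; shift-invariant operators. -/

namespace CT.JointCk

variable {k : ℕ} {Ω : Set W}

/-- A family in `C⁰` that has a jointly `Cᵏ` time derivative and a jointly `Cᵏ` Fréchet derivative
is jointly `Cᵏ⁺¹`. -/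
theorem succ_of_lift_of_fderiv [FiniteDimensional ℝ W] (hΩ : IsOpen Ω) {z : W → CT n 0}
    {v : W → CT n 1} (hv : CT.JointCk k Ω v) (hvz : ∀ q ∈ Ω, (v q).incl = z q)
    {w : W → W →L[ℝ] CT n 0} (hw : ∀ q ∈ Ω, HasFDerivAt z (w q) q)
    (hw' : CT.JointCk k (Ω ×ˢ univ) (fun a : W × W => w a.1 a.2)) :
    CT.JointCk (k + 1) Ω z := by
  rw [iff_zero] at hw' ⊢
  have hv1 := hv 1 le_rfl
  have hopen : IsOpen ((univ : Set ℝ) ×ˢ Ω) := isOpen_univ.prod hΩ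
  -- The total derivative in `(t, q)`: its time part comes from the lift `v`, its parameter part
  -- from the Fréchet derivative `w`.
  let A : ℝ × W → (ℝ × W →L[ℝ] E n) := fun a =>
    (ContinuousLinearMap.toSpanSingleton ℝ (iteratedDeriv 1 (fun t => v a.2 t) a.1)).coprod
      ((CT.evalL n 0 a.1).comp (w a.2))
  have hA : ∀ a ∈ (univ : Set ℝ) ×ˢ Ω, HasFDerivAt (fun a : ℝ × W => z a.2 a.1) (A a) a := by
    rintro ⟨t, q⟩ ⟨-, hq⟩
    have h1 : HasFDerivAt (fun a : ℝ × W => z q a.1) ((ContinuousLinearMap.toSpanSingleton ℝ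
        (iteratedDeriv 1 (fun t => v q t) t)).comp (ContinuousLinearMap.fst ℝ ℝ W)) (t, q) := by
      have := (v q).hasDerivAt t
      rw [← hvz q hq]
      exact this.hasFDerivAt.comp (t, q) hasFDerivAt_fst
    have h2 : HasFDerivAt (fun a : ℝ × W => z a.2 a.1 - z q a.1)
        (((CT.evalL n 0 t).comp (w q)).comp (ContinuousLinearMap.snd ℝ ℝ W)) (t, q) := by
      rw [hasFDerivAt_iff_isLittleO]
      -- Fréchet differentiability in the sup norm allows the remainder to be evaluated at the
      -- moving time `a.1`.
      have e1 : (fun a : ℝ × W => z a.2 a.1 - z q a.1 - w q (a.2 - q) a.1)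
          =o[𝓝 (t, q)] fun a => a - (t, q) := by
        have := (hw q hq).isLittleO.comp_tendsto
          (continuous_snd.tendsto' (t, q) q rfl : Tendsto (Prod.snd : ℝ × W → W) _ _)
        refine IsBigO.trans_isLittleO (IsBigO.of_bound 1 (Eventually.of_forall fun a => ?_))
          (this.trans_isBigO (IsBigO.of_bound 1 (Eventually.of_forall fun a => ?_)))
        · rw [one_mul]
          exact (z a.2 - z q - w q (a.2 - q)).norm_apply_le a.1
        · rw [one_mul]
          exact norm_snd_le (a - (t, q))
      -- Freezing the time at `t` costs an operator norm that tends to 0, because evaluation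
      -- composed with `w q` depends continuously on time; pointwise continuity suffices as `W` is
      -- finite-dimensional.
      have e2 : (fun a : ℝ × W => w q (a.2 - q) a.1 - w q (a.2 - q) t)
          =o[𝓝 (t, q)] fun a => a - (t, q) := by
        have hc : Continuous (fun a : ℝ => (CT.evalL n 0 a).comp (w q)) := by
          rw [continuous_clm_apply]
          exact fun e => (w q e).continuous
        have hc' : Tendsto (fun a : ℝ × W => (CT.evalL n 0 a.1).comp (w q)
            - (CT.evalL n 0 t).comp (w q)) (𝓝 (t, q)) (𝓝 0) := by
          have := ((hc.comp continuous_fst).tendsto (t, q)).sub_const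
            ((CT.evalL n 0 t).comp (w q))
          simpa only [Function.comp_def, sub_self] using this
        rw [isLittleO_iff]
        intro ε hε
        filter_upwards [hc'.norm.eventually (gt_mem_nhds (by simpa using hε))] with a ha
        calc _ = ‖((CT.evalL n 0 a.1).comp (w q) - (CT.evalL n 0 t).comp (w q)) (a.2 - q)‖ := rfl
          _ ≤ _ := ContinuousLinearMap.le_opNorm _ _
          _ ≤ ε * ‖a - (t, q)‖ := by
            gcongr
            exact norm_snd_le (a - (t, q))
      refine (e1.add e2).congr_left fun a => ?_
      show _ = z a.2 a.1 - z q a.1 - (z q t - z q t) - w q (a.2 - q) t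
      abel
    have h3 := h1.add h2
    have e : (fun a : ℝ × W => z a.2 a.1)
        = (fun a : ℝ × W => z q a.1) + (fun a => z a.2 a.1 - z q a.1) := by
      funext a
      simp
    rw [e]
    exact h3
  rw [Nat.cast_succ, contDiffOn_succ_iff_hasFDerivWithinAt_of_uniqueDiffOn hopen.uniqueDiffOn]
  refine ⟨by simp, A, contDiffOn_clm_apply.2 fun a => ?_, fun a ha => (hA a ha).hasFDerivWithinAt⟩
  have e1 : ContDiffOn ℝ k (fun b : ℝ × W => a.1 • iteratedDeriv 1 (fun t => v b.2 t) b.1)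
      (univ ×ˢ Ω) := hv1.const_smul a.1
  have e2 : ContDiffOn ℝ k (fun b : ℝ × W => w b.2 a.2 b.1) (univ ×ˢ Ω) :=
    hw'.comp (f := fun b : ℝ × W => (b.1, (b.2, a.2))) (by fun_prop)
      fun b hb => ⟨mem_univ _, hb.2, mem_univ _⟩
  exact e1.add e2

/-- Continuous linear maps that commute with time shifts preserve joint smoothness. -/
theorem clm_comp [FiniteDimensional ℝ W] (hΩ : IsOpen Ω) {T : CT n 0 →L[ℝ] CT n 0}
    (hT : ∀ t x, T (CT.shift t x) = CT.shift t (T x)) {u : W → CT n 0}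
    (hu : CT.JointCk k Ω u) :
    CT.JointCk k Ω (fun q => T (u q)) := by
  rw [iff_zero]
  -- The value at time `t` is the value at time 0 of the shifted function. With `t` as a parameter,
  -- `T` acts on a `Cᵏ` map into `C⁰`, where bounded linear maps are harmless.
  have h := _root_.PerBVP.JointCk.contDiffOn (n := n) (j := 0) (r := 0) (isOpen_univ.prod hΩ) hu.shift
  have h2 : ContDiffOn ℝ k (fun a : ℝ × W => CT.evalL n 0 0 (T (CT.shift a.1 (u a.2))))
      (univ ×ˢ Ω) := (((CT.evalL n 0 0).comp T).contDiff.comp_contDiffOn h : _)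
  refine h2.congr fun a _ => ?_
  rw [hT, CT.evalL_apply, CT.shift_apply, add_zero]

end CT.JointCk

end Joint

/-! ### The chain rule for extendable continuous derivatives -/

section ExtDeriv

variable {n m j : ℕ} {f : D n j 0 → E m} {df : D n j 1 → D n j 0 →ₗ[ℝ] E m}

namespace IsExtDeriv

/-- Joint continuity at `(c, 0)` bounds `df` by 1 on a product of balls of radius `η`; linearity
rescales this to the constant `2 / η`. The bound in the weaker norm of `D_j` is what the chain rule
needs. -/
theorem exists_norm_le (h : IsExtDeriv f df) (c : D n j 1) :
    ∃ η > 0, ∃ C > 0, ∀ b ∈ Metric.ball c η, ∀ y, ‖df b y‖ ≤ C * ‖y‖ := by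
  have hc := Metric.continuousAt_iff.1 (h.continuous.continuousAt (x := (c, (0 : D n j 0)))) 1
    one_pos
  obtain ⟨η, hη, H⟩ := hc
  refine ⟨η, hη, 2 / η, by positivity, fun b hb y => ?_⟩
  rcases eq_or_ne y 0 with rfl | hy
  · simp
  have hy' : 0 < ‖y‖ := norm_pos_iff.2 hy
  have hn : ‖(η / (2 * ‖y‖)) • y‖ = η / 2 := by
    rw [norm_smul, Real.norm_of_nonneg (by positivity)]
    field_simp
  have h1 := H (x := (b, (η / (2 * ‖y‖)) • y)) (by
    rw [Prod.dist_eq, max_lt_iff]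
    refine ⟨hb, ?_⟩
    rw [dist_zero_right, hn]
    linarith)
  rw [map_zero, dist_zero_right, map_smul, norm_smul, Real.norm_of_nonneg (by positivity),
    div_mul_eq_mul_div, div_lt_one (by positivity)] at h1
  rw [div_mul_eq_mul_div, le_div_iff₀ hη, mul_comm]
  exact h1.le

theorem hasDerivAt_line (h : IsExtDeriv f df) (a v : D n j 1) (s : ℝ) :
    HasDerivAt (fun s : ℝ => f (D.incl (a + s • v))) (df (a + s • v) (D.incl v)) s := by
  rw [hasDerivAt_iff_isLittleO_nhds_zero]
  have ht : Tendsto (fun h : ℝ => h • v) (𝓝 0) (𝓝 0) := by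
    exact (continuous_id.smul continuous_const).tendsto' 0 0 (zero_smul ℝ v)
  have h1 := (h.isLittleO (a + s • v)).comp_tendsto ht
  have h2 : (fun h : ℝ => h • v) =O[𝓝 0] fun h => h :=
    IsBigO.of_bound ‖v‖ (Eventually.of_forall fun h => by rw [norm_smul, mul_comm])
  refine (h1.trans_isBigO h2).congr_left fun r => ?_
  simp only [Function.comp_apply]
  rw [add_assoc, ← add_smul, ← D.inclL_apply (r • v), map_smul, map_smul, D.inclL_apply]

/-- The mean value inequality on a segment in `D_j^1`, after subtracting the linear path with
velocity `y`. -/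
theorem norm_sub_sub_le (h : IsExtDeriv f df) {a b : D n j 1} {y : E m} {C : ℝ}
    (H : ∀ c ∈ segment ℝ a b, ‖df c (D.incl (b - a)) - y‖ ≤ C) :
    ‖f (D.incl b) - f (D.incl a) - y‖ ≤ C := by
  have key := norm_image_sub_le_of_norm_deriv_le_segment_01' (C := C)
    (f := fun s : ℝ => f (D.incl (a + s • (b - a))) - s • y)
    (f' := fun s => df (a + s • (b - a)) (D.incl (b - a)) - y)
    (fun s _ => by
      have h1 := (h.hasDerivAt_line a (b - a) s).sub ((hasDerivAt_id s).smul_const y)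
      rw [one_smul] at h1
      exact h1.hasDerivWithinAt)
    (fun s hs => H _ (by
      rw [segment_eq_image']
      exact ⟨s, ⟨hs.1, hs.2.le⟩, rfl⟩))
  have e : f (D.incl b) - f (D.incl a) - y = f (D.incl (a + (1 : ℝ) • (b - a))) - (1 : ℝ) • y
      - (f (D.incl (a + (0 : ℝ) • (b - a))) - (0 : ℝ) • y) := by
    rw [one_smul, one_smul, zero_smul, zero_smul, add_sub_cancel, add_zero]
    abel
  rw [e]
  exact key

variable {W : Type} [NormedAddCommGroup W] [NormedSpace ℝ W] [FiniteDimensional ℝ W]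

/-- The family needs only continuity in the strong space `D_j^1` and differentiability in the weak
space `D_j`. Along the segment from `v p` to `v q`, the error splits into `df` of the remainder of
`u`, controlled by local boundedness, and the oscillation of `df` on the range of `u'`. -/
theorem hasFDerivAt_comp (h : IsExtDeriv f df) {u : W → D n j 0} {v : W → D n j 1}
    {u' : W →L[ℝ] D n j 0} {p : W} (hv : ContinuousAt v p)
    (hvu : ∀ᶠ q in 𝓝 p, D.incl (v q) = u q) (hu : HasFDerivAt u u' p) :
    HasFDerivAt (fun q => f (u q))
      (LinearMap.toContinuousLinearMap ((df (v p)).comp u'.toLinearMap)) p := by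
  obtain ⟨η, hη, C, hC, hb⟩ := h.exists_norm_le (v p)
  let M : D n j 1 → W →L[ℝ] E m := fun b =>
    LinearMap.toContinuousLinearMap ((df b).comp u'.toLinearMap)
  -- Since `W` is finite-dimensional, continuity in each direction upgrades to the operator norm,
  -- although `df` itself need not be norm continuous.
  have hM : Continuous M := continuous_clm_apply.2 fun e =>
    h.continuous.comp (continuous_id.prodMk continuous_const)
  rw [hasFDerivAt_iff_isLittleO, isLittleO_iff]
  intro ε hε
  obtain ⟨η', hη', hMb⟩ := Metric.continuousAt_iff.1 (hM.continuousAt (x := v p)) (ε / 2)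
    (half_pos hε)
  have hu1 := isLittleO_iff.1 (hasFDerivAt_iff_isLittleO.1 hu) (c := ε / (2 * C)) (by positivity)
  have hball : ∀ᶠ q in 𝓝 p, v q ∈ Metric.ball (v p) (min η η') :=
    hv.eventually (Metric.ball_mem_nhds _ (lt_min hη hη'))
  filter_upwards [hvu, hu1, hball] with q hq1 hq2 hq3
  have hp1 := hvu.self_of_nhds
  have hδ : D.incl (v q - v p) = u q - u p := by
    rw [← D.inclL_apply, map_sub, D.inclL_apply, D.inclL_apply, hq1, hp1]
  have key := h.norm_sub_sub_le (a := v p) (b := v q) (y := M (v p) (q - p)) (C := ε * ‖q - p‖) (by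
    intro c hc
    have hcb : c ∈ Metric.ball (v p) (min η η') :=
      (convex_ball _ _).segment_subset (Metric.mem_ball_self (lt_min hη hη')) hq3 hc
    rw [Metric.mem_ball, lt_min_iff] at hcb
    have h1 := hb c hcb.1 (u q - u p - u' (q - p))
    have h2 := (M c - M (v p)).le_opNorm (q - p)
    have h3 : ‖M c - M (v p)‖ ≤ ε / 2 := by
      rw [← dist_eq_norm]
      exact (hMb hcb.2).le
    have e : df c (D.incl (v q - v p)) - M (v p) (q - p)
        = df c (u q - u p - u' (q - p)) + (M c - M (v p)) (q - p) := by
      rw [hδ]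
      show _ = _ + (df c (u' (q - p)) - M (v p) (q - p))
      rw [map_sub (df c) (u q - u p)]
      abel
    rw [e]
    calc _ ≤ _ := norm_add_le _ _
      _ ≤ C * (ε / (2 * C) * ‖q - p‖) + ε / 2 * ‖q - p‖ := by
        gcongr
        · exact h1.trans (by gcongr)
        · exact h2.trans (by gcongr)
      _ = ε * ‖q - p‖ := by
        field_simp
        ring)
  rw [hq1, hp1] at key
  exact key

end IsExtDeriv

end ExtDeriv

/-! ### Composition of `ECᵏ` functionals with jointly smooth families. -/

namespace IsEC

variable {n m : ℕ}

theorem succ_iff {k j : ℕ} {f : D n j 0 → E m} : IsEC (k + 1) f ↔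
    Continuous f ∧ ∃ df : D n j 1 → D n j 0 →ₗ[ℝ] E m,
      IsExtDeriv f df ∧ IsEC k (fun w : D n (j + 1) 0 => df (D.fst w) (D.snd w)) := Iff.rfl

theorem continuous : ∀ {k j : ℕ} {f : D n j 0 → E m}, IsEC k f → Continuous f
  | 0, _, _, h => h
  | _ + 1, _, _, h => h.1

theorem of_succ : ∀ {k j : ℕ} {f : D n j 0 → E m}, IsEC (k + 1) f → IsEC k f
  | 0, _, _, h => h.1
  | _ + 1, _, _, h => by
    obtain ⟨h1, df, h2, h3⟩ := succ_iff.1 h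
    exact succ_iff.2 ⟨h1, df, h2, of_succ h3⟩

theorem of_le {k l j : ℕ} {f : D n j 0 → E m} (h : IsEC k f) (hl : l ≤ k) : IsEC l f := by
  induction hl with
  | refl => exact h
  | step _ ih => exact ih h.of_succ

/-- Composition of an `ECᵏ` functional with a jointly `Cᵏ` family. -/
theorem contDiffOn_comp {k j : ℕ} {f : D n j 0 → E m} (hf : IsEC k f)
    {W : Type} [NormedAddCommGroup W] [NormedSpace ℝ W] [FiniteDimensional ℝ W] {Ω : Set W}
    (hΩ : IsOpen Ω) {u : W → D n j 0} (hu : JointCk k Ω u) :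
    ContDiffOn ℝ k (fun q => f (u q)) Ω := by
  induction k generalizing j W with
  | zero => exact contDiffOn_zero.2 (hf.continuous.comp_continuousOn (hu.continuousOn hΩ))
  | succ k ih =>
    obtain ⟨-, df, h, hdf⟩ := succ_iff.1 hf
    obtain ⟨v, hv, hvu⟩ := hu.exists_lift hΩ
    obtain ⟨u', hu', hu'k⟩ := hu.exists_fderiv hΩ
    have hder : ∀ p ∈ Ω, HasFDerivAt (fun q => f (u q))
        (LinearMap.toContinuousLinearMap ((df (v p)).comp (u' p).toLinearMap)) p := fun p hp =>
      h.hasFDerivAt_comp ((hv.of_le (Nat.zero_le k)).continuousAt hΩ hp)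
        (by filter_upwards [hΩ.mem_nhds hp] with q hq using hvu q hq) (hu' p hp)
    rw [Nat.cast_succ, contDiffOn_succ_iff_hasFDerivWithinAt_of_uniqueDiffOn hΩ.uniqueDiffOn]
    refine ⟨by simp, _, contDiffOn_clm_apply.2 fun e => ?_,
      fun p hp => (hder p hp).hasFDerivWithinAt⟩
    have hm : MapsTo (fun p => (p, e)) Ω (Ω ×ˢ univ) := fun p hp => ⟨hp, mem_univ _⟩
    -- In a fixed direction `e`, the derivative is the next functional evaluated on the pair (lifted
    -- family, derivative family) in `D_{j+1}`.
    exact ih hdf hΩ (hv.pair (hu'k.comp (φ := fun p => (p, e)) (by fun_prop) hm))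

/-- Composition of an `ECᵏ` functional with the time shifts of a jointly `Cᵏ` family. -/
theorem jointCk {k j : ℕ} {g : D n j 0 → E n} (hg : IsEC k g)
    {W : Type} [NormedAddCommGroup W] [NormedSpace ℝ W] [FiniteDimensional ℝ W] {Ω : Set W}
    (hΩ : IsOpen Ω) {u : W → D n j 0} (hu : JointCk k Ω u) {y : W → CT n 0}
    (hy : ∀ q ∈ Ω, ∀ t, y q t = g (D.shiftL n t j 0 (u q))) : CT.JointCk k Ω y := by
  rw [CT.JointCk.iff_zero]
  -- Time joins the parameters: the family of shifts over `ℝ × Ω` is jointly `Cᵏ`.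
  exact (hg.contDiffOn_comp (isOpen_univ.prod hΩ) hu.shift).congr fun z hz => hy z.2 hz.2 z.1

end IsEC

/-! ### The derivative of the operator `F` -/

theorem CT.continuous_shift_of_order {n r : ℕ} (x : CT n r) :
    Continuous (fun t => CT.shift t x) := by
  have h : CT.JointCk 0 univ (fun t : ℝ => CT.shift t x) := fun i hi => by
    refine contDiffOn_zero.2 (Continuous.continuousOn ?_)
    simp only [CT.iteratedDeriv_shift]
    exact (x.continuous_iteratedDeriv hi).comp (by fun_prop)
  exact continuous_iff_continuousAt.2 fun t => h.continuousAt isOpen_univ (mem_univ t)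

/-- The operator `[∂F(a, v)](t) = ∂¹f(Δ_t a, Δ_t v)`. -/
def opDF {n : ℕ} (df : D n 0 1 → D n 0 0 →ₗ[ℝ] E n)
    (hdf : Continuous (fun w : D n 0 1 × D n 0 0 => df w.1 w.2)) (a : CT n 1) :
    CT n 0 →ₗ[ℝ] CT n 0 where
  toFun v := CT.mk (fun t => df (CT.shift t a) (CT.shift t v))
    (contDiff_zero.2 (hdf.comp (f := fun t : ℝ => ((CT.shift t a : D n 0 1),
      (CT.shift t v : D n 0 0))) (a.continuous_shift_of_order.prodMk v.continuous_shift_of_order)))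
    (fun t => by
      have h1 : CT.shift (t + 2 * Real.pi) a = CT.shift t a := CT.ext fun s => by
        have h := a.periodic (t + s)
        show a (t + 2 * Real.pi + s) = a (t + s)
        rw [add_right_comm]
        exact h
      have h2 : CT.shift (t + 2 * Real.pi) v = CT.shift t v := CT.ext fun s => by
        have h := v.periodic (t + s)
        show v (t + 2 * Real.pi + s) = v (t + s)
        rw [add_right_comm]
        exact h
      exact congrArg₂ (fun (x : D n 0 1) (y : D n 0 0) => df x y) h1 h2)
  map_add' v w := CT.ext fun t => map_add (df (CT.shift t a)) (CT.shift t v) (CT.shift t w)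
  map_smul' c v := CT.ext fun t => map_smul (df (CT.shift t a)) c (CT.shift t v)

section OpDF

variable {n : ℕ} {df : D n 0 1 → D n 0 0 →ₗ[ℝ] E n}
  {hdf : Continuous (fun w : D n 0 1 × D n 0 0 => df w.1 w.2)}

theorem jointCk_opDF {k : ℕ} (hg : IsEC k (fun w : D n 1 0 => df (D.fst w) (D.snd w)))
    {W : Type} [NormedAddCommGroup W] [NormedSpace ℝ W] [FiniteDimensional ℝ W] {Ω : Set W}
    (hΩ : IsOpen Ω) {X : W → CT n 1} (hX : CT.JointCk k Ω X) {z : W → CT n 0}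
    (hz : CT.JointCk k Ω z) : CT.JointCk k Ω (fun q => opDF df hdf (X q) (z q)) :=
  hg.jointCk (j := 1) hΩ (JointCk.pair (n := n) (j := 0) (r := 0) (u := X) (v := z) hX hz)
    fun _ _ _ => rfl

end OpDF

/-! ### Contractive linear equations -/

section Contraction

variable {V : Type*} [NormedAddCommGroup V] [NormedSpace ℝ V]

/-- Neumann series: `1 - B` is invertible because `B` has norm at most 1/2. -/
theorem exists_linear_solution [CompleteSpace V] {B : V →ₗ[ℝ] V}
    (hB : ∀ v, ‖B v‖ ≤ 1 / 2 * ‖v‖) : ∃ S : V →ₗ[ℝ] V, ∀ b, S b = b + B (S b) := by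
  let Bc : V →L[ℝ] V := B.mkContinuous (1 / 2) hB
  have h1 : ‖Bc‖ < 1 := (B.mkContinuous_norm_le (by norm_num) hB).trans_lt (by norm_num)
  let U := Units.oneSub Bc h1
  refine ⟨((U⁻¹ : (V →L[ℝ] V)ˣ) : V →L[ℝ] V).toLinearMap, fun b => ?_⟩
  have h2 : (U : V →L[ℝ] V) * ((U⁻¹ : (V →L[ℝ] V)ˣ) : V →L[ℝ] V) = 1 := U.mul_inv
  have h3 := congrArg (fun A : V →L[ℝ] V => A b) h2
  simp only [mul_apply_eq_comp, one_apply_eq_self] at h3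
  have h4 : ∀ v, (U : V →L[ℝ] V) v = v - B v := fun v => rfl
  rw [h4] at h3
  exact sub_eq_iff_eq_add.1 h3

theorem isLittleO_clm_sub_apply {W : Type*} [NormedAddCommGroup W] [NormedSpace ℝ W]
    {M : W → W →L[ℝ] V} {p : W} (hM : ContinuousAt M p) :
    (fun q => (M q - M p) (q - p)) =o[𝓝 p] fun q => q - p := by
  rw [isLittleO_iff]
  intro ε hε
  have : Tendsto (fun q => ‖M q - M p‖) (𝓝 p) (𝓝 0) := by
    have h := (hM.sub_const (M p)).norm
    simpa [ContinuousAt] using h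
  filter_upwards [this.eventually (gt_mem_nhds hε)] with q hq
  exact ((M q - M p).le_opNorm _).trans (by gcongr)

/-- Absorbing the contracted term on the left gives `‖D‖ ≤ 2 ‖r‖`. All continuity and
differentiability proofs for fixed points below end this way. -/
theorem isLittleO_of_contraction {α V V' : Type*} [NormedAddCommGroup V] [NormedAddCommGroup V'] {l : Filter α}
    {D r : α → V} {e : α → V'} (hr : r =o[l] e)
    (h : ∀ᶠ a in l, ‖D a‖ ≤ 1 / 2 * ‖D a‖ + ‖r a‖) : D =o[l] e := by
  refine IsBigO.trans_isLittleO (IsBigO.of_bound 2 ?_) hr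
  filter_upwards [h] with a ha
  linarith

end Contraction

/-! ### Smoothing operators commuting with time shifts -/

/-- `T` and `Q` commute with time shifts, and `T x` has the time derivative `Q x`. -/
structure IsSmoothing {n : ℕ} (T Q : CT n 0 →L[ℝ] CT n 0) : Prop where
  shift_left : ∀ t x, T (CT.shift t x) = CT.shift t (T x)
  shift_right : ∀ t x, Q (CT.shift t x) = CT.shift t (Q x)
  hasDerivAt : ∀ x t, HasDerivAt (fun t => T x t) (Q x t) t

theorem CT.continuous_iteratedDeriv_apply {n r i : ℕ} (hi : i ≤ r) :
    Continuous (fun a : ℝ × CT n r => iteratedDeriv i (fun t => a.2 t) a.1) := by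
  refine continuous_prod_of_continuous_lipschitzWith' _ 1 (fun t => LipschitzWith.of_dist_le_mul
    fun x y => ?_) fun x => x.continuous_iteratedDeriv hi
  rw [NNReal.coe_one, one_mul, dist_eq_norm, dist_eq_norm, ← CT.iteratedDeriv_sub_apply _ _ hi]
  exact (x - y).norm_iteratedDeriv_le hi t

section Linear

variable {n : ℕ} {W : Type} [NormedAddCommGroup W] [NormedSpace ℝ W] {Ω : Set W}

theorem CT.JointCk.of_continuousOn {r : ℕ} {z : W → CT n r} (hz : ContinuousOn z Ω) :
    CT.JointCk 0 Ω z := fun _ hi =>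
  contDiffOn_zero.2 ((CT.continuous_iteratedDeriv_apply hi).comp_continuousOn
    (continuousOn_fst.prodMk (hz.comp continuousOn_snd fun _ ha => ha.2)))

variable [FiniteDimensional ℝ W] {T Q : CT n 0 →L[ℝ] CT n 0}

/-- The gain of regularity: `T y` has time derivative `Q y`, and both operators preserve joint order
by shift invariance, so no joint order is lost. -/
theorem IsSmoothing.exists_lift (hT : IsSmoothing T Q) {k : ℕ} (hΩ : IsOpen Ω)
    {y : W → CT n 0} (hy : CT.JointCk k Ω y) :
    ∃ v : W → CT n 1, CT.JointCk k Ω v ∧ ∀ q, (v q).incl = T (y q) := by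
  have hd : ∀ q, deriv (fun t => T (y q) t) = fun t => Q (y q) t := fun q =>
    funext fun t => (hT.hasDerivAt (y q) t).deriv
  have hc : ∀ q, ContDiff ℝ (1 : ℕ) (fun t => T (y q) t) := fun q => by
    rw [Nat.cast_one, contDiff_one_iff_deriv, hd]
    exact ⟨fun t => (hT.hasDerivAt (y q) t).differentiableAt, (Q (y q)).continuous⟩
  refine ⟨fun q => CT.mk _ (hc q) (T (y q)).periodic, fun i hi => ?_, fun q => rfl⟩
  show ContDiffOn ℝ k (fun z : ℝ × W => iteratedDeriv i (fun t => T (y z.2) t) z.1) _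
  interval_cases i
  · simpa using CT.JointCk.iff_zero.1 (CT.JointCk.clm_comp hΩ hT.shift_left hy)
  · simp only [iteratedDeriv_one, hd]
    exact CT.JointCk.iff_zero.1 (CT.JointCk.clm_comp hΩ hT.shift_right hy)

variable {df : D n 0 1 → D n 0 0 →ₗ[ℝ] E n}
  {hdf : Continuous (fun w : D n 0 1 × D n 0 0 => df w.1 w.2)}

theorem continuousOn_opDF (hΩ : IsOpen Ω) {X : W → CT n 1} (hX : CT.JointCk 0 Ω X) (v : CT n 0) :
    ContinuousOn (fun q => opDF df hdf (X q) v) Ω := by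
  have hg : IsEC 0 (fun w : D n 1 0 => df (D.fst w) (D.snd w)) := hdf
  have h := jointCk_opDF (hdf := hdf) hg hΩ hX
    (CT.JointCk.of_continuousOn (continuousOn_const (c := v)))
  exact fun p hp => (h.continuousAt hΩ hp).continuousWithinAt

/-- Derivative with respect to parameters of `∂F(X(p), v)`, for fixed `v`. -/
theorem exists_fderiv_opDF {k : ℕ}
    (hg : IsEC (k + 1) (fun w : D n 1 0 => df (D.fst w) (D.snd w)))
    (hΩ : IsOpen Ω) {X : W → CT n 1} (hX : CT.JointCk (k + 1) Ω X) {z : W → CT n 0}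
    {zl : W → CT n 1} (hz : CT.JointCk k Ω zl) (hzl : ∀ q ∈ Ω, (zl q).incl = z q) :
    ∃ G : W → W →L[ℝ] CT n 0,
      (∀ p ∈ Ω, HasFDerivAt (fun q => opDF df hdf (X q) (z p)) (G p) p) ∧
      CT.JointCk k (Ω ×ˢ univ) (fun a : W × W => G a.1 a.2) := by
  -- With `z p` frozen at an element of `C¹`, the constant family is jointly `C¹`. Thus no
  -- differentiability of `z` in the parameter enters, which avoids circularity.
  have hex : ∀ p ∈ Ω, ∃ A : W →L[ℝ] CT n 0,
      HasFDerivAt (fun q => opDF df hdf (X q) (z p)) A p := by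
    intro p hp
    have h0 : CT.JointCk 1 Ω (fun _ : W => z p) := by
      rw [← hzl p hp]
      exact CT.JointCk.const_incl (zl p)
    have h1 : CT.JointCk (0 + 1) Ω (fun q => opDF df hdf (X q) (z p)) :=
      jointCk_opDF (hg.of_le (Nat.succ_le_succ (Nat.zero_le k))) hΩ
        (hX.of_le (Nat.succ_le_succ (Nat.zero_le k))) h0
    obtain ⟨u', hu', -⟩ := h1.exists_fderiv hΩ
    exact ⟨u' p, hu' p hp⟩
  classical
  choose! G hG using hex
  refine ⟨G, hG, ?_⟩
  obtain ⟨-, dg, hdg, hdgk⟩ := IsEC.succ_iff.1 hg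
  obtain ⟨Xl, hXl, hXl'⟩ := hX.exists_lift hΩ
  obtain ⟨X', hX', hX'k⟩ := hX.exists_fderiv hΩ
  have hm : MapsTo (Prod.fst : W × W → W) (Ω ×ˢ univ) Ω := fun a ha => ha.1
  -- The derivative of `∂F` is the second extended derivative of `f` at an element of `D_2`; the
  -- last entry is 0 because `z p` does not vary.
  have h1 : JointCk k (Ω ×ˢ univ) (fun a : W × W =>
      (D.pair (D.pair (j := 0) (Xl a.1) (zl a.1)) (D.pair (j := 0) (X' a.1 a.2) 0) : D n 2 0)) :=
    JointCk.pair
      (JointCk.pair (j := 0) (r := 1) (hXl.comp contDiffOn_fst hm) (hz.comp contDiffOn_fst hm))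
      (JointCk.pair (j := 0) (r := 0) hX'k CT.JointCk.zero)
  refine hdgk.jointCk (j := 2) (hΩ.prod isOpen_univ) h1 ?_
  rintro ⟨p, e⟩ ⟨hp, -⟩ t
  have e1 : HasFDerivAt (fun q => opDF df hdf (X q) (z p) t) ((CT.evalL n 0 t).comp (G p)) p :=
    (CT.evalL n 0 t).hasFDerivAt.comp p (hG p hp)
  have hv : ContinuousAt (fun q => D.shiftL n t 1 1
      (D.pair (n := n) (j := 0) (r := 1) (Xl q) (zl p))) p :=
    (D.shiftL n t 1 1).continuous.continuousAt.comp (D.continuousAt_pair (j := 0)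
      ((hXl.of_le (Nat.zero_le k)).continuousAt hΩ hp) continuousAt_const)
  have hu : HasFDerivAt (fun q => D.shiftL n t 1 0
      (D.pair (n := n) (j := 0) (r := 0) (X q) (z p)))
      ((D.shiftL n t 1 0).comp (D.pairL (j := 0) (r := 0) (X' p) 0)) p :=
    (D.shiftL n t 1 0).hasFDerivAt.comp p (D.hasFDerivAt_pair (j := 0) (r := 0) (hX' p hp)
      (hasFDerivAt_const (F := CT n 0) (z p) p))
  have e2 := hdg.hasFDerivAt_comp hv (by
    filter_upwards [hΩ.mem_nhds hp] with q hq
    rw [← D.shiftL_incl]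
    congr 1
    exact Prod.ext (hXl' q hq) (hzl p hp)) hu
  have e3 := HasFDerivAt.unique e1 e2
  exact congrArg (fun A : W →L[ℝ] E n => A e) e3

/-- Smooth dependence on parameters of the solution of the linear equation
`z = b(p) + T ∂F(X(p), z)`. -/
theorem jointCk_of_linear_fixedPoint {n : ℕ} {T Q : CT n 0 →L[ℝ] CT n 0} (hT : IsSmoothing T Q)
    {df : D n 0 1 → D n 0 0 →ₗ[ℝ] E n}
    {hdf : Continuous (fun w : D n 0 1 × D n 0 0 => df w.1 w.2)} {k : ℕ}
    (hg : IsEC k (fun w : D n 1 0 => df (D.fst w) (D.snd w)))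
    {W : Type} [NormedAddCommGroup W] [NormedSpace ℝ W] [FiniteDimensional ℝ W]
    {Ω : Set W} (hΩ : IsOpen Ω) {X : W → CT n 1} (hX : CT.JointCk k Ω X)
    (hA : ∀ q ∈ Ω, ∀ v, ‖T (opDF df hdf (X q) v)‖ ≤ 1 / 2 * ‖v‖) {b z : W → CT n 0}
    (hb : CT.JointCk k Ω b) (hz : ∀ q ∈ Ω, z q = b q + T (opDF df hdf (X q) (z q))) :
    CT.JointCk k Ω z := by
  -- The parameter space must vary: the derivative satisfies an equation of the same kind over `W ×
  -- W`, with parameters `(p, e)`.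
  induction k generalizing W with
  | zero =>
    refine CT.JointCk.of_continuousOn fun p hp => ContinuousAt.continuousWithinAt ?_
    have hr : Tendsto (fun q => (b q - b p)
        + (T (opDF df hdf (X q) (z p)) - T (opDF df hdf (X p) (z p)))) (𝓝 p) (𝓝 0) := by
      have h1 := (hb.continuousAt hΩ hp).sub_const (b p)
      have h2 : ContinuousAt (fun q => T (opDF df hdf (X q) (z p))) p :=
        T.continuous.continuousAt.comp
          ((continuousOn_opDF hΩ hX (z p)).continuousAt (hΩ.mem_nhds hp))
      have h3 := h1.add (h2.sub_const (T (opDF df hdf (X p) (z p))))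
      simpa [ContinuousAt] using h3
    have hr1 := (isLittleO_one_iff ℝ).2 hr
    have := isLittleO_of_contraction (D := fun q => z q - z p) hr1 (by
      filter_upwards [hΩ.mem_nhds hp] with q hq
      have e : z q - z p = T (opDF df hdf (X q) (z q - z p)) + ((b q - b p)
          + (T (opDF df hdf (X q) (z p)) - T (opDF df hdf (X p) (z p)))) := by
        rw [map_sub, map_sub]
        nth_rewrite 1 [hz q hq, hz p hp]
        abel
      calc ‖z q - z p‖ ≤ _ := by
            nth_rewrite 1 [e]
            exact norm_add_le _ _
        _ ≤ _ := add_le_add (hA q hq _) le_rfl)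
    have h := (isLittleO_one_iff ℝ).1 this
    have h2 := h.add_const (z p)
    simpa [ContinuousAt] using h2
  | succ k ih =>
    have hzk : CT.JointCk k Ω z := ih hg.of_succ hΩ (hX.of_le k.le_succ) hA (hb.of_le k.le_succ) hz
    obtain ⟨v, hv, hv'⟩ := hT.exists_lift hΩ
      (jointCk_opDF (hdf := hdf) hg.of_succ hΩ (hX.of_le k.le_succ) hzk)
    obtain ⟨bl, hbl, hbl'⟩ := hb.exists_lift hΩ
    obtain ⟨b', hb', hb'k⟩ := hb.exists_fderiv hΩ
    have hzl : CT.JointCk k Ω (fun q => bl q + v q) := hbl.add hv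
    have hzl' : ∀ q ∈ Ω, (bl q + v q).incl = z q := by
      intro q hq
      rw [hz q hq, ← hbl' q hq, ← hv' q]
      rfl
    obtain ⟨G, hG, hGk⟩ := exists_fderiv_opDF (hdf := hdf) hg hΩ hX hzl hzl'
    have hS : ∀ p ∈ Ω, ∃ S : CT n 0 →ₗ[ℝ] CT n 0, ∀ b, S b = b + T (opDF df hdf (X p) (S b)) :=
      fun p hp => exists_linear_solution
        (B := T.toLinearMap.comp (opDF df hdf (X p))) (hA p hp)
    choose! S hS using hS
    -- Candidate derivative from formal differentiation: `w = b' + T G + T ∂F(X, w)`, where `G`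
    -- differentiates `∂F(X, z)` with `z` frozen.
    let w : W → W →L[ℝ] CT n 0 := fun p =>
      LinearMap.toContinuousLinearMap ((S p).comp (b' p + T.comp (G p)).toLinearMap)
    have hw : ∀ p ∈ Ω, ∀ e, w p e = (b' p e + T (G p e)) + T (opDF df hdf (X p) (w p e)) :=
      fun p hp e => hS p hp (b' p e + T (G p e))
    have hΩ' : IsOpen (Ω ×ˢ (univ : Set W)) := hΩ.prod isOpen_univ
    have hwk : CT.JointCk k (Ω ×ˢ univ) (fun a : W × W => w a.1 a.2) :=
      ih hg.of_succ hΩ' (X := fun a : W × W => X a.1)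
        ((hX.of_le k.le_succ).comp contDiffOn_fst fun a ha => ha.1)
        (fun a ha => hA a.1 ha.1) (hb'k.add (CT.JointCk.clm_comp hΩ' hT.shift_left hGk))
        (fun a ha => hw a.1 ha.1 a.2)
    refine CT.JointCk.succ_of_lift_of_fderiv hΩ hzl hzl' (w := w) (fun p hp => ?_) hwk
    rw [hasFDerivAt_iff_isLittleO]
    let M : W → W →L[ℝ] CT n 0 := fun q => LinearMap.toContinuousLinearMap
      (T.toLinearMap.comp ((opDF df hdf (X q)).comp (w p).toLinearMap))
    have hM : ContinuousAt M p := by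
      refine ContinuousOn.continuousAt (s := Ω) ?_ (hΩ.mem_nhds hp)
      refine continuousOn_clm_apply.2 fun e => ?_
      exact T.continuous.comp_continuousOn
        (continuousOn_opDF (hdf := hdf) hΩ (hX.of_le (Nat.zero_le _)) (w p e))
    have hTG : HasFDerivAt (fun q => T (opDF df hdf (X q) (z p))) (T.comp (G p)) p :=
      T.hasFDerivAt.comp p (hG p hp)
    refine isLittleO_of_contraction (((hb' p hp).isLittleO.add hTG.isLittleO).add
      (isLittleO_clm_sub_apply hM)) ?_
    filter_upwards [hΩ.mem_nhds hp] with q hq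
    -- The remainder satisfies the same contractive equation, with forcing made of the remainders of
    -- `b` and of `T ∂F(X, z p)` and the variation of `∂F(X)` along `w p`, all of lower order.
    have e : z q - z p - w p (q - p) = T (opDF df hdf (X q) (z q - z p - w p (q - p)))
        + (b q - b p - b' p (q - p) + (T (opDF df hdf (X q) (z p)) - T (opDF df hdf (X p) (z p))
          - T.comp (G p) (q - p)) + (M q - M p) (q - p)) := by
      have e1 : (M q - M p) (q - p)
          = T (opDF df hdf (X q) (w p (q - p))) - T (opDF df hdf (X p) (w p (q - p))) := rfl
      have e2 : T.comp (G p) (q - p) = T (G p (q - p)) := rfl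
      rw [e1, e2]
      simp only [map_sub (opDF df hdf (X q)), map_sub T]
      nth_rewrite 1 [hz q hq, hz p hp, hw p hp]
      abel
    calc ‖z q - z p - w p (q - p)‖ ≤ _ := by
          nth_rewrite 1 [e]
          exact norm_add_le _ _
      _ ≤ _ := by
        gcongr
        exact hA q hq _

end Linear

/-! ### Mollification -/

namespace CT

variable {n : ℕ}

theorem hasDerivAt_integral (x : CT n 0) (h t : ℝ) :
    HasDerivAt (fun t => ∫ s in t..t + h, x s) (x (t + h) - x t) t := by
  have hi : ∀ a b, IntervalIntegrable (fun s => x s) MeasureTheory.volume a b :=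
    fun a b => x.continuous.intervalIntegrable a b
  have h1 : ∀ t, HasDerivAt (fun t => ∫ s in (0 : ℝ)..t, x s) (x t) t := fun t =>
    x.continuous.integral_hasStrictDerivAt 0 t |>.hasDerivAt
  have h2 : (fun t => ∫ s in t..t + h, x s)
      = fun t => (∫ s in (0 : ℝ)..t + h, x s) - ∫ s in (0 : ℝ)..t, x s := by
    funext t
    rw [intervalIntegral.integral_interval_sub_left (hi _ _) (hi _ _)]
  rw [h2]
  exact ((h1 (t + h)).comp_add_const t h).sub (h1 t)

/-- The average of `x` over intervals of length `h`. -/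
def mollify (h : ℝ) (x : CT n 0) : CT n 1 :=
  mk (fun t => h⁻¹ • ∫ s in t..t + h, x s)
    (by
      have hd : ∀ t, HasDerivAt (fun t => h⁻¹ • ∫ s in t..t + h, x s)
        (h⁻¹ • (x (t + h) - x t)) t := fun t => (x.hasDerivAt_integral h t).const_smul h⁻¹
      rw [Nat.cast_one, contDiff_one_iff_deriv]
      refine ⟨fun t => (hd t).differentiableAt, ?_⟩
      rw [funext fun t => (hd t).deriv]
      have := x.continuous
      fun_prop)
    (fun t => by
      have h1 := intervalIntegral.integral_comp_add_right (a := t) (b := t + h) (fun s => x s)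
        (2 * Real.pi)
      have h2 : (fun s => x (s + 2 * Real.pi)) = fun s => x s := funext fun s => x.periodic s
      rw [h2] at h1
      show h⁻¹ • _ = h⁻¹ • _
      rw [h1, add_right_comm])

theorem mollify_apply (h : ℝ) (x : CT n 0) (t : ℝ) :
    mollify h x t = h⁻¹ • ∫ s in t..t + h, x s := rfl

theorem iteratedDeriv_one_mollify (h : ℝ) (x : CT n 0) (t : ℝ) :
    iteratedDeriv 1 (fun t => mollify h x t) t = h⁻¹ • (x (t + h) - x t) := by
  rw [iteratedDeriv_one]
  exact ((x.hasDerivAt_integral h t).const_smul h⁻¹).deriv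

theorem mollify_sub (h : ℝ) (x y : CT n 0) : mollify h (x - y) = mollify h x - mollify h y := by
  ext1 t
  rw [sub_apply]
  simp only [mollify_apply, sub_apply]
  rw [intervalIntegral.integral_sub (x.continuous.intervalIntegrable _ _)
    (y.continuous.intervalIntegrable _ _), smul_sub]

theorem norm_mollify_apply_le {h : ℝ} (hh : 0 < h) (x : CT n 0) (y : E n) {c t : ℝ}
    (H : ∀ s ∈ Icc t (t + h), ‖x s - y‖ ≤ c) : ‖mollify h x t - y‖ ≤ c := by
  have e : mollify h x t - y = h⁻¹ • ∫ s in t..t + h, (x s - y) := by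
    rw [mollify_apply, intervalIntegral.integral_sub (x.continuous.intervalIntegrable _ _)
      (continuous_const.intervalIntegrable _ _), intervalIntegral.integral_const, smul_sub,
      add_sub_cancel_left, smul_smul, inv_mul_cancel₀ hh.ne', one_smul]
  rw [e, norm_smul, norm_inv, Real.norm_of_nonneg hh.le]
  have h1 := intervalIntegral.norm_integral_le_of_norm_le_const (a := t) (b := t + h) (C := c)
    (f := fun s => x s - y) (fun s hs => H s (by
      rw [uIoc_of_le (by linarith)] at hs
      exact ⟨hs.1.le, hs.2⟩))
  rw [add_sub_cancel_left, abs_of_pos hh] at h1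
  rw [inv_mul_le_iff₀ hh, mul_comm]
  exact h1

theorem tendsto_mollify_incl (x : CT n 0) :
    Tendsto (fun h => (mollify h x).incl) (𝓝[>] 0) (𝓝 x) := by
  rw [Metric.tendsto_nhds]
  intro ε hε
  obtain ⟨δ, hδ, H⟩ := Metric.uniformContinuous_iff.1 x.uniformContinuous (ε / 2) (half_pos hε)
  filter_upwards [self_mem_nhdsWithin, nhdsWithin_le_nhds (Iio_mem_nhds hδ)] with h h0 h1
  have h0 : 0 < h := h0
  have h1 : h < δ := h1
  rw [dist_eq_norm]
  refine lt_of_le_of_lt ((norm_le_iff_zero _ (half_pos hε).le).2 fun t => ?_) (half_lt_self hε)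
  refine norm_mollify_apply_le h0 x (x t) fun s hs => ?_
  rw [← dist_eq_norm]
  refine (H ?_).le
  rw [Real.dist_eq, abs_lt]
  constructor <;> linarith [hs.1, hs.2]

theorem denseRange_incl : DenseRange (incl : CT n 1 → CT n 0) := fun x =>
  mem_closure_of_tendsto x.tendsto_mollify_incl (Eventually.of_forall fun _ => mem_range_self _)

theorem norm_le_iff_one (x : CT n 1) {c : ℝ} (hc : 0 ≤ c) :
    ‖x‖ ≤ c ↔ ∀ t, ‖x t‖ ≤ c ∧ ‖iteratedDeriv 1 (fun t => x t) t‖ ≤ c := by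
  rw [norm_le_iff x hc]
  refine ⟨fun h t => ⟨by simpa using h 0 zero_le_one t, h 1 le_rfl t⟩, fun h i hi t => ?_⟩
  interval_cases i
  · simpa using (h t).1
  · exact (h t).2

/-- The derivative of a `C¹` function. -/
def derivC (x : CT n 1) : CT n 0 :=
  mk (iteratedDeriv 1 (fun t => x t)) (contDiff_zero.2 (x.continuous_iteratedDeriv le_rfl))
    (x.iteratedDeriv_periodic 1)

theorem derivC_apply (x : CT n 1) (t : ℝ) : x.derivC t = iteratedDeriv 1 (fun t => x t) t := rfl

theorem integral_derivC (x : CT n 1) (a b : ℝ) : ∫ s in a..b, x.derivC s = x b - x a :=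
  intervalIntegral.integral_eq_sub_of_hasDerivAt (fun t _ => x.hasDerivAt t)
    (x.derivC.continuous.intervalIntegrable _ _)

theorem tendsto_mollify (x : CT n 1) :
    Tendsto (fun h => mollify h x.incl) (𝓝[>] 0) (𝓝 x) := by
  rw [Metric.tendsto_nhds]
  intro ε hε
  filter_upwards [Metric.tendsto_nhds.1 x.incl.tendsto_mollify_incl (ε / 2) (half_pos hε),
    Metric.tendsto_nhds.1 x.derivC.tendsto_mollify_incl (ε / 2) (half_pos hε)] with h h1 h2
  rw [dist_eq_norm] at h1 h2 ⊢
  refine lt_of_le_of_lt ((norm_le_iff_one _ (half_pos hε).le).2 fun t => ⟨?_, ?_⟩)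
    (half_lt_self hε)
  · exact (norm_apply_le ((mollify h x.incl).incl - x.incl) t).trans h1.le
  · rw [iteratedDeriv_sub_apply _ _ le_rfl, iteratedDeriv_one_mollify]
    have h3 := (norm_apply_le _ t).trans h2.le
    rw [sub_apply, incl_apply, mollify_apply, integral_derivC] at h3
    exact h3

/-! ### The Lipschitz norm -/

theorem lipNorm_le_iff (x : CT n 0) {c : ℝ} (hc : 0 ≤ c) :
    lipNorm x ≤ ENNReal.ofReal c ↔ ‖x‖ ≤ c ∧ ∀ s t, ‖x s - x t‖ ≤ c * |s - t| := by
  have h1 : ∀ {V : Type} [NormedAddCommGroup V] (v : V) {c : ℝ}, 0 ≤ c →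
      (‖v‖ₑ ≤ ENNReal.ofReal c ↔ ‖v‖ ≤ c) := fun v c hc => by
    rw [← ofReal_norm, ENNReal.ofReal_le_ofReal_iff hc]
  rw [lipNorm, max_le_iff, h1 x hc]
  refine and_congr_right fun _ => ?_
  simp only [iSup_le_iff]
  refine forall₂_congr fun s t => ?_
  constructor
  · intro h
    rcases eq_or_ne s t with rfl | hst
    · simp
    have h2 := h hst
    have hpos : 0 < |s - t| := abs_pos.2 (sub_ne_zero.2 hst)
    rw [ENNReal.div_le_iff (by simpa [sub_eq_zero] using hst) (by simp), ← ofReal_norm (s - t),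
      ← ENNReal.ofReal_mul hc, h1 _ (by positivity), Real.norm_eq_abs] at h2
    exact h2
  · intro h hst
    rw [ENNReal.div_le_iff (by simpa [sub_eq_zero] using hst) (by simp), ← ofReal_norm (s - t),
      ← ENNReal.ofReal_mul hc, h1 _ (by positivity), Real.norm_eq_abs]
    exact h

theorem lipNorm_add_le {x y : CT n 0} {c d : ℝ} (hc : 0 ≤ c) (hd : 0 ≤ d)
    (hx : lipNorm x ≤ ENNReal.ofReal c) (hy : lipNorm y ≤ ENNReal.ofReal d) :
    lipNorm (x + y) ≤ ENNReal.ofReal (c + d) := by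
  rw [lipNorm_le_iff _ hc] at hx
  rw [lipNorm_le_iff _ hd] at hy
  rw [lipNorm_le_iff _ (add_nonneg hc hd)]
  refine ⟨(norm_add_le _ _).trans (add_le_add hx.1 hy.1), fun s t => ?_⟩
  have e : (x + y) s - (x + y) t = (x s - x t) + (y s - y t) := by
    simp only [add_apply]
    abel
  rw [e, add_mul]
  exact (norm_add_le _ _).trans (add_le_add (hx.2 s t) (hy.2 s t))

theorem lipNorm_neg (x : CT n 0) : lipNorm (-x) = lipNorm x := by
  have h : ∀ t, (-x) t = - x t := fun t => rfl
  simp only [lipNorm, enorm_neg, h, neg_sub_neg]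
  congr 1
  refine iSup_congr fun s => iSup_congr fun t => ?_
  rw [enorm_sub_rev]

theorem norm_sub_le (x : CT n 1) (s t : ℝ) : ‖x s - x t‖ ≤ ‖x‖ * |s - t| := by
  have := Convex.norm_image_sub_le_of_norm_hasDerivWithin_le (s := univ) (C := ‖x‖)
    (fun t _ => (x.hasDerivAt t).hasDerivWithinAt) (fun t _ => x.norm_iteratedDeriv_le le_rfl t)
    convex_univ (mem_univ t) (mem_univ s)
  simpa using this

theorem norm_incl_le (x : CT n 1) : ‖x.incl‖ ≤ ‖x‖ :=
  (norm_le_iff_zero _ (norm_nonneg x)).2 x.norm_apply_le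

theorem lipNorm_incl_le (x : CT n 1) : lipNorm x.incl ≤ ENNReal.ofReal ‖x‖ :=
  (lipNorm_le_iff _ (norm_nonneg x)).2
    ⟨x.norm_incl_le, fun s t => x.norm_sub_le s t⟩

/-- A Lipschitz bound becomes a `C¹` bound with the same constant. This lets `EC` derivatives,
defined only at `C¹` points, act on Lipschitz balls. -/
theorem norm_mollify_le {h : ℝ} (hh : 0 < h) {x : CT n 0} {c : ℝ} (hc : 0 ≤ c)
    (hx : lipNorm x ≤ ENNReal.ofReal c) : ‖mollify h x‖ ≤ c := by
  rw [lipNorm_le_iff _ hc] at hx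
  refine (norm_le_iff_one _ hc).2 fun t => ⟨?_, ?_⟩
  · have := norm_mollify_apply_le hh x 0 (c := c) (t := t) fun s _ => by
      rw [sub_zero]
      exact (x.norm_apply_le s).trans hx.1
    simpa using this
  · rw [iteratedDeriv_one_mollify, norm_smul, norm_inv, Real.norm_of_nonneg hh.le,
      inv_mul_le_iff₀ hh]
    have := hx.2 (t + h) t
    rwa [add_sub_cancel_left, abs_of_pos hh, mul_comm] at this

end CT

/-! ### Smooth dependence of fixed points on parameters -/

section Nonlinear

variable {n : ℕ} {f : C(CT n 0, E n)} {df : D n 0 1 → D n 0 0 →ₗ[ℝ] E n}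

theorem jointCk_opF {k : ℕ} (hf : IsEC k (j := 0) (fun x : CT n 0 => f x)) {W : Type}
    [NormedAddCommGroup W] [NormedSpace ℝ W] [FiniteDimensional ℝ W] {Ω : Set W}
    (hΩ : IsOpen Ω) {X : W → CT n 0} (hX : CT.JointCk k Ω X) :
    CT.JointCk k Ω (fun q => opF f (X q)) :=
  hf.jointCk (j := 0) hΩ (u := X) hX fun _ _ _ => rfl

/-- Directional differentiability of the operator `F` at points of `C¹(𝕋; ℝⁿ)`. -/
theorem hasFDerivAt_opF (hf : IsEC 1 (j := 0) (fun x : CT n 0 => f x))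
    (hdf : IsExtDeriv (j := 0) (fun x : CT n 0 => f x) df) {W : Type}
    [NormedAddCommGroup W] [NormedSpace ℝ W] [FiniteDimensional ℝ W] (a : CT n 1)
    (L : W →L[ℝ] CT n 1) :
    HasFDerivAt (fun e => opF f (a + L e).incl) (LinearMap.toContinuousLinearMap
      ((opDF df hdf.continuous a).comp ((CT.inclL n 0).comp L).toLinearMap)) 0 := by
  have hu : ∀ p, HasFDerivAt (fun e => (a + L e).incl) ((CT.inclL n 0).comp L) p := fun p =>
    ((CT.inclL n 0).comp L).hasFDerivAt.const_add a.incl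
  have hc : Continuous (fun e => a + L e) := by fun_prop
  -- Because `L` takes values in `C¹`, the affine family is jointly `C¹`, so `F` is Fréchet
  -- differentiable along it.
  have hk : CT.JointCk 1 univ (fun e => (a + L e).incl) := by
    refine CT.JointCk.succ_of_lift_of_fderiv (k := 0) isOpen_univ
      (CT.JointCk.of_continuousOn hc.continuousOn) (fun q _ => rfl) (fun q _ => hu q)
      (CT.JointCk.of_continuousOn ?_)
    exact (((CT.inclL n 0).comp L).continuous.comp continuous_snd).continuousOn
  have hk2 : CT.JointCk (0 + 1) univ (fun e => opF f (a + L e).incl) :=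
    jointCk_opF hf isOpen_univ hk
  obtain ⟨A, hA, -⟩ := hk2.exists_fderiv isOpen_univ
  convert hA 0 (mem_univ 0) using 1
  -- It remains to identify the derivative, which is done at each time by the chain rule for `f`.
  ext e t : 2
  have e1 : HasFDerivAt (fun e => opF f (a + L e).incl t) ((CT.evalL n 0 t).comp (A 0)) 0 :=
    (CT.evalL n 0 t).hasFDerivAt.comp 0 (hA 0 (mem_univ 0))
  have e2 := hdf.hasFDerivAt_comp (u := fun e => CT.shiftL n 0 t (a + L e).incl)
    (v := fun e => CT.shiftL n 1 t (a + L e)) (p := 0)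
    ((CT.shiftL n 1 t).continuous.comp hc).continuousAt (Eventually.of_forall fun q => rfl)
    ((CT.shiftL n 0 t).hasFDerivAt.comp 0 (hu 0))
  have e3 := congrArg (fun A : W →L[ℝ] E n => A e) (HasFDerivAt.unique e1 e2)
  refine Eq.trans ?_ e3.symm
  show df (CT.shift t a) _ = df (CT.shift t (a + L 0)) _
  rw [map_zero, add_zero]
  rfl

/-- For `v` in `C¹`, the difference quotients of `F` at `a` along `v` stay in `B` and inherit its
Lipschitz constant; density of `C¹` and continuity of `∂¹f` in its second argument give all `v` in
`C⁰`. -/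
theorem norm_opDF_le (hf : IsEC 1 (j := 0) (fun x : CT n 0 => f x))
    (hdf : IsExtDeriv (j := 0) (fun x : CT n 0 => f x) df) {B : Set (CT n 0)} {K : ℝ}
    (hK : 0 ≤ K) (hB : ∀ x ∈ B, ∀ y ∈ B, ‖opF f x - opF f y‖ ≤ K * ‖x - y‖) {a : CT n 1}
    (ha : ∀ᶠ b in 𝓝 a, b.incl ∈ B) (v : CT n 0) :
    ‖opDF df hdf.continuous a v‖ ≤ K * ‖v‖ := by
  rw [CT.norm_le_iff_zero _ (by positivity)]
  intro t
  have hcl : IsClosed {v : CT n 0 | ‖opDF df hdf.continuous a v t‖ ≤ K * ‖v‖} := by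
    refine isClosed_le (Continuous.norm ?_) (by fun_prop)
    exact hdf.continuous.comp (f := fun v : CT n 0 => ((CT.shift t a : D n 0 1),
      (CT.shift t v : D n 0 0))) (continuous_const.prodMk (CT.shiftL n 0 t).continuous)
  refine CT.denseRange_incl.induction_on v hcl fun v => ?_
  have hd := hasFDerivAt_opF hf hdf a (ContinuousLinearMap.toSpanSingleton ℝ v)
  have hc : Tendsto (fun s : ℝ => a + ContinuousLinearMap.toSpanSingleton ℝ v s) (𝓝 0) (𝓝 a) := by
    have := (by fun_prop : Continuous
      fun s : ℝ => a + ContinuousLinearMap.toSpanSingleton ℝ v s).tendsto 0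
    simpa only [map_zero, add_zero] using this
  have h1 := hd.hasDerivAt.le_of_lip' (C := K * ‖v.incl‖) (by positivity) (by
    filter_upwards [hc.eventually ha] with s hs
    refine (hB _ hs _ ?_).trans ?_
    · simpa using ha.self_of_nhds
    · have e : (a + ContinuousLinearMap.toSpanSingleton ℝ v s).incl
          - (a + ContinuousLinearMap.toSpanSingleton ℝ v 0).incl = s • v.incl := by
        ext1 t
        simp
      rw [e, norm_smul, sub_zero]
      exact le_of_eq (by ring))
  refine ((CT.norm_apply_le _ t).trans ?_).trans h1
  refine le_of_eq (congrArg norm ?_)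
  show _ = opDF df hdf.continuous a (((1 : ℝ) • v : CT n 1).incl)
  rw [one_smul]

/-- The pointwise lift is linear since the inclusion is injective, and bounded in `C¹` since `W` is
finite-dimensional. -/
theorem exists_clm_lift {W : Type*} [NormedAddCommGroup W] [NormedSpace ℝ W]
    [FiniteDimensional ℝ W] (w : W →ₗ[ℝ] CT n 0) (h : ∀ e, ∃ x : CT n 1, x.incl = w e) :
    ∃ L : W →L[ℝ] CT n 1, ∀ e, (L e).incl = w e := by
  choose g hg using h
  refine ⟨LinearMap.toContinuousLinearMap
    { toFun := g
      map_add' := fun a b => CT.incl_injective ?_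
      map_smul' := fun c a => CT.incl_injective ?_ }, hg⟩
  · rw [hg, map_add, ← hg a, ← hg b]
    rfl
  · rw [hg, map_smul, ← hg a]
    rfl

/-- Smooth dependence on parameters of the solution of `x = b(p) + T F(x)`. -/
theorem jointCk_of_fixedPoint {T Q : CT n 0 →L[ℝ] CT n 0} (hT : IsSmoothing T Q) {m : ℕ}
    (hf : IsEC m (j := 0) (fun x : CT n 0 => f x)) {W : Type} [NormedAddCommGroup W]
    [NormedSpace ℝ W] [FiniteDimensional ℝ W] {U : Set W} (hU : IsOpen U) {b : W → CT n 0}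
    (hb : ∀ k, CT.JointCk k U b) {B : Set (CT n 0)} {K : ℝ} (hK : 0 < K)
    (hB : ∀ x ∈ B, ∀ y ∈ B, ‖opF f x - opF f y‖ ≤ K * ‖x - y‖)
    (hTK : ∀ x, ‖T x‖ ≤ 1 / (2 * K) * ‖x‖) {X : W → CT n 0}
    (hXB : ∀ p ∈ U, ∀ a : CT n 1, a.incl = X p → ∀ᶠ c in 𝓝 a, c.incl ∈ B)
    (hXB' : ∀ p ∈ U, X p ∈ B) (hX : ∀ p ∈ U, X p = b p + T (opF f (X p))) :
    CT.JointCk m U X := by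
  have hTB : ∀ x ∈ B, ∀ y ∈ B, ‖T (opF f x - opF f y)‖ ≤ 1 / 2 * ‖x - y‖ := fun x hx y hy =>
    calc _ ≤ 1 / (2 * K) * (K * ‖x - y‖) := (hTK _).trans (by gcongr; exact hB x hx y hy)
      _ = 1 / 2 * ‖x - y‖ := by field_simp
  have h0 : CT.JointCk 0 U X := by
    refine CT.JointCk.of_continuousOn fun p hp => ContinuousAt.continuousWithinAt ?_
    have hr : Tendsto (fun q => b q - b p) (𝓝 p) (𝓝 0) := by
      have h1 := ((hb 0).continuousAt hU hp).sub_const (b p)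
      simpa [ContinuousAt] using h1
    have := isLittleO_of_contraction (D := fun q => X q - X p) ((isLittleO_one_iff ℝ).2 hr) (by
      filter_upwards [hU.mem_nhds hp] with q hq
      have e : X q - X p = T (opF f (X q) - opF f (X p)) + (b q - b p) := by
        rw [map_sub]
        nth_rewrite 1 [hX q hq, hX p hp]
        abel
      calc ‖X q - X p‖ ≤ _ := by
            nth_rewrite 1 [e]
            exact norm_add_le _ _
        _ ≤ _ := add_le_add (hTB _ (hXB' q hq) _ (hXB' p hp)) le_rfl)
    have h2 := ((isLittleO_one_iff ℝ).1 this).add_const (X p)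
    simpa [ContinuousAt] using h2
  rcases m with _ | m
  · exact h0
  obtain ⟨-, df, hdf, hdfk⟩ := IsEC.succ_iff.1 hf
  have hf1 : IsEC 1 (j := 0) (fun x : CT n 0 => f x) :=
    hf.of_le (Nat.succ_le_succ (Nat.zero_le m))
  -- The bootstrap in time: the fixed point equation expresses `X` by `b` and `T F(X)`, both of
  -- which have one more time derivative.
  have hlift : ∀ k ≤ m + 1, CT.JointCk k U X →
      ∃ Xl : W → CT n 1, CT.JointCk k U Xl ∧ ∀ q ∈ U, (Xl q).incl = X q := by
    intro k hk hXk
    obtain ⟨v, hv, hv'⟩ := hT.exists_lift hU (jointCk_opF (hf.of_le hk) hU hXk)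
    obtain ⟨bl, hbl, hbl'⟩ := (hb (k + 1)).exists_lift hU
    refine ⟨fun q => bl q + v q, hbl.add hv, fun q hq => ?_⟩
    rw [hX q hq, ← hbl' q hq, ← hv' q]
    rfl
  have hA : ∀ p ∈ U, ∀ a : CT n 1, a.incl = X p → ∀ v,
      ‖T (opDF df hdf.continuous a v)‖ ≤ 1 / 2 * ‖v‖ := fun p hp a ha v =>
    calc _ ≤ 1 / (2 * K) * (K * ‖v‖) := (hTK _).trans (by
            gcongr
            exact norm_opDF_le hf1 hdf hK.le hB (hXB p hp a ha) v)
      _ = 1 / 2 * ‖v‖ := by field_simp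
  have hall : ∀ k, ∃ b' : W → W →L[ℝ] CT n 0, (∀ p ∈ U, HasFDerivAt b (b' p) p) ∧
      CT.JointCk k (U ×ˢ univ) (fun z : W × W => b' z.1 z.2) :=
    fun k => (hb (k + 1)).exists_fderiv hU
  obtain ⟨b', hb', hb'1⟩ := hall 1
  -- The derivatives of `b` found for different orders agree by uniqueness.
  have hb'k : ∀ k, CT.JointCk k (U ×ˢ univ) (fun z : W × W => b' z.1 z.2) := by
    intro k
    obtain ⟨b'', h1, h2⟩ := hall k
    exact h2.congr fun z hz => by rw [(hb' z.1 hz.1).unique (h1 z.1 hz.1)]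
  have hUU : IsOpen (U ×ˢ (univ : Set W)) := hU.prod isOpen_univ
  obtain ⟨bl, -, hbl⟩ := hb'1.exists_lift hUU
  obtain ⟨Xl, hXl, hXl'⟩ := hlift 0 (Nat.zero_le _) h0
  have hS : ∀ p ∈ U, ∃ S : CT n 0 →ₗ[ℝ] CT n 0,
      ∀ c, S c = c + T (opDF df hdf.continuous (Xl p) (S c)) := fun p hp =>
    exists_linear_solution (B := T.toLinearMap.comp (opDF df hdf.continuous (Xl p)))
      (hA p hp _ (hXl' p hp))
  choose! S hS using hS
  let w : W → W →L[ℝ] CT n 0 := fun p =>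
    LinearMap.toContinuousLinearMap ((S p).comp (b' p).toLinearMap)
  have hw : ∀ p ∈ U, ∀ e, w p e = b' p e + T (opDF df hdf.continuous (Xl p) (w p e)) :=
    fun p hp e => hS p hp (b' p e)
  have hder : ∀ p ∈ U, HasFDerivAt X (w p) p := by
    intro p hp
    -- By its equation, `w p` takes values in `C¹`. Hence `F` is differentiable at `X p` along `w
    -- p`, the only directions needed.
    obtain ⟨L, hL⟩ := exists_clm_lift (w p).toLinearMap (fun e => by
      obtain ⟨v, -, hv⟩ := hT.exists_lift (W := ℝ) (k := 0) isOpen_univ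
        (CT.JointCk.of_continuousOn (continuousOn_const
          (c := opDF df hdf.continuous (Xl p) (w p e))))
      refine ⟨bl (p, e) + v 0, ?_⟩
      show (bl (p, e)).incl + (v 0).incl = w p e
      rw [hv, hbl (p, e) ⟨hp, mem_univ e⟩]
      exact (hw p hp e).symm)
    have hF := hasFDerivAt_iff_isLittleO_nhds_zero.1 (hasFDerivAt_opF hf1 hdf (Xl p) L)
    have hbo := hasFDerivAt_iff_isLittleO_nhds_zero.1 (hb' p hp)
    rw [hasFDerivAt_iff_isLittleO_nhds_zero]
    refine isLittleO_of_contraction (hbo.add ((T.isBigO_comp _ _).trans_isLittleO hF)) ?_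
    have hc1 : Tendsto (fun h => p + h) (𝓝 0) (𝓝 p) :=
      (continuous_const.add continuous_id).tendsto' 0 p (add_zero p)
    have hc2 : Tendsto (fun h => Xl p + L h) (𝓝 0) (𝓝 (Xl p)) :=
      (continuous_const.add L.continuous).tendsto' 0 _ (by simp)
    filter_upwards [hc1.eventually (hU.mem_nhds hp), hc2.eventually (hXB p hp _ (hXl' p hp))]
      with h h1 h2
    have e1 : (Xl p + L h).incl = X p + w p h := by
      rw [← hXl' p hp]
      exact congrArg ((Xl p).incl + ·) (hL h)
    have e2 : (Xl p + L 0).incl = X p := by rw [map_zero, add_zero, hXl' p hp]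
    have e3 : X (p + h) - X p - w p h = X (p + h) - (Xl p + L h).incl := by rw [e1]; abel
    -- Compare `X (p + h)` with the linear prediction `X p + w p h`: the difference of `F` at these
    -- two points is contracted, and only the Taylor remainders of `b` and of `F` along `L` remain.
    have e : X (p + h) - X p - w p h = T (opF f (X (p + h)) - opF f (Xl p + L h).incl)
        + ((b (p + h) - b p - b' p h) + T (opF f (Xl p + L (0 + h)).incl
          - opF f (Xl p + L 0).incl - opDF df hdf.continuous (Xl p) (w p h))) := by
      rw [e2, zero_add]
      simp only [map_sub T]
      nth_rewrite 1 [hX _ h1, hX p hp, hw p hp h]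
      abel
    have e4 : opDF df hdf.continuous (Xl p) (w p h) = (LinearMap.toContinuousLinearMap
        ((opDF df hdf.continuous (Xl p)).comp ((CT.inclL n 0).comp L).toLinearMap)) h :=
      congrArg (opDF df hdf.continuous (Xl p)) (hL h).symm
    rw [e4] at e
    calc ‖X (p + h) - X p - w p h‖ ≤ _ := by
          nth_rewrite 1 [e]
          exact norm_add_le _ _
      _ ≤ _ := add_le_add ((hTB _ (hXB' _ h1) _ h2).trans_eq (by rw [e3])) le_rfl
  -- One round: order `k` for `X` gives its lift with order `k`, hence `w` with order `k` from the
  -- linear equation, hence order `k + 1` for `X`.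
  have main : ∀ k ≤ m + 1, CT.JointCk k U X := by
    intro k
    induction k with
    | zero => exact fun _ => h0
    | succ k ih =>
      intro hk
      obtain ⟨Xk, hXk, hXk'⟩ := hlift k (by omega) (ih (by omega))
      refine CT.JointCk.succ_of_lift_of_fderiv hU hXk hXk' hder ?_
      refine jointCk_of_linear_fixedPoint hT (hdf := hdf.continuous)
        (hdfk.of_le (Nat.succ_le_succ_iff.1 hk)) hUU (X := fun a : W × W => Xk a.1)
        (hXk.comp contDiffOn_fst fun a ha => ha.1)
        (fun a ha => hA a.1 ha.1 _ (hXk' a.1 ha.1)) (hb'k k) fun a ha => ?_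
      have e : Xk a.1 = Xl a.1 :=
        CT.incl_injective ((hXk' a.1 ha.1).trans (hXl' a.1 ha.1).symm)
      rw [e]
      exact hw a.1 ha.1 a.2
  exact main (m + 1) le_rfl

end Nonlinear

/-! ### Operators commuting with time shifts -/

namespace CT

variable {n : ℕ}

theorem hasDerivAt_shift (y : CT n 1) (t : ℝ) :
    HasDerivAt (fun t => shift t y.incl) (shift t y.derivC) t := by
  have h1 : CT.JointCk (0 + 1) (univ ×ˢ univ) (fun z : ℝ × ℝ => shift z.1 y.incl) :=
    (CT.JointCk.const_incl (W := ℝ) (Ω := univ) y).shift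
  have h2 : CT.JointCk (0 + 1) univ (fun t : ℝ => shift t y.incl) :=
    h1.comp (φ := fun t : ℝ => (t, (0 : ℝ))) (by fun_prop) (mapsTo_univ_iff.2 fun t => by simp)
  obtain ⟨u', hu', -⟩ := h2.exists_fderiv isOpen_univ
  have h3 := (hu' t (mem_univ t)).hasDerivAt
  have e : u' t 1 = shift t y.derivC := by
    ext1 s
    have h4 := (evalL n 0 s).hasFDerivAt.comp_hasDerivAt t h3
    have h5 : HasDerivAt (fun t => y (t + s)) (y.derivC (t + s)) t :=
      (y.hasDerivAt (t + s)).comp_add_const t s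
    exact h4.unique h5
  rw [← e]
  exact h3

/-- By shift invariance `S y` at time `t` is `S (Δ_t y)` at time 0, and `t ↦ Δ_t y` is
differentiable in `C⁰` for `y` in `C¹`. -/
theorem hasDerivAt_of_commute_shift {S : CT n 0 →L[ℝ] CT n 0}
    (hS : ∀ t x, S (shift t x) = shift t (S x)) (y : CT n 1) (t : ℝ) :
    HasDerivAt (fun t => S y.incl t) (S y.derivC t) t := by
  have h1 := ((evalL n 0 0).comp S).hasFDerivAt.comp_hasDerivAt t (y.hasDerivAt_shift t)
  have h2 : ∀ x : CT n 0, ∀ t, (evalL n 0 0).comp S (shift t x) = S x t := fun x t => by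
    show S (shift t x) 0 = _
    rw [hS, shift_apply, add_zero]
  rw [h2] at h1
  exact h1.congr_of_eventuallyEq (Eventually.of_forall fun t => (h2 _ t).symm)

theorem integral_period (x : CT n 0) (t : ℝ) :
    ∫ s in t..t + 2 * Real.pi, x s = ∫ s in (-Real.pi)..Real.pi, x s := by
  rw [x.periodic.intervalIntegral_add_eq t (-Real.pi)]
  congr 1
  ring

theorem average_shift (t : ℝ) (x : CT n 0) : average (shift t x) = average x := by
  have h : ∫ s in (-Real.pi)..Real.pi, shift t x s = ∫ s in (-Real.pi)..Real.pi, x s := by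
    simp only [shift_apply]
    rw [intervalIntegral.integral_comp_add_left (fun s => x s), ← integral_period x (t + -Real.pi)]
    congr 1
    ring
  rw [average, average, h]

/-- Constant functions. -/
def const (c : E n) : CT n 0 := mk (fun _ => c) contDiff_const fun _ => rfl

@[simp] theorem const_apply (c : E n) (t : ℝ) : const c t = c := rfl

end CT

/-! ### The operator `L` -/

section OpL

variable {n : ℕ}

theorem average_add (x y : CT n 0) : average (x + y) = average x + average y := by
  simp only [average, CT.add_apply]
  rw [intervalIntegral.integral_add (x.continuous.intervalIntegrable _ _)
    (y.continuous.intervalIntegrable _ _), smul_add]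

theorem average_smul (c : ℝ) (x : CT n 0) : average (c • x) = c • average x := by
  simp only [average, CT.smul_apply]
  rw [intervalIntegral.integral_smul, smul_comm]

theorem opL_add (x y : CT n 0) : opL (x + y) = opL x + opL y := by
  ext1 t
  have hx := x.continuous
  have hy := y.continuous
  rw [CT.add_apply, opL_apply, opL_apply, opL_apply, ← intervalIntegral.integral_add
    (Continuous.intervalIntegrable (by fun_prop) _ _)
    (Continuous.intervalIntegrable (by fun_prop) _ _)]
  refine intervalIntegral.integral_congr fun s _ => ?_
  simp only [CT.add_apply, average_add]
  abel

theorem opL_smul (c : ℝ) (x : CT n 0) : opL (c • x) = c • opL x := by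
  ext1 t
  rw [CT.smul_apply, opL_apply, opL_apply, ← intervalIntegral.integral_smul]
  refine intervalIntegral.integral_congr fun s _ => ?_
  simp only [CT.smul_apply, average_smul, smul_sub]

theorem hasDerivAt_opL (x : CT n 0) (t : ℝ) :
    HasDerivAt (fun t => opL x t) ((x - CT.const (average x)) t) t := by
  have hx := x.continuous
  exact ((by fun_prop : Continuous fun s => x s - average x).integral_hasStrictDerivAt
    0 t).hasDerivAt

theorem opL_zero_time (x : CT n 0) : opL x 0 = 0 := by
  rw [opL_apply, intervalIntegral.integral_same]

theorem exists_lift_opL (x : CT n 0) :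
    ∃ y : CT n 1, y.incl = opL x ∧ y.derivC = x - CT.const (average x) := by
  have hd : deriv (fun t => opL x t) = fun t => (x - CT.const (average x)) t :=
    funext fun t => (hasDerivAt_opL x t).deriv
  refine ⟨CT.mk (fun t => opL x t) ?_ (opL x).periodic, rfl, ?_⟩
  · rw [Nat.cast_one, contDiff_one_iff_deriv, hd]
    exact ⟨fun t => (hasDerivAt_opL x t).differentiableAt, (x - CT.const (average x)).continuous⟩
  · ext1 t
    rw [CT.derivC_apply, iteratedDeriv_one]
    exact congrFun hd t

/-- `L` normalizes its value at time 0, so it commutes with shifts only up to a constant; `Q_N`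
later removes that constant. -/
theorem opL_shift (t : ℝ) (x : CT n 0) :
    opL (CT.shift t x) = CT.shift t (opL x) - CT.const (opL x t) := by
  ext1 s
  have hx := x.continuous
  have hc : Continuous (fun s => x s - average x) := by fun_prop
  rw [CT.sub_apply, CT.shift_apply, CT.const_apply, opL_apply, opL_apply, opL_apply,
    CT.average_shift, intervalIntegral.integral_interval_sub_left (hc.intervalIntegrable _ _)
    (hc.intervalIntegrable _ _)]
  simp only [CT.shift_apply]
  rw [intervalIntegral.integral_comp_add_left (fun s => x s - average x), add_zero]

theorem opL_derivC (y : CT n 1) : opL y.derivC = y.incl - CT.const (y 0) := by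
  have h0 : average y.derivC = 0 := by
    rw [average, CT.integral_derivC]
    have h := y.periodic (-Real.pi)
    have e : -Real.pi + 2 * Real.pi = Real.pi := by ring
    simp only [e] at h
    rw [h, sub_self, smul_zero]
  ext1 t
  rw [opL_apply, h0]
  simp only [sub_zero]
  rw [CT.integral_derivC]
  rfl

end OpL

/-! ### Fourier projections -/

section Fourier

variable {n : ℕ}

theorem continuous_mode (k : ℤ) : Continuous (mode k) := by
  unfold mode
  split_ifs <;> fun_prop

theorem abs_mode_le (k : ℤ) (t : ℝ) : |mode k t| ≤ 1 := by
  unfold mode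
  split_ifs
  · simp
  · exact Real.abs_cos_le_one _
  · exact Real.abs_sin_le_one _

/-- Integration against a mode, as a continuous linear map. -/
def modeIntegralL (n : ℕ) (k : ℤ) : CT n 0 →L[ℝ] E n :=
  LinearMap.mkContinuous {
    toFun := fun x => ∫ s in (-Real.pi)..Real.pi, mode k s • x s
    map_add' := fun x y => by
      have hx := x.continuous
      have hy := y.continuous
      have hm := continuous_mode k
      simp only [CT.add_apply, smul_add]
      exact intervalIntegral.integral_add (Continuous.intervalIntegrable (by fun_prop) _ _)
        (Continuous.intervalIntegrable (by fun_prop) _ _)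
    map_smul' := fun c x => by
      simp only [CT.smul_apply, smul_comm _ c, RingHom.id_apply]
      exact intervalIntegral.integral_smul c _ } (2 * Real.pi) fun x => by
    have h := intervalIntegral.norm_integral_le_of_norm_le_const (a := -Real.pi) (b := Real.pi)
      (C := ‖x‖) (f := fun s => mode k s • x s) (fun s _ => by
        rw [norm_smul, Real.norm_eq_abs]
        exact (mul_le_mul (abs_mode_le k s) (x.norm_apply_le s) (norm_nonneg _)
          zero_le_one).trans_eq (one_mul _))
    have e : |Real.pi - -Real.pi| = 2 * Real.pi := by
      rw [abs_of_pos (by linarith [Real.pi_pos])]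
      ring
    rw [e, mul_comm] at h
    exact h

/-- The linear map `E_N`. -/
def opEL (n N : ℕ) : Coeff n N →L[ℝ] CT n 0 :=
  LinearMap.toContinuousLinearMap {
    toFun := opE N
    map_add' := fun p q => by
      ext1 t
      simp only [CT.add_apply, opE_apply, Pi.add_apply, smul_add, Finset.sum_add_distrib]
    map_smul' := fun c p => by
      ext1 t
      simp only [CT.smul_apply, opE_apply, Pi.smul_apply, smul_comm _ c, Finset.smul_sum,
        RingHom.id_apply] }

/-- The projection `P_N` as a continuous linear map. -/
def opPL (n N : ℕ) : CT n 0 →L[ℝ] CT n 0 :=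
  (opEL n N).comp (ContinuousLinearMap.pi fun k =>
    (if (k : ℤ) = 0 then 1 / (2 * Real.pi) else 1 / Real.pi) • modeIntegralL n k)

/-- The projection `Q_N` as a continuous linear map. -/
def opQL (n N : ℕ) : CT n 0 →L[ℝ] CT n 0 := ContinuousLinearMap.id ℝ _ - opPL n N

theorem opQL_apply (N : ℕ) (x : CT n 0) : opQL n N x = opQ N x := rfl

/-- The Dirichlet kernel `1/2 + ∑_{k=1}^N cos(ks)`. -/
def dirichletKernel (N : ℕ) (s : ℝ) : ℝ :=
  1 / 2 + ∑ k ∈ Finset.range N, Real.cos ((k + 1 : ℕ) * s)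

theorem dirichletKernel_succ (N : ℕ) (s : ℝ) :
    dirichletKernel (N + 1) s = dirichletKernel N s + Real.cos ((N + 1 : ℕ) * s) := by
  rw [dirichletKernel, Finset.sum_range_succ, ← add_assoc, dirichletKernel]

theorem continuous_dirichletKernel (N : ℕ) : Continuous (dirichletKernel N) := by
  unfold dirichletKernel
  fun_prop

/-- The subtraction formula for the cosine combines each pair of modes `±k` into the term `cos(k(t -
s))` of the Dirichlet kernel. -/
theorem opP_apply_eq_integral (N : ℕ) (x : CT n 0) (t : ℝ) :
    opP N x t = (1 / Real.pi) • ∫ s in (-Real.pi)..Real.pi, dirichletKernel N (t - s) • x s := by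
  have hx := x.continuous
  let g : ℤ → E n := fun k => mode k t • ((if k = 0 then 1 / (2 * Real.pi) else 1 / Real.pi) •
    ∫ s in (-Real.pi)..Real.pi, mode k s • x s)
  have h1 : opP N x t = ∑ k ∈ Finset.Icc (-(N : ℤ)) N, g k :=
    Finset.sum_coe_sort (Finset.Icc (-(N : ℤ)) N) g
  rw [h1]
  clear h1
  induction N with
  | zero =>
    simp only [Nat.cast_zero, neg_zero, Finset.Icc_self, Finset.sum_singleton, g, mode,
      dirichletKernel, Finset.range_zero, Finset.sum_empty, add_zero, if_true, one_smul]
    rw [intervalIntegral.integral_smul, smul_smul]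
    congr 1
    ring
  | succ N ih =>
    have hI : Finset.Icc (-((N + 1 : ℕ) : ℤ)) ((N + 1 : ℕ) : ℤ) = insert ((N + 1 : ℕ) : ℤ)
        (insert (-((N + 1 : ℕ) : ℤ)) (Finset.Icc (-(N : ℤ)) N)) := by
      ext k
      simp only [Finset.mem_Icc, Finset.mem_insert]
      push_cast
      omega
    have hn1 : -((N + 1 : ℕ) : ℤ) ∉ Finset.Icc (-(N : ℤ)) N := by
      simp only [Finset.mem_Icc]
      push_cast
      omega
    have hn2 : ((N + 1 : ℕ) : ℤ) ∉ insert (-((N + 1 : ℕ) : ℤ)) (Finset.Icc (-(N : ℤ)) N) := by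
      simp only [Finset.mem_Icc, Finset.mem_insert]
      push_cast
      omega
    rw [hI, Finset.sum_insert hn2, Finset.sum_insert hn1, ih]
    have m1 : ∀ s, mode ((N + 1 : ℕ) : ℤ) s = Real.cos ((N + 1 : ℕ) * s) := fun s => by
      rw [mode, if_neg (by positivity), if_pos (by positivity)]
      norm_cast
    have m2 : ∀ s, mode (-((N + 1 : ℕ) : ℤ)) s = Real.sin ((N + 1 : ℕ) * s) := fun s => by
      rw [mode, if_neg (by simp; omega), if_neg (by simp)]
      push_cast
      rw [neg_neg]
    have hker : ∀ s, dirichletKernel (N + 1) (t - s) • x s = dirichletKernel N (t - s) • x s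
        + (Real.cos ((N + 1 : ℕ) * t) • (Real.cos ((N + 1 : ℕ) * s) • x s)
          + Real.sin ((N + 1 : ℕ) * t) • (Real.sin ((N + 1 : ℕ) * s) • x s)) := fun s => by
      rw [dirichletKernel_succ, mul_sub, Real.cos_sub, smul_smul, smul_smul, ← add_smul, ← add_smul]
    have hD := continuous_dirichletKernel N
    simp only [hker]
    rw [intervalIntegral.integral_add (Continuous.intervalIntegrable (by fun_prop) _ _)
      (Continuous.intervalIntegrable (by fun_prop) _ _),
      intervalIntegral.integral_add (Continuous.intervalIntegrable (by fun_prop) _ _)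
      (Continuous.intervalIntegrable (by fun_prop) _ _), intervalIntegral.integral_smul,
      intervalIntegral.integral_smul]
    simp only [g, m1, m2]
    rw [if_neg (by positivity), if_neg (by simp; omega), smul_comm _ (1 / Real.pi),
      smul_comm _ (1 / Real.pi), smul_add, smul_add]
    abel

theorem dirichletKernel_periodic (N : ℕ) : Function.Periodic (dirichletKernel N) (2 * Real.pi) := by
  intro s
  unfold dirichletKernel
  congr 1
  refine Finset.sum_congr rfl fun k _ => ?_
  rw [mul_add]
  exact Real.cos_add_nat_mul_two_pi _ _

theorem dirichletKernel_neg (N : ℕ) (s : ℝ) : dirichletKernel N (-s) = dirichletKernel N s := by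
  simp [dirichletKernel]

theorem opP_shift (N : ℕ) (t : ℝ) (x : CT n 0) :
    opP N (CT.shift t x) = CT.shift t (opP N x) := by
  ext1 s
  rw [CT.shift_apply, opP_apply_eq_integral, opP_apply_eq_integral]
  congr 1
  have hp : Function.Periodic (fun u => dirichletKernel N (t + s - u) • x u) (2 * Real.pi) := by
    intro u
    have h1 := (dirichletKernel_periodic N).sub_eq (t + s - u)
    have h2 := x.periodic u
    simp only [h2]
    rw [← sub_sub, h1]
  have h3 := intervalIntegral.integral_comp_add_left (a := -Real.pi) (b := Real.pi)
    (fun u => dirichletKernel N (t + s - u) • x u) t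
  have h4 := hp.intervalIntegral_add_eq (t + -Real.pi) (-Real.pi)
  have e1 : t + -Real.pi + 2 * Real.pi = t + Real.pi := by ring
  have e2 : -Real.pi + 2 * Real.pi = Real.pi := by ring
  rw [e1, e2, ← h3] at h4
  rw [← h4]
  simp only [add_sub_add_left_eq_sub, CT.shift_apply]

/-- The primitive `(s - π)/2 + ∑_{k=1}^N sin(ks)/k` of the Dirichlet kernel. -/
def dirichletPrimitive (N : ℕ) (s : ℝ) : ℝ :=
  (s - Real.pi) / 2 + ∑ k ∈ Finset.range N, Real.sin ((k + 1 : ℕ) * s) / (k + 1 : ℕ)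

theorem dirichletPrimitive_succ (N : ℕ) (s : ℝ) : dirichletPrimitive (N + 1) s
    = dirichletPrimitive N s + Real.sin ((N + 1 : ℕ) * s) / (N + 1 : ℕ) := by
  rw [dirichletPrimitive, Finset.sum_range_succ, ← add_assoc, dirichletPrimitive]

theorem hasDerivAt_dirichletPrimitive (N : ℕ) (s : ℝ) :
    HasDerivAt (dirichletPrimitive N) (dirichletKernel N s) s := by
  refine HasDerivAt.add ?_ (HasDerivAt.fun_sum fun k _ => ?_)
  · exact ((hasDerivAt_id s).sub_const Real.pi).div_const 2
  · have h := ((hasDerivAt_id s).const_mul ((k + 1 : ℕ) : ℝ)).sin.div_const ((k + 1 : ℕ) : ℝ)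
    have hk : ((k + 1 : ℕ) : ℝ) ≠ 0 := by positivity
    rw [mul_one, mul_div_assoc, div_self hk, mul_one] at h
    exact h

theorem continuous_dirichletPrimitive (N : ℕ) : Continuous (dirichletPrimitive N) := by
  unfold dirichletPrimitive
  fun_prop

theorem dirichletPrimitive_zero (N : ℕ) : dirichletPrimitive N 0 = -(Real.pi / 2) := by
  simp [dirichletPrimitive]
  ring

theorem dirichletPrimitive_two_pi (N : ℕ) : dirichletPrimitive N (2 * Real.pi) = Real.pi / 2 := by
  have h : ∀ k : ℕ, Real.sin ((k : ℝ) * (2 * Real.pi)) = 0 := fun k => by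
    have := Real.sin_nat_mul_pi (k * 2)
    push_cast at this
    rwa [mul_assoc] at this
  simp only [dirichletPrimitive, h]
  simp
  ring

theorem integral_dirichletKernel (N : ℕ) :
    ∫ s in (0 : ℝ)..2 * Real.pi, dirichletKernel N s = Real.pi := by
  rw [intervalIntegral.integral_eq_sub_of_hasDerivAt
    (fun s _ => hasDerivAt_dirichletPrimitive N s)
    ((continuous_dirichletKernel N).intervalIntegrable _ _), dirichletPrimitive_zero,
    dirichletPrimitive_two_pi]
  ring

theorem opP_apply_zero (N : ℕ) (x : CT n 0) : opP N x 0
    = (1 / Real.pi) • ∫ s in (0 : ℝ)..2 * Real.pi, dirichletKernel N s • x s := by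
  rw [opP_apply_eq_integral]
  simp only [zero_sub, dirichletKernel_neg]
  have hp : Function.Periodic (fun u => dirichletKernel N u • x u) (2 * Real.pi) := fun u => by
    have h2 := x.periodic u
    simp only at h2
    simp only [h2]
    rw [dirichletKernel_periodic N u]
  have h4 := hp.intervalIntegral_add_eq 0 (-Real.pi)
  have e2 : -Real.pi + 2 * Real.pi = Real.pi := by ring
  rw [e2, zero_add] at h4
  rw [h4]

/-- Shift invariance reduces to time 0, where the kernel has integral `π`. -/
theorem opP_const (N : ℕ) (c : E n) : opP N (CT.const c) = CT.const c := by
  ext1 t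
  have h := congrArg (fun x : CT n 0 => x 0) (opP_shift N t (CT.const c))
  have e : CT.shift t (CT.const c) = CT.const c := rfl
  simp only [CT.shift_apply, add_zero, e] at h
  rw [← h, opP_apply_zero]
  simp only [CT.const_apply]
  rw [intervalIntegral.integral_smul_const, integral_dirichletKernel, smul_smul,
    one_div_mul_cancel Real.pi_ne_zero, one_smul]

theorem opQ_const (N : ℕ) (c : E n) : opQ N (CT.const c) = 0 := by
  rw [opQ, opP_const, sub_self]

theorem opQ_shift (N : ℕ) (t : ℝ) (x : CT n 0) :
    opQ N (CT.shift t x) = CT.shift t (opQ N x) := by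
  rw [opQ, opP_shift]
  rfl

theorem opQ_sub (N : ℕ) (x y : CT n 0) : opQ N (x - y) = opQ N x - opQ N y :=
  map_sub (opQL n N) x y

theorem opQ_opL_shift (N : ℕ) (t : ℝ) (x : CT n 0) :
    opQ N (opL (CT.shift t x)) = CT.shift t (opQ N (opL x)) := by
  rw [opL_shift, opQ_sub, opQ_const, sub_zero, opQ_shift]

theorem hasDerivAt_opQ_opL (N : ℕ) (x : CT n 0) (t : ℝ) :
    HasDerivAt (fun t => opQ N (opL x) t) (opQ N x t) t := by
  obtain ⟨y, hy, hy'⟩ := exists_lift_opL x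
  have h := CT.hasDerivAt_of_commute_shift (S := opQL n N) (fun t x => opQ_shift N t x) y t
  rw [hy, hy', opQL_apply, opQL_apply, opQ_sub, opQ_const, sub_zero] at h
  exact h

end Fourier

/-! ### Smallness of `Q_N L` -/

theorem integral_cos_nat_mul {m : ℕ} (hm : m ≠ 0) :
    ∫ s in (0 : ℝ)..2 * Real.pi, Real.cos (m * s) = 0 := by
  have hm' : (m : ℝ) ≠ 0 := by exact_mod_cast hm
  rw [intervalIntegral.integral_comp_mul_left (fun s => Real.cos s) hm', integral_cos]
  have := Real.sin_nat_mul_pi (m * 2)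
  push_cast at this
  rw [mul_assoc] at this
  simp [this]

theorem integral_cos_mul_cos {k m : ℕ} (h : k < m) :
    ∫ s in (0 : ℝ)..2 * Real.pi, Real.cos (k * s) * Real.cos (m * s) = 0 := by
  have e : ∀ s : ℝ, Real.cos (k * s) * Real.cos (m * s)
      = 1 / 2 * Real.cos ((m - k : ℕ) * s) + 1 / 2 * Real.cos ((m + k : ℕ) * s) := fun s => by
    rw [Nat.cast_sub h.le, Nat.cast_add, sub_mul, add_mul, Real.cos_sub, Real.cos_add]
    ring
  simp only [e]
  rw [intervalIntegral.integral_add (Continuous.intervalIntegrable (by fun_prop) _ _)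
    (Continuous.intervalIntegrable (by fun_prop) _ _), intervalIntegral.integral_const_mul,
    intervalIntegral.integral_const_mul, integral_cos_nat_mul (by omega),
    integral_cos_nat_mul (by omega)]
  simp

theorem integral_dirichletKernel_mul_cos {N m : ℕ} (h : N < m) :
    ∫ s in (0 : ℝ)..2 * Real.pi, dirichletKernel N s * Real.cos (m * s) = 0 := by
  induction N with
  | zero =>
    simp only [dirichletKernel, Finset.range_zero, Finset.sum_empty, add_zero]
    rw [intervalIntegral.integral_const_mul, integral_cos_nat_mul (by omega), mul_zero]
  | succ N ih =>
    have hD := continuous_dirichletKernel N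
    simp only [dirichletKernel_succ, add_mul]
    rw [intervalIntegral.integral_add (Continuous.intervalIntegrable (by fun_prop) _ _)
      (Continuous.intervalIntegrable (by fun_prop) _ _), ih (by omega), integral_cos_mul_cos h,
      add_zero]

theorem integral_dirichletPrimitive_mul_sin (N : ℕ) :
    ∫ s in (0 : ℝ)..2 * Real.pi, dirichletPrimitive N s * Real.sin ((N + 1 : ℕ) * s)
      = -(Real.pi / (N + 1 : ℕ)) := by
  have hm : ((N + 1 : ℕ) : ℝ) ≠ 0 := by positivity
  have hv : ∀ s, HasDerivAt (fun s : ℝ => -(Real.cos ((N + 1 : ℕ) * s) / (N + 1 : ℕ)))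
      (Real.sin ((N + 1 : ℕ) * s)) s := fun s => by
    have h := (((hasDerivAt_id s).const_mul ((N + 1 : ℕ) : ℝ)).cos.div_const ((N + 1 : ℕ) : ℝ)).neg
    rw [mul_one, mul_div_assoc, div_self hm, mul_one, neg_neg] at h
    exact h
  have hD := continuous_dirichletKernel N
  rw [intervalIntegral.integral_mul_deriv_eq_deriv_mul
    (fun s _ => hasDerivAt_dirichletPrimitive N s) (fun s _ => hv s)
    (hD.intervalIntegrable _ _) (Continuous.intervalIntegrable (by fun_prop) _ _),
    dirichletPrimitive_zero, dirichletPrimitive_two_pi]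
  have e1 : ∀ s : ℝ, dirichletKernel N s * -(Real.cos ((N + 1 : ℕ) * s) / (N + 1 : ℕ))
      = (-(1 / ((N + 1 : ℕ) : ℝ))) * (dirichletKernel N s * Real.cos ((N + 1 : ℕ) * s)) :=
    fun s => by ring
  have e2 : Real.cos (((N + 1 : ℕ) : ℝ) * (2 * Real.pi)) = 1 := Real.cos_nat_mul_two_pi _
  simp only [e1]
  rw [intervalIntegral.integral_const_mul, integral_dirichletKernel_mul_cos (Nat.lt_succ_self N),
    e2, mul_zero, mul_zero, Real.cos_zero]
  ring

theorem integral_sin_sq_nat_mul {m : ℕ} (hm : m ≠ 0) :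
    ∫ s in (0 : ℝ)..2 * Real.pi, Real.sin (m * s) ^ 2 = Real.pi := by
  have e : ∀ s : ℝ, Real.sin (m * s) ^ 2 = 1 / 2 - 1 / 2 * Real.cos ((2 * m : ℕ) * s) :=
    fun s => by
      rw [Nat.cast_mul, Nat.cast_two, mul_assoc, Real.cos_two_mul, Real.cos_sq']
      ring
  simp only [e]
  rw [intervalIntegral.integral_sub (Continuous.intervalIntegrable (by fun_prop) _ _)
    (Continuous.intervalIntegrable (by fun_prop) _ _), intervalIntegral.integral_const_mul,
    integral_cos_nat_mul (by omega), intervalIntegral.integral_const]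
  simp
  ring

/-- Parseval by hand: adding the mode `N + 1` contributes a cross term `-2π/(N+1)²` and a square
`π/(N+1)²`. -/
theorem integral_dirichletPrimitive_sq (N : ℕ) :
    ∫ s in (0 : ℝ)..2 * Real.pi, dirichletPrimitive N s ^ 2
      = Real.pi ^ 3 / 6 - Real.pi * ∑ k ∈ Finset.range N, 1 / ((k + 1 : ℕ) : ℝ) ^ 2 := by
  induction N with
  | zero =>
    have hd : ∀ s : ℝ, HasDerivAt (fun s => (s - Real.pi) ^ 3 / 12) (dirichletPrimitive 0 s ^ 2) s :=
      fun s => by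
        have h := (((hasDerivAt_id s).sub_const Real.pi).pow 3).div_const 12
        refine h.congr_deriv ?_
        simp only [dirichletPrimitive, Finset.range_zero, Finset.sum_empty, id]
        push_cast
        ring
    rw [intervalIntegral.integral_eq_sub_of_hasDerivAt (fun s _ => hd s)
      (((continuous_dirichletPrimitive 0).pow 2).intervalIntegrable _ _)]
    simp
    ring
  | succ N ih =>
    have hP := continuous_dirichletPrimitive N
    have hm : ((N + 1 : ℕ) : ℝ) ≠ 0 := by positivity
    have e : ∀ s, dirichletPrimitive (N + 1) s ^ 2 = dirichletPrimitive N s ^ 2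
        + (2 / ((N + 1 : ℕ) : ℝ)) * (dirichletPrimitive N s * Real.sin ((N + 1 : ℕ) * s))
        + (1 / ((N + 1 : ℕ) : ℝ) ^ 2) * Real.sin ((N + 1 : ℕ) * s) ^ 2 := fun s => by
      rw [dirichletPrimitive_succ]
      ring
    simp only [e]
    rw [intervalIntegral.integral_add (Continuous.intervalIntegrable (by fun_prop) _ _)
      (Continuous.intervalIntegrable (by fun_prop) _ _),
      intervalIntegral.integral_add (Continuous.intervalIntegrable (by fun_prop) _ _)
      (Continuous.intervalIntegrable (by fun_prop) _ _), intervalIntegral.integral_const_mul,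
      intervalIntegral.integral_const_mul, ih, integral_dirichletPrimitive_mul_sin,
      integral_sin_sq_nat_mul N.succ_ne_zero, Finset.sum_range_succ]
    field_simp
    ring

theorem integral_dirichletPrimitive (N : ℕ) :
    ∫ s in (0 : ℝ)..2 * Real.pi, dirichletPrimitive N s = 0 := by
  have h := intervalIntegral.integral_comp_sub_left (a := 0) (b := 2 * Real.pi)
    (dirichletPrimitive N) (2 * Real.pi)
  have e : ∀ s, dirichletPrimitive N (2 * Real.pi - s) = -dirichletPrimitive N s := fun s => by
    have h1 : ∀ k : ℕ, Real.sin ((k : ℝ) * (2 * Real.pi - s)) = -Real.sin (k * s) := fun k => by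
      rw [mul_sub, Real.sin_nat_mul_two_pi_sub]
    simp only [dirichletPrimitive, h1, neg_div, Finset.sum_neg_distrib]
    ring
  simp only [e, intervalIntegral.integral_neg, sub_self, sub_zero] at h
  linarith

/-- The partial sums exhaust `π²/6`, so the formula leaves only the tail of `ζ(2)`. -/
theorem tendsto_integral_dirichletPrimitive_sq :
    Tendsto (fun N => ∫ s in (0 : ℝ)..2 * Real.pi, dirichletPrimitive N s ^ 2) atTop (𝓝 0) := by
  simp only [integral_dirichletPrimitive_sq]
  have h1 : HasSum (fun k : ℕ => 1 / ((k + 1 : ℕ) : ℝ) ^ 2) (Real.pi ^ 2 / 6) := by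
    have := (hasSum_nat_add_iff' 1).2 hasSum_zeta_two
    simpa using this
  have h2 := (h1.tendsto_sum_nat.const_mul Real.pi).const_sub (Real.pi ^ 3 / 6)
  have e : Real.pi ^ 3 / 6 - Real.pi * (Real.pi ^ 2 / 6) = 0 := by ring
  rwa [e] at h2

/-! ### `Q_N L` as convolution with the Dirichlet primitive, and its norm. -/

section

variable {n : ℕ}

/-- Integration by parts against the Dirichlet kernel. The boundary terms vanish since `L x` is 0 at
both ends of the period, and the average drops out since the primitive has mean zero. -/
theorem opQ_opL_apply_zero (N : ℕ) (x : CT n 0) : opQ N (opL x) 0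
    = (1 / Real.pi) • ∫ s in (0 : ℝ)..2 * Real.pi, dirichletPrimitive N s • x s := by
  have hx := x.continuous
  have hP := continuous_dirichletPrimitive N
  have hD := continuous_dirichletKernel N
  have hL := (opL x).continuous
  have h2π : opL x (2 * Real.pi) = 0 := by
    have := (opL x).periodic 0
    simp only [zero_add] at this
    rw [this, opL_zero_time]
  have h1 := intervalIntegral.integral_eq_sub_of_hasDerivAt (a := 0) (b := 2 * Real.pi)
    (fun s _ => (hasDerivAt_dirichletPrimitive N s).smul (hasDerivAt_opL x s))
    (Continuous.intervalIntegrable (by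
      have := (x - CT.const (average x)).continuous
      fun_prop) _ _)
  rw [intervalIntegral.integral_add (Continuous.intervalIntegrable (by
      have := (x - CT.const (average x)).continuous
      fun_prop) _ _) (Continuous.intervalIntegrable (by fun_prop) _ _)] at h1
  simp only [CT.sub_apply, CT.const_apply, smul_sub, Pi.smul_apply', h2π, opL_zero_time,
    smul_zero, sub_self] at h1
  rw [intervalIntegral.integral_sub (Continuous.intervalIntegrable (by fun_prop) _ _)
    (Continuous.intervalIntegrable (by fun_prop) _ _), intervalIntegral.integral_smul_const,
    integral_dirichletPrimitive, zero_smul, sub_zero] at h1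
  have h3 : opQ N (opL x) 0 = opL x 0 - opP N (opL x) 0 := rfl
  rw [h3, opL_zero_time, opP_apply_zero, zero_sub, ← smul_neg, eq_neg_of_add_eq_zero_left h1]

theorem eventually_norm_opQ_opL_le (n : ℕ) {η : ℝ} (hη : 0 < η) :
    ∀ᶠ N in atTop, ∀ x : CT n 0, ‖opQ N (opL x)‖ ≤ η * ‖x‖ := by
  have hpi := Real.pi_pos
  filter_upwards [tendsto_integral_dirichletPrimitive_sq.eventually
    (gt_mem_nhds (by positivity : 0 < η * η * Real.pi / 2))] with N hN x
  have hP := continuous_dirichletPrimitive N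
  rw [CT.norm_le_iff_zero _ (by positivity)]
  intro t
  have h0 : opQ N (opL x) t = opQ N (opL (CT.shift t x)) 0 := by
    rw [opQ_opL_shift, CT.shift_apply, add_zero]
  rw [h0, opQ_opL_apply_zero, norm_smul, Real.norm_of_nonneg (by positivity)]
  have hx := (CT.shift t x).continuous
  have h1 : ‖∫ s in (0 : ℝ)..2 * Real.pi, dirichletPrimitive N s • CT.shift t x s‖
      ≤ ∫ s in (0 : ℝ)..2 * Real.pi, (η / 4 + dirichletPrimitive N s ^ 2 / η) * ‖x‖ := by
    refine intervalIntegral.norm_integral_le_of_norm_le (by positivity) ?_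
      (Continuous.intervalIntegrable (by fun_prop) _ _)
    refine MeasureTheory.ae_of_all _ fun s _ => ?_
    rw [norm_smul, Real.norm_eq_abs]
    refine mul_le_mul ?_ (x.norm_apply_le _) (norm_nonneg _) (by positivity)
    -- Young's inequality `|φ| ≤ η/4 + φ²/η` passes from `L²` to `L¹` smallness; the threshold
    -- `η²π/2` makes each summand integrate to `ηπ/2`.
    rw [← sub_nonneg]
    have : η / 4 + dirichletPrimitive N s ^ 2 / η - |dirichletPrimitive N s|
        = (η / 2 - |dirichletPrimitive N s|) ^ 2 / η := by
      rw [← sq_abs (dirichletPrimitive N s)]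
      field_simp
      ring
    rw [this]
    positivity
  rw [intervalIntegral.integral_mul_const, intervalIntegral.integral_add
    (Continuous.intervalIntegrable (by fun_prop) _ _)
    (Continuous.intervalIntegrable (by fun_prop) _ _), intervalIntegral.integral_const,
    intervalIntegral.integral_div, smul_eq_mul, sub_zero] at h1
  calc _ ≤ 1 / Real.pi * ((2 * Real.pi * (η / 4) + η * η * Real.pi / 2 / η) * ‖x‖) := by
        refine mul_le_mul_of_nonneg_left (h1.trans ?_) (by positivity)
        gcongr
    _ = η * ‖x‖ := by
      field_simp
      ring

end

/-! ### Local Lipschitz bounds for `F` -/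

section Bounds

variable {n : ℕ}

namespace CT

theorem norm_shift {r : ℕ} (t : ℝ) (x : CT n r) : ‖shift t x‖ = ‖x‖ := by
  refine le_antisymm (norm_shift_le t x) ?_
  have e : shift (-t) (shift t x) = x := by
    ext1 s
    simp
  calc ‖x‖ = ‖shift (-t) (shift t x)‖ := by rw [e]
    _ ≤ _ := norm_shift_le _ _

theorem shift_periodic {r : ℕ} (x : CT n r) :
    Function.Periodic (fun t => shift t x) (2 * Real.pi) := fun t => by
  ext1 s
  have h := x.periodic (t + s)
  simp only [shift_apply]
  rw [add_right_comm]
  exact h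

theorem exists_lipNorm_eq {x : CT n 0} (hx : lipNorm x < ⊤) :
    ∃ c : ℝ, 0 ≤ c ∧ lipNorm x = ENNReal.ofReal c :=
  ⟨(lipNorm x).toReal, ENNReal.toReal_nonneg, (ENNReal.ofReal_toReal hx.ne).symm⟩

end CT

/-- Finitely many of the local bounds on `df` cover the compact set, giving one radius and one
constant. -/
theorem IsExtDeriv.exists_norm_le_of_isCompact {m j : ℕ} {f : D n j 0 → E m}
    {df : D n j 1 → D n j 0 →ₗ[ℝ] E m} (h : IsExtDeriv f df) {S : Set (D n j 1)}
    (hS : IsCompact S) : ∃ η > 0, ∃ C > 0, ∀ c ∈ S, ∀ b ∈ Metric.ball c η, ∀ y,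
      ‖df b y‖ ≤ C * ‖y‖ := by
  refine hS.induction_on (p := fun s => ∃ η > 0, ∃ C > 0, ∀ c ∈ s, ∀ b ∈ Metric.ball c η, ∀ y,
      ‖df b y‖ ≤ C * ‖y‖) ⟨1, one_pos, 1, one_pos, by simp⟩ ?_ ?_ ?_
  · rintro s t hst ⟨η, hη, C, hC, H⟩
    exact ⟨η, hη, C, hC, fun c hc => H c (hst hc)⟩
  · rintro s t ⟨η, hη, C, hC, H⟩ ⟨η', hη', C', hC', H'⟩
    refine ⟨min η η', lt_min hη hη', max C C', lt_max_of_lt_left hC, fun c hc b hb y => ?_⟩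
    rw [Metric.mem_ball, lt_min_iff] at hb
    rcases hc with hc | hc
    · exact (H c hc b hb.1 y).trans (by gcongr; exact le_max_left _ _)
    · exact (H' c hc b hb.2 y).trans (by gcongr; exact le_max_right _ _)
  · intro c _
    obtain ⟨η, hη, C, hC, H⟩ := h.exists_norm_le c
    refine ⟨Metric.ball c (η / 2), nhdsWithin_le_nhds (Metric.ball_mem_nhds c (half_pos hη)),
      η / 2, half_pos hη, C, hC, fun b hb d hd => H d ?_⟩
    rw [Metric.mem_ball] at hb hd ⊢
    linarith [dist_triangle d b c]

/-- The orbit of `x₀` is compact in `C¹`, so `∂¹f` is bounded uniformly near it. The mean value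
inequality is applied to mollified functions, and the limit is taken in `C⁰`. Allowing two different
shifts also yields Lipschitz continuity of `F(x)` in time. -/
theorem exists_local_lipschitz {f : C(CT n 0, E n)} {df : D n 0 1 → D n 0 0 →ₗ[ℝ] E n}
    (hdf : IsExtDeriv (j := 0) (fun x : CT n 0 => f x) df) (x₀ : CT n 1) :
    ∃ ρ > 0, ∃ C > 0, ∃ τ > 0, ∀ x ∈ CT.lipBall x₀.incl ρ, ∀ y ∈ CT.lipBall x₀.incl ρ,
      ∀ s t : ℝ, |s - t| < τ →
        ‖f (CT.shift s x) - f (CT.shift t y)‖ ≤ C * ‖CT.shift s x - CT.shift t y‖ := by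
  have hcomp : IsCompact (range fun t => CT.shift t x₀) :=
    x₀.shift_periodic.compact_of_continuous (by positivity) x₀.continuous_shift_of_order
  obtain ⟨η, hη, C, hC, H⟩ := hdf.exists_norm_le_of_isCompact hcomp
  obtain ⟨τ, hτ, hτ'⟩ := Metric.continuousAt_iff.1
    (x₀.continuous_shift_of_order.continuousAt (x := 0)) (η / 4) (by positivity)
  refine ⟨η / 4, by positivity, C, hC, τ, hτ, fun x hx y hy s t hst => ?_⟩
  have hst' : ‖CT.shift t x₀ - CT.shift s x₀‖ < η / 4 := by
    have h1 := hτ' (x := t - s) (by rwa [dist_zero_right, Real.norm_eq_abs, abs_sub_comm])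
    rw [dist_eq_norm] at h1
    have e : CT.shift t x₀ - CT.shift s x₀
        = CT.shift s (CT.shift (t - s) x₀ - CT.shift 0 x₀) := by
      ext1 u
      simp only [CT.sub_apply, CT.shift_apply, zero_add]
      congr 2
      ring
    rw [e, CT.norm_shift]
    exact h1
  have hx1 : Tendsto (fun h => (CT.mollify h x).incl) (𝓝[>] 0) (𝓝 x) := x.tendsto_mollify_incl
  have hy1 : Tendsto (fun h => (CT.mollify h y).incl) (𝓝[>] 0) (𝓝 y) := y.tendsto_mollify_incl
  have hx2 := ((CT.shiftL n 0 s).continuous.tendsto x).comp hx1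
  have hy2 := ((CT.shiftL n 0 t).continuous.tendsto y).comp hy1
  refine le_of_tendsto_of_tendsto (((f.continuous.tendsto _).comp hx2).sub
    ((f.continuous.tendsto _).comp hy2)).norm ((hx2.sub hy2).norm.const_mul C) ?_
  -- In `C¹`, the Lipschitz distance to `x₀` and the mollification error of `x₀` cost `η/4` each;
  -- the shift mismatch costs another `η/4`, so both points stay inside the `η`-ball.
  have hm : ∀ z ∈ CT.lipBall x₀.incl (η / 4), ∀ᶠ h in 𝓝[>] (0 : ℝ),
      ‖CT.mollify h z - x₀‖ < η / 2 := by
    intro z hz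
    filter_upwards [self_mem_nhdsWithin,
      Metric.tendsto_nhds.1 x₀.tendsto_mollify (η / 4) (by positivity)] with h h0 h1
    have h2 := CT.norm_mollify_le h0 (by positivity) hz
    rw [CT.mollify_sub] at h2
    rw [dist_eq_norm] at h1
    have e : CT.mollify h z - x₀
        = (CT.mollify h z - CT.mollify h x₀.incl) + (CT.mollify h x₀.incl - x₀) := by abel
    rw [e]
    linarith [norm_add_le (CT.mollify h z - CT.mollify h x₀.incl) (CT.mollify h x₀.incl - x₀)]
  filter_upwards [hm x hx, hm y hy] with h h1 h2
  have hbx : CT.shift s (CT.mollify h x) ∈ Metric.ball (CT.shift s x₀) η := by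
    rw [mem_ball_iff_norm]
    have e : CT.shift s (CT.mollify h x) - CT.shift s x₀ = CT.shift s (CT.mollify h x - x₀) := rfl
    rw [e, CT.norm_shift]
    linarith
  have hby : CT.shift t (CT.mollify h y) ∈ Metric.ball (CT.shift s x₀) η := by
    rw [mem_ball_iff_norm]
    have e : CT.shift t (CT.mollify h y) - CT.shift s x₀
        = CT.shift t (CT.mollify h y - x₀) + (CT.shift t x₀ - CT.shift s x₀) := by
      ext1 u
      simp
    rw [e]
    have h3 := norm_add_le (CT.shift t (CT.mollify h y - x₀)) (CT.shift t x₀ - CT.shift s x₀)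
    rw [CT.norm_shift] at h3
    linarith
  have key := hdf.norm_sub_sub_le (a := CT.shift t (CT.mollify h y))
    (b := CT.shift s (CT.mollify h x)) (y := 0)
    (C := C * ‖(CT.shift s (CT.mollify h x) - CT.shift t (CT.mollify h y)).incl‖)
    (fun c hc => by
      rw [sub_zero]
      exact H _ (mem_range_self s) c ((convex_ball (E := CT n 1) _ _).segment_subset hby hbx hc) _)
  rw [sub_zero] at key
  exact key

theorem exists_hasBounds {f : C(CT n 0, E n)} {df : D n 0 1 → D n 0 0 →ₗ[ℝ] E n}
    (hdf : IsExtDeriv (j := 0) (fun x : CT n 0 => f x) df) (x₀ : CT n 1) :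
    ∃ δ R K : ℝ, 0 < δ ∧ 0 < R ∧ 0 < K ∧ HasBounds f x₀ δ R K := by
  obtain ⟨ρ, hρ, C, hC, τ, hτ, H⟩ := exists_local_lipschitz hdf x₀
  have h6 : 6 * (ρ / 6) = ρ := by ring
  have hK : ∀ x ∈ CT.lipBall x₀.incl ρ, ∀ y ∈ CT.lipBall x₀.incl ρ,
      ‖opF f x - opF f y‖ ≤ C * ‖x - y‖ := by
    intro x hx y hy
    rw [CT.norm_le_iff_zero _ (by positivity)]
    intro t
    have h1 := H x hx y hy t t (by simpa using hτ)
    have e : CT.shift t x - CT.shift t y = CT.shift t (x - y) := rfl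
    rwa [e, CT.norm_shift] at h1
  let S : ℝ := ‖opF f x₀.incl‖ + C * ρ
  have hS : 0 ≤ S := by positivity
  -- The summands cover the sup norm, the Lipschitz quotient for `|s - t| < τ` and that for `|s - t|
  -- ≥ τ`; the final 1 ensures positivity.
  let R : ℝ := S + C * (ρ + ‖x₀‖) + 2 * S / τ + 1
  have hR : 0 < R := by positivity
  refine ⟨ρ / 6, R, C, by positivity, hR, hC, ?_⟩
  rw [HasBounds, h6]
  refine ⟨fun x hx => ?_, hK⟩
  have hx0 : x₀.incl ∈ CT.lipBall x₀.incl ρ := by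
    show CT.lipNorm (x₀.incl - x₀.incl) ≤ _
    rw [sub_self, CT.lipNorm_le_iff _ hρ.le]
    simp only [norm_zero, CT.zero_apply, sub_self]
    exact ⟨hρ.le, fun s t => by positivity⟩
  have hsup : ‖opF f x‖ ≤ S := by
    have h1 := hK x hx _ hx0
    have h2 := ((CT.lipNorm_le_iff _ hρ.le).1 hx).1
    calc ‖opF f x‖ = ‖opF f x₀.incl + (opF f x - opF f x₀.incl)‖ := by rw [add_sub_cancel]
      _ ≤ _ := norm_add_le _ _
      _ ≤ S := add_le_add le_rfl (h1.trans (by gcongr))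
  have hxl : CT.lipNorm x ≤ ENNReal.ofReal (ρ + ‖x₀‖) := by
    have := CT.lipNorm_add_le hρ.le (norm_nonneg _) hx x₀.lipNorm_incl_le
    rwa [sub_add_cancel] at this
  rw [CT.lipNorm_le_iff _ (by positivity)] at hxl
  rw [CT.lipNorm_le_iff _ hR.le]
  have hp1 : 0 ≤ C * (ρ + ‖x₀‖) := by positivity
  have hp2 : 0 ≤ 2 * S / τ := by positivity
  refine ⟨by simp only [R]; linarith, fun s t => ?_⟩
  rcases lt_or_ge |s - t| τ with hst | hst
  · have h1 := H x hx x hx s t hst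
    have h2 : ‖CT.shift s x - CT.shift t x‖ ≤ (ρ + ‖x₀‖) * |s - t| := by
      rw [CT.norm_le_iff_zero _ (by positivity)]
      intro u
      have := hxl.2 (s + u) (t + u)
      rwa [add_sub_add_right_eq_sub] at this
    calc ‖opF f x s - opF f x t‖ ≤ C * ((ρ + ‖x₀‖) * |s - t|) := h1.trans (by gcongr)
      _ = C * (ρ + ‖x₀‖) * |s - t| := by ring
      _ ≤ R * |s - t| := by
        gcongr
        simp only [R]
        linarith
  · calc ‖opF f x s - opF f x t‖ ≤ ‖opF f x s‖ + ‖opF f x t‖ := norm_sub_le _ _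
      _ ≤ S + S := add_le_add (((opF f x).norm_apply_le s).trans hsup)
        (((opF f x).norm_apply_le t).trans hsup)
      _ = 2 * S / τ * τ := by field_simp; ring
      _ ≤ 2 * S / τ * |s - t| := by gcongr
      _ ≤ R * |s - t| := by
        gcongr
        simp only [R]
        linarith

/-! ### Large Fourier truncations -/

/-- On a mollified function `Q_N x = Q_N L x'`, since they differ by `Q_N` of a constant; the
derivative is bounded by the Lipschitz norm, and the estimate survives the limit. -/
theorem norm_opQ_le {N : ℕ} {η : ℝ} (hη : 0 ≤ η)
    (hN : ∀ x : CT n 0, ‖opQ N (opL x)‖ ≤ η * ‖x‖) {x : CT n 0} {c : ℝ} (hc : 0 ≤ c)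
    (hx : CT.lipNorm x ≤ ENNReal.ofReal c) : ‖opQ N x‖ ≤ η * c := by
  refine le_of_tendsto (((opQL n N).continuous.tendsto x).comp x.tendsto_mollify_incl).norm ?_
  filter_upwards [self_mem_nhdsWithin] with h hh
  have h1 := hN (CT.mollify h x).derivC
  rw [opL_derivC, opQ_sub, opQ_const, sub_zero] at h1
  refine h1.trans ?_
  gcongr
  refine (CT.norm_le_iff_zero _ hc).2 fun t => ?_
  exact ((CT.mollify h x).norm_iteratedDeriv_le le_rfl t).trans (CT.norm_mollify_le hh hc hx)

/-- The time derivative of `Q_N L x` is `Q_N x`, so the Lipschitz estimate reduces to the sup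
estimate for `Q_N`. -/
theorem lipNorm_opQ_opL_le {N : ℕ} {η : ℝ} (hη : 0 ≤ η)
    (hN : ∀ x : CT n 0, ‖opQ N (opL x)‖ ≤ η * ‖x‖) {x : CT n 0} {c : ℝ} (hc : 0 ≤ c)
    (hx : CT.lipNorm x ≤ ENNReal.ofReal c) :
    CT.lipNorm (opQ N (opL x)) ≤ ENNReal.ofReal (η * c) := by
  rw [CT.lipNorm_le_iff _ (by positivity)]
  refine ⟨(hN x).trans ?_, fun s t => ?_⟩
  · gcongr
    exact ((CT.lipNorm_le_iff x hc).1 hx).1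
  · have := Convex.norm_image_sub_le_of_norm_hasDerivWithin_le (s := univ) (C := η * c)
      (fun t _ => (hasDerivAt_opQ_opL N x t).hasDerivWithinAt)
      (fun t _ => ((opQ N x).norm_apply_le t).trans (norm_opQ_le hη hN hc hx))
      convex_univ (mem_univ t) (mem_univ s)
    simpa using this

theorem eventually_largeEnough {x₀ : CT n 1} (hx₀ : IsC11 x₀) {δ R K : ℝ} (hδ : 0 < δ)
    (hR : 0 < R) (hK : 0 < K) : ∀ᶠ N : ℕ in atTop, LargeEnough x₀ δ R K N := by
  obtain ⟨C, hC⟩ := hx₀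
  let c : ℝ := ‖x₀.derivC‖ + C
  have hc : 0 ≤ c := by positivity
  have hx' : CT.lipNorm x₀.derivC ≤ ENNReal.ofReal c := by
    rw [CT.lipNorm_le_iff _ hc]
    refine ⟨by simp only [c]; linarith [C.2], fun s t => ?_⟩
    have h1 := hC.dist_le_mul s t
    rw [dist_eq_norm, Real.dist_eq] at h1
    rw [CT.derivC_apply, CT.derivC_apply, iteratedDeriv_one]
    refine h1.trans ?_
    gcongr
    simp only [c]
    linarith [norm_nonneg x₀.derivC]
  -- One entry for each requirement in (2). The last handles `Q_N x₀ = Q_N L x₀'`, with `c + 1` to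
  -- avoid dividing by zero.
  let η : ℝ := min (1 / (2 * K)) (min (2 * δ / R) (2 * δ / (c + 1)))
  have hη : 0 < η := by positivity
  have h1 : η ≤ 1 / (2 * K) := min_le_left _ _
  have h2 : η ≤ 2 * δ / R := (min_le_right _ _).trans (min_le_left _ _)
  have h3 : η ≤ 2 * δ / (c + 1) := (min_le_right _ _).trans (min_le_right _ _)
  filter_upwards [eventually_norm_opQ_opL_le n hη] with N hN
  refine ⟨?_, fun x hx => ?_, fun x => (hN x).trans (by gcongr)⟩
  · have h4 := lipNorm_opQ_opL_le hη.le hN hc hx'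
    rw [opL_derivC, opQ_sub, opQ_const, sub_zero] at h4
    refine h4.trans (ENNReal.ofReal_le_ofReal ?_)
    calc η * c ≤ 2 * δ / (c + 1) * (c + 1) := by
          gcongr
          linarith
      _ = 2 * δ := by field_simp
  · obtain ⟨d, hd, hxd⟩ := CT.exists_lipNorm_eq hx
    refine (lipNorm_opQ_opL_le hη.le hN hd hxd.le).trans ?_
    rw [hxd, ← ENNReal.ofReal_mul (by positivity)]
    exact ENNReal.ofReal_le_ofReal (by gcongr)

end Bounds

/-! ### The fixed point problem -/

section FixedPoint

variable {n N : ℕ} {f : C(CT n 0, E n)} {x₀ : CT n 1} {δ R K : ℝ}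

theorem opE_sub (p q : Coeff n N) : opE N (p - q) = opE N p - opE N q := map_sub (opEL n N) p q

theorem jointCk_opE (k : ℕ) (U : Set (Coeff n N)) : CT.JointCk k U (opE (n := n) N) := by
  rw [CT.JointCk.iff_zero]
  refine ContDiff.contDiffOn ?_
  simp only [opE_apply]
  refine ContDiff.sum fun i _ => ContDiff.fun_smul ?_ ?_
  · unfold mode
    split_ifs <;> fun_prop
  · exact (contDiff_apply ℝ (E n) i).comp contDiff_snd

theorem exists_lift_opE (n N : ℕ) :
    ∃ L : Coeff n N →L[ℝ] CT n 1, ∀ p, (L p).incl = opE N p := by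
  obtain ⟨v, -, hv⟩ := (jointCk_opE (n := n) (N := N) 1 univ).exists_lift isOpen_univ
  exact exists_clm_lift (opEL n N).toLinearMap fun p => ⟨v p, hv p (mem_univ p)⟩

/-- Lipschitz bounds pass to `C⁰` limits, so the ball is complete in the metric in which the map
contracts. -/
theorem isClosed_lipBall (x : CT n 0) {ρ : ℝ} (hρ : 0 ≤ ρ) : IsClosed (CT.lipBall x ρ) := by
  have e : CT.lipBall x ρ = {y | ‖y - x‖ ≤ ρ} ∩
      ⋂ (s : ℝ) (t : ℝ), {y | ‖(y - x) s - (y - x) t‖ ≤ ρ * |s - t|} := by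
    ext y
    simp only [mem_inter_iff, mem_iInter]
    exact CT.lipNorm_le_iff _ hρ
  rw [e]
  refine (isClosed_le (by fun_prop) (by fun_prop)).inter
    (isClosed_iInter fun s => isClosed_iInter fun t => isClosed_le ?_ (by fun_prop))
  have hc : ∀ u, Continuous fun y : CT n 0 => (y - x) u := fun u =>
    (CT.evalL n 0 u).continuous.comp (continuous_id.sub continuous_const)
  exact ((hc s).sub (hc t)).norm

theorem exists_lt_of_mem_domU {p : Coeff n N} (hp : p ∈ domU x₀ δ N) :
    ∃ c, 0 ≤ c ∧ c < 2 * δ ∧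
      CT.lipNorm (opE N (p - opR N x₀.incl)) ≤ ENNReal.ofReal c := by
  have hp : CT.lipNorm (opE N (p - opR N x₀.incl)) < ENNReal.ofReal (2 * δ) := hp
  obtain ⟨c, hc, hc'⟩ := CT.exists_lipNorm_eq (hp.trans_le le_top)
  refine ⟨c, hc, ?_, hc'.le⟩
  rw [hc'] at hp
  exact (ENNReal.ofReal_lt_ofReal_iff_of_nonneg hc).1 hp

/-- `E_N` is continuous into `C¹`, whose norm dominates the Lipschitz norm. -/
theorem isOpen_domU : IsOpen (domU x₀ δ N) := by
  rw [isOpen_iff_mem_nhds]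
  intro p hp
  obtain ⟨c, hc, hc2, hc'⟩ := exists_lt_of_mem_domU hp
  obtain ⟨L, hL⟩ := exists_lift_opE n N
  have ht : Tendsto (fun q => ‖L (q - p)‖) (𝓝 p) (𝓝 0) := by
    have : Continuous fun q => ‖L (q - p)‖ := by fun_prop
    exact this.tendsto' p 0 (by simp)
  filter_upwards [ht.eventually (gt_mem_nhds (sub_pos.2 hc2))] with q hq
  show CT.lipNorm (opE N (q - opR N x₀.incl)) < _
  have e : opE N (q - opR N x₀.incl) = opE N (p - opR N x₀.incl) + (L (q - p)).incl := by
    rw [hL, opE_sub, opE_sub, opE_sub]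
    abel
  rw [e]
  refine (CT.lipNorm_add_le hc (norm_nonneg _) hc' (CT.lipNorm_incl_le _)).trans_lt ?_
  rw [ENNReal.ofReal_lt_ofReal_iff_of_nonneg (by positivity)]
  linarith

/-- The radius `6δ` is the sum of three contributions of `2δ`: the parameter, `Q_N x₀` and `Q_N L
F(x)`. The first is strictly smaller on `U`, and this margin keeps all small `C¹` perturbations of
`X(p)` in the ball. -/
theorem exists_lipNorm_opM_le (hδ : 0 < δ) (hR : 0 < R) (hB : HasBounds f x₀ δ R K) (hN : LargeEnough x₀ δ R K N)
    {p : Coeff n N} (hp : p ∈ domU x₀ δ N) :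
    ∃ c, 0 ≤ c ∧ c < 6 * δ ∧ ∀ x ∈ CT.lipBall x₀.incl (6 * δ),
      CT.lipNorm (opM f N x p - x₀.incl) ≤ ENNReal.ofReal c := by
  obtain ⟨c, hc, hc2, hc'⟩ := exists_lt_of_mem_domU hp
  refine ⟨c + 2 * δ + 2 * δ, by positivity, by linarith, fun x hx => ?_⟩
  have h1 : CT.lipNorm (opQ N (opL (opF f x))) ≤ ENNReal.ofReal (2 * δ) := by
    have hF := hB.1 x hx
    refine (hN.2.1 _ (hF.trans_lt ENNReal.ofReal_lt_top)).trans ?_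
    calc _ ≤ ENNReal.ofReal (2 * δ / R) * ENNReal.ofReal R := by gcongr
      _ = ENNReal.ofReal (2 * δ) := by
        rw [← ENNReal.ofReal_mul (by positivity), div_mul_cancel₀ _ hR.ne']
  have h2 : CT.lipNorm (-opQ N x₀.incl) ≤ ENNReal.ofReal (2 * δ) := by
    rw [CT.lipNorm_neg]
    exact hN.1
  have e : opM f N x p - x₀.incl = opE N (p - opR N x₀.incl) + -opQ N x₀.incl
      + opQ N (opL (opF f x)) := by
    have e0 : opQ N x₀.incl = x₀.incl - opE N (opR N x₀.incl) := rfl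
    rw [opE_sub, opM, e0]
    abel
  rw [e]
  have h2δ : 0 ≤ 2 * δ := by positivity
  exact CT.lipNorm_add_le (by positivity) h2δ (CT.lipNorm_add_le hc h2δ hc' h2) h1

theorem norm_opM_sub_le (hK : 0 < K) (hB : HasBounds f x₀ δ R K) (hN : LargeEnough x₀ δ R K N)
    {x y : CT n 0} (hx : x ∈ CT.lipBall x₀.incl (6 * δ))
    (hy : y ∈ CT.lipBall x₀.incl (6 * δ)) (p : Coeff n N) :
    ‖opM f N x p - opM f N y p‖ ≤ 1 / 2 * ‖x - y‖ := by
  have e : opM f N x p - opM f N y p = opQ N (opL (opF f x - opF f y)) := by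
    have h1 : opL (opF f x - opF f y) = opL (opF f x) - opL (opF f y) := by
      rw [sub_eq_add_neg, opL_add, ← neg_one_smul ℝ (opF f y), opL_smul, neg_one_smul,
        ← sub_eq_add_neg]
    rw [h1, opQ_sub, opM, opM]
    abel
  rw [e]
  calc _ ≤ 1 / (2 * K) * (K * ‖x - y‖) := (hN.2.2 _).trans (by gcongr; exact hB.2 x hx y hy)
    _ = 1 / 2 * ‖x - y‖ := by field_simp

theorem existsUnique_fixedPoint (hδ : 0 < δ) (hR : 0 < R) (hK : 0 < K) (hB : HasBounds f x₀ δ R K) (hN : LargeEnough x₀ δ R K N)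
    {p : Coeff n N} (hp : p ∈ domU x₀ δ N) :
    ∃! x : CT n 0, x ∈ CT.lipBall x₀.incl (6 * δ) ∧ x = opM f N x p := by
  obtain ⟨c, hc, hc6, H⟩ := exists_lipNorm_opM_le hδ hR hB hN hp
  have hm : MapsTo (fun x => opM f N x p) (CT.lipBall x₀.incl (6 * δ))
      (CT.lipBall x₀.incl (6 * δ)) := fun x hx =>
    (H x hx).trans (ENNReal.ofReal_le_ofReal hc6.le)
  have hcon : ContractingWith (1 / 2) (hm.restrict _ _ _) := by
    refine ⟨by norm_num, LipschitzWith.of_dist_le_mul fun x y => ?_⟩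
    have h := norm_opM_sub_le hK hB hN x.2 y.2 p
    rw [Subtype.dist_eq, Subtype.dist_eq, dist_eq_norm, dist_eq_norm]
    simpa using h
  have hx0 : x₀.incl ∈ CT.lipBall x₀.incl (6 * δ) := by
    show CT.lipNorm (x₀.incl - x₀.incl) ≤ _
    rw [sub_self, CT.lipNorm_le_iff _ (by positivity)]
    simp only [norm_zero, CT.zero_apply, sub_self]
    exact ⟨by positivity, fun s t => by positivity⟩
  obtain ⟨x, hx, hfix, -⟩ := hcon.exists_fixedPoint'
    (isClosed_lipBall x₀.incl (by positivity)).isComplete hm hx0 (edist_ne_top _ _)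
  refine ⟨x, ⟨hx, hfix.eq.symm⟩, ?_⟩
  rintro y ⟨hy, hy'⟩
  have h := norm_opM_sub_le hK hB hN hy hx p
  rw [← hy', hfix.eq] at h
  have h0 : ‖y - x‖ ≤ 0 := by linarith
  exact sub_eq_zero.1 (norm_le_zero_iff.1 h0)

theorem jointCk_fixedPointMap (hδ : 0 < δ) (hR : 0 < R) (hK : 0 < K) (hB : HasBounds f x₀ δ R K) (hN : LargeEnough x₀ δ R K N)
    {m : ℕ} (hf : IsEC m (j := 0) (fun x : CT n 0 => f x))
    {X : Coeff n N → CT n 0} (hX : IsFixedPointMap f x₀ δ N X) :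
    CT.JointCk m (domU x₀ δ N) X := by
  let T : CT n 0 →L[ℝ] CT n 0 := LinearMap.mkContinuous
    { toFun := fun x => opQ N (opL x)
      map_add' := fun x y => by
        rw [opL_add]
        exact map_add (opQL n N) _ _
      map_smul' := fun c x => by
        rw [opL_smul]
        exact map_smul (opQL n N) _ _ } (1 / (2 * K)) hN.2.2
  have hT : IsSmoothing T (opQL n N) :=
    ⟨fun t x => opQ_opL_shift N t x, fun t x => opQ_shift N t x, fun x t => hasDerivAt_opQ_opL N x t⟩
  refine jointCk_of_fixedPoint hT hf isOpen_domU (fun k => jointCk_opE k _) hK hB.2 hN.2.2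
    (fun p hp a ha => ?_) (fun p hp => (hX p hp).1) fun p hp => (hX p hp).2
  obtain ⟨c, hc, hc6, H⟩ := exists_lipNorm_opM_le hδ hR hB hN hp
  have h1 := H _ (hX p hp).1
  rw [← (hX p hp).2] at h1
  have ht : Tendsto (fun b => ‖b - a‖) (𝓝 a) (𝓝 0) := by
    have : Continuous fun b => ‖b - a‖ := by fun_prop
    exact this.tendsto' a 0 (by simp)
  filter_upwards [ht.eventually (gt_mem_nhds (sub_pos.2 hc6))] with b hb
  show CT.lipNorm (b.incl - x₀.incl) ≤ _
  have e : b.incl - x₀.incl = (X p - x₀.incl) + (b - a).incl := by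
    rw [← ha]
    ext1 t
    simp
  rw [e]
  refine (CT.lipNorm_add_le hc (norm_nonneg _) h1 (CT.lipNorm_incl_le _)).trans
    (ENNReal.ofReal_le_ofReal ?_)
  linarith

end FixedPoint

/-! ### Iterated maps -/

section Iterated

variable {n N : ℕ}

theorem Par.finiteDimensional (n N : ℕ) : ∀ j, FiniteDimensional ℝ (Par n N j)
  | 0 => inferInstanceAs (FiniteDimensional ℝ (Coeff n N))
  | j + 1 =>
    have := Par.finiteDimensional n N j
    inferInstanceAs (FiniteDimensional ℝ (Par n N j × Par n N j))

theorem isOpen_domX {U : Set (Coeff n N)} (hU : IsOpen U) : ∀ j, IsOpen (domX U j)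
  | 0 => hU
  | j + 1 => (isOpen_domX hU j).preimage
      (continuous_fst : Continuous (Prod.fst : Par n N j × Par n N j → Par n N j))

/-- `v` is the map `[p, q] ↦ [u(p), ∂u(p) q]`. -/
def IsTangentMap {j : ℕ} (Ω : Set (Par n N j)) (u : Par n N j → D n j 0)
    (v : Par n N (j + 1) → D n (j + 1) 0) : Prop :=
  ∀ p ∈ Ω, ∃ du : Par n N j →L[ℝ] D n j 0, HasFDerivAt u du p ∧
    ∀ q : Par n N j, D.incl (D.fst (v (Par.pair p q))) = u p ∧ D.snd (v (Par.pair p q)) = du q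

/-- One joint order pays for both components: the lift supplies `u(p)` in `D_j^1`, and the Fréchet
derivative supplies the second entry. -/
theorem exists_isTangentMap {j k : ℕ} {U : Set (Coeff n N)} (hU : IsOpen U)
    {u : Par n N j → D n j 0} (hu : JointCk (k + 1) (domX U j) u) :
    ∃ v : Par n N (j + 1) → D n (j + 1) 0, IsTangentMap (domX U j) u v ∧
      JointCk k (domX U (j + 1)) v := by
  have := Par.finiteDimensional n N j
  have hΩ := isOpen_domX hU j
  obtain ⟨w, hw, hw'⟩ := hu.exists_lift hΩ
  obtain ⟨u', hu', hu'k⟩ := hu.exists_fderiv hΩ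
  have h1 : JointCk k ((domX U j) ×ˢ univ)
      (fun a : Par n N j × Par n N j => D.pair (w a.1) (u' a.1 a.2)) :=
    JointCk.pair (hw.comp contDiffOn_fst fun a ha => ha.1) hu'k
  have e : (domX U (j + 1) : Set (Par n N j × Par n N j)) = (domX U j) ×ˢ univ := by
    ext a
    exact ⟨fun h => ⟨h, mem_univ _⟩, fun h => h.1⟩
  refine ⟨fun a : Par n N j × Par n N j => D.pair (w a.1) (u' a.1 a.2),
    fun p hp => ⟨u' p, hu' p hp, fun q => ⟨hw' p hp, rfl⟩⟩, ?_⟩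
  rw [← e] at h1
  exact h1

open Classical in
/-- The iterated tangent maps of `Z`. -/
def tangentMaps (m : ℕ) (U : Set (Coeff n N)) (Z : Coeff n N → CT n 0) :
    ∀ j, Par n N j → D n j 0
  | 0 => Z
  | j + 1 =>
    -- The order `m - (j + 1)` is built into the choice so that the recursion can continue; the zero
    -- default never occurs for `j < m` when `U` is open and `Z` is jointly `Cᵐ`.
    if h : ∃ v : Par n N (j + 1) → D n (j + 1) 0, IsTangentMap (domX U j) (tangentMaps m U Z j) v ∧
      JointCk (m - (j + 1)) (domX U (j + 1)) v then h.choose else fun _ => 0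

theorem tangentMaps_spec {m : ℕ} {U : Set (Coeff n N)} (hU : IsOpen U) {Z : Coeff n N → CT n 0}
    {j : ℕ} (hj : j < m) (h : JointCk (m - j) (domX U j) (tangentMaps m U Z j)) :
    IsTangentMap (domX U j) (tangentMaps m U Z j) (tangentMaps m U Z (j + 1)) ∧
      JointCk (m - (j + 1)) (domX U (j + 1)) (tangentMaps m U Z (j + 1)) := by
  -- Subtraction is truncated, so `j < m` is needed to have an order left to spend.
  have e : m - j = m - (j + 1) + 1 := by omega
  rw [e] at h
  have hex := exists_isTangentMap hU h
  rw [tangentMaps, dif_pos hex]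
  exact hex.choose_spec

theorem iteratedMapsExist_of_jointCk {m : ℕ} {U : Set (Coeff n N)} (hU : IsOpen U)
    {Z : Coeff n N → CT n 0} (hZ : CT.JointCk m U Z) : IteratedMapsExist m U Z := by
  have key : ∀ j ≤ m, JointCk (m - j) (domX U j) (tangentMaps m U Z j) := by
    intro j
    induction j with
    | zero => exact fun _ => hZ
    | succ j ih => exact fun hj => (tangentMaps_spec hU hj (ih (by omega))).2
  refine ⟨tangentMaps m U Z, fun p _ => rfl,
    fun j hj => (tangentMaps_spec hU hj (key j hj.le)).1,
    fun j hj => ((key j hj).of_le (Nat.zero_le _)).continuousOn (isOpen_domX hU j)⟩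

end Iterated

end PerBVP

end

/-! ### Assembly of the theorem. -/

theorem mainTheorem3 (n jmax : ℕ) (f : C(PerBVP.CT n 0, PerBVP.E n))
    (hf : PerBVP.IsEC jmax (j := 0) (fun x : PerBVP.CT n 0 => f x))
    (x₀ : PerBVP.CT n 1) (hx₀ : PerBVP.IsC11 x₀) :
    (1 ≤ jmax → ∃ δ R K : ℝ, 0 < δ ∧ 0 < R ∧ 0 < K ∧ PerBVP.HasBounds f x₀ δ R K) ∧
    ∀ δ R K : ℝ, 0 < δ → 0 < R → 0 < K → PerBVP.HasBounds f x₀ δ R K →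
      (∀ᶠ N : ℕ in Filter.atTop, PerBVP.LargeEnough x₀ δ R K N) ∧
      ∀ N : ℕ, PerBVP.LargeEnough x₀ δ R K N →
        (∀ p ∈ PerBVP.domU x₀ δ N,
          ∃! x : PerBVP.CT n 0, x ∈ PerBVP.CT.lipBall x₀.incl (6 * δ) ∧
            x = PerBVP.opM f N x p) ∧
        ∀ X : PerBVP.Coeff n N → PerBVP.CT n 0, PerBVP.IsFixedPointMap f x₀ δ N X →
          PerBVP.IteratedMapsExist jmax (PerBVP.domU x₀ δ N) X ∧
          PerBVP.IteratedMapsExist jmax (PerBVP.domU x₀ δ N)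
            (fun p => PerBVP.opF f (X p)) := by

  refine ⟨fun hj => ?_, fun δ R K hδ hR hK hB =>
    ⟨PerBVP.eventually_largeEnough hx₀ hδ hR hK, fun N hN =>
      ⟨fun p hp => PerBVP.existsUnique_fixedPoint hδ hR hK hB hN hp, fun X hX => ?_⟩⟩⟩
  · obtain ⟨-, df, hdf, -⟩ := PerBVP.IsEC.succ_iff.1 (hf.of_le hj)
    exact PerBVP.exists_hasBounds hdf x₀
  · have h := PerBVP.jointCk_fixedPointMap hδ hR hK hB hN hf hX
    exact ⟨PerBVP.iteratedMapsExist_of_jointCk PerBVP.isOpen_domU h,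
      PerBVP.iteratedMapsExist_of_jointCk PerBVP.isOpen_domU
        (PerBVP.jointCk_opF hf PerBVP.isOpen_domU h)⟩
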